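/- Let $N\ge 2$, $0<q<1$ and $k,\kappa\in\mathbb C^\times$. Put $T=(\mathbb C^\times)^N$, let $\mathbb K=\mathcal M(T\times T)$ be the field of meromorphic functions in $(t,\gamma)\in T\times T$ (the quotient field of the ring of holomorphic functions on $T\times T$), let $H_0$ be the Hecke algebra of $S_N$ with generators $T_1,\dots,T_{N-1}$, quadratic relations $(T_i-k)(T_i+k^{-1})=0$ and standard basis $T_w$ ($w\in S_N$), and let $H_0^{\mathbb K}=\mathbb K\otimes H_0$, viewed as the space of $H_0$-valued meromorphic functions on $T\times T$. Let $W=\langle\pi\rangle\ltimes W_Q\simeq S_N\ltimes\mathbb Z^N$ be the extended affine Weyl group of $\mathrm{GL}_N$, where $W_Q$ is the affine Weyl group of type $\widehat A_{N-1}$ with Coxeter generators $s_i$ ($i\in\mathbb Z_N$), $\pi s_i\pi^{-1}=s_{i+1}$, and where the standard basis vectors of $\mathbb Z^N$ are $\epsilon_j=s_{j-1}\cdots s_2s_1\,\pi\, s_{N-1}s_{N-2}\cdots s_j$. Let $\mathbb W=\mathbb Z_2\ltimes(W\times W)$, where the generator $\iota$ of $\mathbb Z_2$ satisfies $\iota(w,w')=(w',w)\iota$.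 The group $\mathbb W$ acts on $T\times T$ by $(s_i,e)(t,\gamma)=(s_it,\gamma)$ for $1\le i<N$ (interchange of $t_i$ and $t_{i+1}$), $(\pi,e)(t,\gamma)=((qt_N,t_1,\dots,t_{N-1}),\gamma)$ and $\iota(t,\gamma)=(\gamma^{-1},t^{-1})$. Let $\tau$ be the action of $\mathbb W$ on $H_0^{\mathbb K}$ by $\mathbb C$-linear automorphisms $$(\tau(\mathrm w)f)(t,\gamma)=C_{\mathrm w}(t,\gamma)\,f(\mathrm w^{-1}(t,\gamma)),$$ which is determined by the following values of the cocycle $C$: $$C_{(s_i,e)}(t,\gamma)h=h+\frac{1-t_{i+1}/t_i}{k-k^{-1}t_{i+1}/t_i}\,(T_i-k)h\quad(1\le i<N),\qquad C_{(\pi,e)}(t,\gamma)T_w=\gamma_{w^{-1}(N)}T_{\sigma w},\qquad C_\iota T_w=T_{w^{-1}},$$ where $h\in H_0$, $w\in S_N$ and $\sigma=s_1s_2\cdots s_{N-1}$. For $\lambda,\mu\in\mathbb Z^N$ one has $(\tau(\lambda,\mu)f)(t,\gamma)=C_{(\lambda,\mu)}(t,\gamma)f(q^{-\lambda}t,q^{\mu}\gamma)$.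 Put $\theta(z)=\prod_{m\ge0}(1-q^mz)(1-q^{m+1}/z)$, $\delta=(N-1,N-3,\dots,1-N)$, $$W_\kappa(t,\gamma)=\prod_{i=1}^N\frac{\theta(\kappa t_i\gamma_{N-i+1}^{-1})}{\theta(\kappa k^{\delta_i}t_i)\,\theta(\kappa k^{-\delta_i}\gamma_{N-i+1}^{-1})},$$ $$D_{(\lambda,\mu)}(t,\gamma)=W_\kappa(t,\gamma)^{-1}C_{(\lambda,\mu)}(t,\gamma)W_\kappa(q^{-\lambda}t,q^\mu\gamma).$$ Let $w_0\in S_N$ be the longest element, $Q_+=\bigoplus_{i=1}^{N-1}\mathbb Z_{\ge0}\,\alpha_i$ with $\alpha_i=\epsilon_i-\epsilon_{i+1}$ (so $t^{\alpha_i}=t_i/t_{i+1}$), and for $\varepsilon>0$ let $B_\varepsilon=\{t\in T:\ |t^{\alpha_i}|<\varepsilon\ \text{for } 1\le i<N\}$ and $B_\varepsilon^{-1}=\{t\in T:\ t^{-1}\in B_\varepsilon\}$. **Theorem.** There is a unique $\Psi\in H_0^{\mathbb K}$ such that $$D_{(\lambda,\mu)}(t,\gamma)\Psi(q^{-\lambda}t,q^\mu\gamma)=\Psi(t,\gamma)\qquad\text{for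 all }\lambda,\mu\in\mathbb Z^N$$ and such that, for some $\varepsilon>0$, $$\Psi(t,\gamma)=\sum_{\alpha,\beta\in Q_+}K_{\alpha,\beta}\,t^{-\alpha}\gamma^{\beta}\qquad (K_{\alpha,\beta}\in H_0),\qquad K_{0,0}=T_{w_0},$$ for $(t,\gamma)\in B_\varepsilon^{-1}\times B_\varepsilon$, with normal convergence on compacta of $B_\varepsilon^{-1}\times B_\varepsilon$. The basic asymptotically free solution $\Phi_\kappa:=W_\kappa\Psi$ is self-dual: $$\tau(\iota)\Phi_\kappa=\Phi_\kappa,$$ that is, $\Phi_\kappa(t,\gamma)=C_\iota\,\Phi_\kappa(\gamma^{-1},t^{-1})$ as $H_0$-valued meromorphic functions in $(t,\gamma)\in T\times T$. -/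

import Mathlib

namespace BqKZ

noncomputable section

/-- The complex torus `T = (ℂ \ {0})^N` with `N = n + 2`. -/
abbrev Torus (n : ℕ) : Type := Fin (n + 2) → ℂˣ

/-- The inclusion of `T × T` in the complex vector space `ℂ^N × ℂ^N`; it is an open subset. -/
def emb (n : ℕ) (p : Torus n × Torus n) : (Fin (n + 2) → ℂ) × (Fin (n + 2) → ℂ) :=
  (fun i => (p.1 i : ℂ), fun i => (p.2 i : ℂ))

/-- Holomorphic functions on `T × T`. -/
def IsHol (n : ℕ) (f : Torus n × Torus n → ℂ) : Prop :=
  ∃ F : (Fin (n + 2) → ℂ) × (Fin (n + 2) → ℂ) → ℂ,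
    AnalyticOnNhd ℂ F (Set.range (emb n)) ∧ ∀ p, f p = F (emb n p)

/-- The ring `𝒪(T × T)` of holomorphic functions on `T × T`. -/
def Hol (n : ℕ) : Subalgebra ℂ (Torus n × Torus n → ℂ) where
  carrier := {f | IsHol n f}
  mul_mem' := by
    rintro f g ⟨F, hF, hf⟩ ⟨G, hG, hg⟩
    exact ⟨F * G, hF.mul hG, fun p => by simp [hf, hg]⟩
  add_mem' := by
    rintro f g ⟨F, hF, hf⟩ ⟨G, hG, hg⟩
    exact ⟨F + G, hF.add hG, fun p => by simp [hf, hg]⟩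
  algebraMap_mem' c := ⟨fun _ => c, analyticOnNhd_const, fun p => rfl⟩

theorem range_emb (n : ℕ) : Set.range (emb n) =
    (Set.univ.pi fun _ => ({0}ᶜ : Set ℂ)) ×ˢ (Set.univ.pi fun _ => ({0}ᶜ : Set ℂ)) := by
  ext z
  constructor
  · rintro ⟨p, rfl⟩
    simp [emb]
  · intro hz
    simp only [Set.mem_prod, Set.mem_pi, Set.mem_univ, forall_const, Set.mem_compl_iff,
      Set.mem_singleton_iff] at hz
    exact ⟨(fun i => Units.mk0 (z.1 i) (hz.1 i), fun i => Units.mk0 (z.2 i) (hz.2 i)), rfl⟩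

theorem isOpen_range_emb (n : ℕ) : IsOpen (Set.range (emb n)) := by
  rw [range_emb]
  exact (isOpen_set_pi Set.finite_univ fun _ _ => isOpen_compl_singleton).prod
    (isOpen_set_pi Set.finite_univ fun _ _ => isOpen_compl_singleton)

theorem isPreconnected_range_emb (n : ℕ) : IsPreconnected (Set.range (emb n)) := by
  rw [range_emb]
  have h : IsPreconnected ({0}ᶜ : Set ℂ) :=
    (isConnected_compl_singleton_of_one_lt_rank (by simp) 0).isPreconnected
  exact (isPreconnected_univ_pi fun _ => h).prod (isPreconnected_univ_pi fun _ => h)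

instance instIsDomainHol (n : ℕ) : IsDomain (Hol n) := by
  have : NoZeroDivisors (Hol n) := by
    constructor
    rintro ⟨f, F, hF, hf⟩ ⟨g, G, hG, hg⟩ h
    by_contra! hne
    obtain ⟨hf0, hg0⟩ := hne
    have h' : ∀ p, F (emb n p) * G (emb n p) = 0 := fun p => by
      have := congrFun (congrArg Subtype.val h) p
      simpa [← hf, ← hg] using this
    obtain ⟨p, hp⟩ : ∃ p, f p ≠ 0 := by
      by_contra! hc
      exact hf0 (Subtype.ext (funext hc))
    have hFp : ∀ᶠ z in nhds (emb n p), F z ≠ 0 :=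
      (hF _ ⟨p, rfl⟩).continuousAt.eventually_ne (by rwa [← hf])
    have hmem : ∀ᶠ z in nhds (emb n p), z ∈ Set.range (emb n) :=
      (isOpen_range_emb n).mem_nhds ⟨p, rfl⟩
    have hG0 : G =ᶠ[nhds (emb n p)] 0 := by
      filter_upwards [hFp, hmem] with z hz hz'
      obtain ⟨p', rfl⟩ := hz'
      simpa [hz] using h' p'
    have := hG.eqOn_zero_of_preconnected_of_eventuallyEq_zero (isPreconnected_range_emb n)
      ⟨p, rfl⟩ hG0
    exact hg0 (Subtype.ext (funext fun p' => by
      have := this ⟨p', rfl⟩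
      simpa [hg] using this))
  have : Nontrivial (Hol n) := inferInstance
  exact NoZeroDivisors.to_isDomain _

/-- The field `𝕂 = ℳ(T × T)` of meromorphic functions on `T × T`, as the quotient field of the
ring of holomorphic functions (`T × T` is a connected Stein manifold). -/
def Mer (n : ℕ) : Type := FractionRing (Hol n)

instance instFieldMer (n : ℕ) : Field (Mer n) := inferInstanceAs (Field (FractionRing (Hol n)))

instance instAlgebraHolMer (n : ℕ) : Algebra (Hol n) (Mer n) :=
  inferInstanceAs (Algebra (Hol n) (FractionRing (Hol n)))

instance instAlgebraMer (n : ℕ) : Algebra ℂ (Mer n) :=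
  inferInstanceAs (Algebra ℂ (FractionRing (Hol n)))

instance instIsScalarTowerMer (n : ℕ) : IsScalarTower ℂ (Hol n) (Mer n) :=
  IsScalarTower.of_algebraMap_eq fun _ => rfl

instance instIsFractionRingMer (n : ℕ) : IsFractionRing (Hol n) (Mer n) :=
  inferInstanceAs (IsFractionRing (Hol n) (FractionRing (Hol n)))

/-- Holomorphic self-maps of `T × T`. -/
def IsHolMap (n : ℕ) (φ : Torus n × Torus n → Torus n × Torus n) : Prop :=
  ∃ F : (Fin (n + 2) → ℂ) × (Fin (n + 2) → ℂ) → (Fin (n + 2) → ℂ) × (Fin (n + 2) → ℂ),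
    AnalyticOnNhd ℂ F (Set.range (emb n)) ∧ ∀ p, emb n (φ p) = F (emb n p)

/-- The group of biholomorphic self-maps of `T × T`. -/
def Bihol (n : ℕ) : Subgroup (Equiv.Perm (Torus n × Torus n)) where
  carrier := {φ | IsHolMap n φ ∧ IsHolMap n φ.symm}
  mul_mem' := by
    have key : ∀ φ ψ : Torus n × Torus n → Torus n × Torus n,
        IsHolMap n φ → IsHolMap n ψ → IsHolMap n (φ ∘ ψ) := by
      rintro φ ψ ⟨F, hF, hf⟩ ⟨G, hG, hg⟩
      refine ⟨F ∘ G, hF.comp hG ?_, fun p => by simp [hf, hg]⟩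
      rintro _ ⟨p, rfl⟩
      exact ⟨ψ p, hg p⟩
    rintro φ ψ ⟨h1, h2⟩ ⟨h3, h4⟩
    exact ⟨key φ ψ h1 h3, key ψ.symm φ.symm h4 h2⟩
  one_mem' := ⟨⟨id, analyticOnNhd_id, fun p => rfl⟩, ⟨id, analyticOnNhd_id, fun p => rfl⟩⟩
  inv_mem' := fun h => ⟨h.2, h.1⟩

theorem IsHol.comp {n : ℕ} {f : Torus n × Torus n → ℂ}
    {φ : Torus n × Torus n → Torus n × Torus n} (hf : IsHol n f) (hφ : IsHolMap n φ) :
    IsHol n (f ∘ φ) := by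
  obtain ⟨F, hF, hf⟩ := hf
  obtain ⟨G, hG, hg⟩ := hφ
  refine ⟨F ∘ G, hF.comp hG ?_, fun p => by simp [hf, hg]⟩
  rintro _ ⟨p, rfl⟩
  exact ⟨φ p, hg p⟩

/-- The action `(φ f)(p) = f(φ⁻¹ p)` on holomorphic functions. -/
def actHol (n : ℕ) : Bihol n →* (Hol n ≃ₐ[ℂ] Hol n) where
  toFun φ :=
    { toFun := fun f => ⟨fun p => f.1 (φ.1.symm p), f.2.comp φ.2.2⟩
      invFun := fun f => ⟨fun p => f.1 (φ.1 p), f.2.comp φ.2.1⟩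
      left_inv := fun f => Subtype.ext (funext fun p => by simp)
      right_inv := fun f => Subtype.ext (funext fun p => by simp)
      map_mul' := fun f g => rfl
      map_add' := fun f g => rfl
      commutes' := fun c => rfl }
  map_one' := rfl
  map_mul' φ ψ := rfl

/-- The induced action `(φ f)(p) = f(φ⁻¹ p)` on meromorphic functions. -/
def act (n : ℕ) : Bihol n →* (Mer n ≃ₐ[ℂ] Mer n) where
  toFun φ := IsFractionRing.algEquivOfAlgEquiv (actHol n φ)
  map_one' := by
    ext x
    obtain ⟨a, b, -, rfl⟩ := IsFractionRing.div_surjective (Hol n) x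
    simp
  map_mul' φ ψ := by
    ext x
    obtain ⟨a, b, -, rfl⟩ := IsFractionRing.div_surjective (Hol n) x
    simp

theorem act_algebraMap {n : ℕ} (φ : Bihol n) (f : Hol n) :
    act n φ (algebraMap (Hol n) (Mer n) f) = algebraMap (Hol n) (Mer n) (actHol n φ f) := by
  simp [act]

/-- The parameter `q ∈ (0, 1)`, as a nonzero complex number. -/
def qC (q : Set.Ioo (0 : ℝ) 1) : ℂˣ := Units.mk0 ((q : ℝ) : ℂ) (by exact_mod_cast q.2.1.ne')

theorem isHol_fst {n : ℕ} (i : Fin (n + 2)) :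
    IsHol n (fun p : Torus n × Torus n => (p.1 i : ℂ)) :=
  ⟨fun z => z.1 i, fun _ _ => ((ContinuousLinearMap.proj (R := ℂ) (φ := fun _ => ℂ) i).comp
    (ContinuousLinearMap.fst ℂ (Fin (n + 2) → ℂ) (Fin (n + 2) → ℂ))).analyticAt _, fun _ => rfl⟩

theorem isHol_snd {n : ℕ} (i : Fin (n + 2)) :
    IsHol n (fun p : Torus n × Torus n => (p.2 i : ℂ)) :=
  ⟨fun z => z.2 i, fun _ _ => ((ContinuousLinearMap.proj (R := ℂ) (φ := fun _ => ℂ) i).comp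
    (ContinuousLinearMap.snd ℂ (Fin (n + 2) → ℂ) (Fin (n + 2) → ℂ))).analyticAt _, fun _ => rfl⟩

theorem isHol_const {n : ℕ} (c : ℂ) : IsHol n (fun _ : Torus n × Torus n => c) :=
  ⟨fun _ => c, analyticOnNhd_const, fun _ => rfl⟩

theorem IsHol.mul {n : ℕ} {f g : Torus n × Torus n → ℂ} (hf : IsHol n f) (hg : IsHol n g) :
    IsHol n (fun p => f p * g p) := (Hol n).mul_mem hf hg

theorem IsHol.inv {n : ℕ} {f : Torus n × Torus n → ℂ} (hf : IsHol n f) (h0 : ∀ p, f p ≠ 0) :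
    IsHol n (fun p => (f p)⁻¹) := by
  obtain ⟨F, hF, hf⟩ := hf
  refine ⟨fun z => (F z)⁻¹, hF.inv ?_, fun p => by simp only [hf]⟩
  rintro _ ⟨p, rfl⟩
  rw [← hf]
  exact h0 p

theorem isHolMap_of {n : ℕ} {φ : Torus n × Torus n → Torus n × Torus n}
    (h1 : ∀ i, IsHol n (fun p => ((φ p).1 i : ℂ))) (h2 : ∀ i, IsHol n (fun p => ((φ p).2 i : ℂ))) :
    IsHolMap n φ := by
  choose F hF hf using h1
  choose G hG hg using h2
  refine ⟨fun z => (fun i => F i z, fun i => G i z), ?_, fun p => ?_⟩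
  · intro z hz
    exact AnalyticAt.prod (analyticAt_pi_iff.2 fun i => hF i z hz)
      (analyticAt_pi_iff.2 fun i => hG i z hz)
  · exact Prod.ext (funext fun i => hf i p) (funext fun i => hg i p)

/-- The clockwise rotation `σ ∈ S_N`, mapping `N` to `1` and all other `i` to `i + 1`. -/
def rot (n : ℕ) : Equiv.Perm (Fin (n + 2)) := finRotate (n + 2)

theorem rot_last (n : ℕ) : rot n (Fin.last (n + 1)) = 0 := finRotate_last

theorem rot_symm_zero (n : ℕ) : (rot n).symm 0 = Fin.last (n + 1) := by
  rw [Equiv.symm_apply_eq, rot_last]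

theorem rot_castSucc {n : ℕ} (i : Fin (n + 1)) : rot n i.castSucc = i.succ := by
  rw [rot, finRotate_apply]
  simp

theorem rot_eq_zero_iff {n : ℕ} (j : Fin (n + 2)) : rot n j = 0 ↔ j = Fin.last (n + 1) := by
  rw [← rot_last, EmbeddingLike.apply_eq_iff_eq]

/-- The coordinate functions `x_i` (first torus) as meromorphic functions on `T × T`. -/
def xM {n : ℕ} (i : Fin (n + 2)) : Mer n := algebraMap (Hol n) (Mer n) ⟨_, isHol_fst i⟩

/-- The coordinate functions `y_i` (second torus) as meromorphic functions on `T × T`. -/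
def yM {n : ℕ} (i : Fin (n + 2)) : Mer n := algebraMap (Hol n) (Mer n) ⟨_, isHol_snd i⟩

/-- The action of `(w, e)`, `w ∈ S_N`, on `T × T`: `(w t)_j = t_{w⁻¹(j)}`. -/
def permB {n : ℕ} (w : Equiv.Perm (Fin (n + 2))) : Bihol n :=
  ⟨{ toFun := fun p => (fun j => p.1 (w⁻¹ j), p.2)
     invFun := fun p => (fun j => p.1 (w j), p.2)
     left_inv := fun p => by simp
     right_inv := fun p => by simp },
   isHolMap_of (fun _ => isHol_fst _) (fun _ => isHol_snd _),
   isHolMap_of (fun _ => isHol_fst _) (fun _ => isHol_snd _)⟩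

/-- The action of `(π, e)` on `T × T`: `π (t_1, …, t_N) = (q t_N, t_1, …, t_{N-1})`. -/
def piB {n : ℕ} (q : Set.Ioo (0 : ℝ) 1) : Bihol n :=
  ⟨{ toFun := fun p =>
       (fun j => (if j = 0 then qC q else 1) * p.1 ((rot n)⁻¹ j), p.2)
     invFun := fun p =>
       (fun j => (if j = Fin.last (n + 1) then (qC q)⁻¹ else 1) * p.1 (rot n j), p.2)
     left_inv := fun p => by
       refine Prod.ext (funext fun j => ?_) rfl
       by_cases h : j = Fin.last (n + 1)
       · subst h
         simp [rot_last, rot_symm_zero]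
       · simp [rot_eq_zero_iff, h]
     right_inv := fun p => by
       refine Prod.ext (funext fun j => ?_) rfl
       obtain ⟨i, rfl⟩ := (rot n).surjective j
       by_cases h : i = Fin.last (n + 1)
       · subst h
         simp [rot_last, rot_symm_zero]
       · simp [rot_eq_zero_iff, h] },
   isHolMap_of (fun j => by
     simp only [Equiv.coe_fn_mk, Units.val_mul]
     exact (isHol_const _).mul (isHol_fst _)) (fun _ => isHol_snd _),
   isHolMap_of (fun j => by
     simp only [Equiv.coe_fn_symm_mk, Units.val_mul]
     exact (isHol_const _).mul (isHol_fst _)) (fun _ => isHol_snd _)⟩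

/-- The action of `ι` on `T × T`: `ι (t, γ) = (γ⁻¹, t⁻¹)`. -/
def iotaB {n : ℕ} : Bihol n :=
  ⟨{ toFun := fun p => (p.2⁻¹, p.1⁻¹)
     invFun := fun p => (p.2⁻¹, p.1⁻¹)
     left_inv := fun p => by simp
     right_inv := fun p => by simp },
   isHolMap_of
     (fun j => by
       simpa using (isHol_snd j).inv fun p => (p.2 j).ne_zero)
     (fun j => by
       simpa using (isHol_fst j).inv fun p => (p.1 j).ne_zero),
   isHolMap_of
     (fun j => by
       simpa using (isHol_snd j).inv fun p => (p.2 j).ne_zero)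
     (fun j => by
       simpa using (isHol_fst j).inv fun p => (p.1 j).ne_zero)⟩

/-- The renormalized Jacobi theta function `θ(z) = ∏_{m ≥ 0} (1 - q^m z)(1 - q^{m+1}/z)`. -/
def theta (q : Set.Ioo (0 : ℝ) 1) (z : ℂ) : ℂ :=
  ∏' m : ℕ, (1 - (qC q : ℂ) ^ m * z) * (1 - (qC q : ℂ) ^ (m + 1) / z)

theorem analyticOnNhd_theta (q : Set.Ioo (0 : ℝ) 1) : AnalyticOnNhd ℂ (theta q) {0}ᶜ := by
  have hopen : IsOpen ({0}ᶜ : Set ℂ) := isOpen_compl_singleton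
  have hq : ‖(qC q : ℂ)‖ = (q : ℝ) := by
    simp only [qC, Units.val_mk0, Complex.norm_real, Real.norm_eq_abs, abs_of_pos q.2.1]
  have hlim : HasProdLocallyUniformlyOn
      (fun (m : ℕ) z => (1 - (qC q : ℂ) ^ m * z) * (1 - (qC q : ℂ) ^ (m + 1) / z))
      (theta q) {0}ᶜ := by
    apply hasProdLocallyUniformlyOn_of_forall_compact hopen
    intro K hK hcK
    have hc1 : ContinuousOn (fun z : ℂ => ‖z‖ + ‖z⁻¹‖ + 1) K := by
      refine ContinuousOn.add (ContinuousOn.add (by fun_prop) ?_) (by fun_prop)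
      exact (continuousOn_id.inv₀ fun z hz => hK hz).norm
    obtain ⟨C, hC⟩ := hcK.bddAbove_image hc1
    have hsum : Summable fun m : ℕ => C * (q : ℝ) ^ m :=
      (summable_geometric_of_lt_one q.2.1.le q.2.2).mul_left C
    have := hsum.hasProdUniformlyOn_nat_one_add
      (f := fun (m : ℕ) (z : ℂ) =>
        (1 - (qC q : ℂ) ^ m * z) * (1 - (qC q : ℂ) ^ (m + 1) / z) - 1) hcK
      (.of_forall fun m z hz => ?_) (fun m => ?_)
    · simp only [add_sub_cancel] at this
      exact this
    · have hz0 : z ≠ 0 := hK hz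
      have e : (1 - (qC q : ℂ) ^ m * z) * (1 - (qC q : ℂ) ^ (m + 1) / z) - 1 =
          (qC q : ℂ) ^ m * (-z + -(qC q : ℂ) * z⁻¹ + (qC q : ℂ) ^ (m + 1)) := by
        field_simp
        ring
      rw [e, norm_mul, norm_pow, hq, mul_comm]
      refine mul_le_mul_of_nonneg_right ?_ (pow_nonneg q.2.1.le _)
      refine le_trans ?_ (hC ⟨z, hz, rfl⟩)
      refine (norm_add₃_le).trans ?_
      rw [norm_neg, norm_mul, norm_neg, norm_pow, hq]
      have h1 : (q : ℝ) * ‖z⁻¹‖ ≤ ‖z⁻¹‖ :=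
        mul_le_of_le_one_left (norm_nonneg _) q.2.2.le
      have h2 : (q : ℝ) ^ (m + 1) ≤ 1 := pow_le_one₀ q.2.1.le q.2.2.le
      linarith
    · have hd : ContinuousOn (fun z : ℂ => (qC q : ℂ) ^ (m + 1) / z) K :=
        continuousOn_const.div continuousOn_id fun z hz => hK hz
      exact ((Continuous.continuousOn (by fun_prop)).mul (continuousOn_const.sub hd)).sub
        continuousOn_const
  refine DifferentiableOn.analyticOnNhd ?_ hopen
  refine hlim.differentiableOn (.of_forall fun s => ?_) hopen
  refine DifferentiableOn.fun_finsetProd fun m _ => ?_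
  have hd : DifferentiableOn ℂ (fun z : ℂ => (qC q : ℂ) ^ (m + 1) / z) {0}ᶜ :=
    (differentiableOn_const _).div differentiableOn_id fun z hz => hz
  exact (Differentiable.differentiableOn (by fun_prop)).mul ((differentiableOn_const _).sub hd)

/-- The holomorphic function `θ(u(t, γ))` for a nowhere vanishing holomorphic function `u`. -/
def thetaHol {n : ℕ} (q : Set.Ioo (0 : ℝ) 1) (u : Torus n × Torus n → ℂˣ)
    (hu : IsHol n fun p => (u p : ℂ)) : Hol n :=
  ⟨fun p => theta q (u p), by
    obtain ⟨F, hF, hf⟩ := hu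
    refine ⟨theta q ∘ F, (analyticOnNhd_theta q).comp hF ?_, fun p => by simp [hf]⟩
    rintro _ ⟨p, rfl⟩
    simp [← hf]⟩

theorem isHol_mul_fst {n : ℕ} (c : ℂˣ) (i : Fin (n + 2)) :
    IsHol n fun p : Torus n × Torus n => ((c * p.1 i : ℂˣ) : ℂ) := by
  simpa using (isHol_const _).mul (isHol_fst i)

theorem isHol_mul_inv_snd {n : ℕ} (c : ℂˣ) (i : Fin (n + 2)) :
    IsHol n fun p : Torus n × Torus n => ((c * (p.2 i)⁻¹ : ℂˣ) : ℂ) := by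
  simpa using (isHol_const _).mul ((isHol_snd i).inv fun p => (p.2 i).ne_zero)

theorem isHol_mul_fst_mul_inv_snd {n : ℕ} (c : ℂˣ) (i j : Fin (n + 2)) :
    IsHol n fun p : Torus n × Torus n => ((c * p.1 i * (p.2 j)⁻¹ : ℂˣ) : ℂ) := by
  simpa using ((isHol_const _).mul (isHol_fst i)).mul
    ((isHol_snd j).inv fun p => (p.2 j).ne_zero)

/-- The coordinates of `δ = (N - 1, N - 3, …, 1 - N)`. -/
def delta {n : ℕ} (i : Fin (n + 2)) : ℤ := (n + 1 : ℤ) - 2 * (i : ℕ)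

/-- The meromorphic function
`W_κ(t, γ) = ∏_i θ(κ t_i / γ_{N-i+1}) / (θ(κ k^{δ_i} t_i) θ(κ k^{-δ_i} / γ_{N-i+1}))`. -/
def Wk (n : ℕ) (q : Set.Ioo (0 : ℝ) 1) (k κ : ℂˣ) : Mer n :=
  ∏ i : Fin (n + 2),
    algebraMap (Hol n) (Mer n) (thetaHol q _ (isHol_mul_fst_mul_inv_snd κ i i.rev)) /
      (algebraMap (Hol n) (Mer n) (thetaHol q _ (isHol_mul_fst (κ * k ^ delta i) i)) *
        algebraMap (Hol n) (Mer n) (thetaHol q _ (isHol_mul_inv_snd (κ * k ^ (-delta i)) i.rev)))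

theorem act_perm_xM {n : ℕ} (w : Equiv.Perm (Fin (n + 2))) (j : Fin (n + 2)) :
    act n (permB w) (xM j) = xM (w j) := act_algebraMap _ _

theorem act_perm_yM {n : ℕ} (w : Equiv.Perm (Fin (n + 2))) (j : Fin (n + 2)) :
    act n (permB w) (yM j) = yM j := act_algebraMap _ _

theorem act_pi_yM {n : ℕ} (q : Set.Ioo (0 : ℝ) 1) (j : Fin (n + 2)) :
    act n (piB q) (yM j) = yM j := act_algebraMap _ _

theorem act_pi_xM {n : ℕ} (q : Set.Ioo (0 : ℝ) 1) (j : Fin (n + 2)) :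
    act n (piB q) (xM j) =
      algebraMap ℂ (Mer n) (if j = Fin.last (n + 1) then (qC q : ℂ)⁻¹ else 1) * xM (rot n j) := by
  rw [xM, act_algebraMap, IsScalarTower.algebraMap_apply ℂ (Hol n) (Mer n), xM, ← map_mul]
  congr 1
  refine Subtype.ext (funext fun p => ?_)
  change (((if j = Fin.last (n + 1) then (qC q)⁻¹ else 1) * p.1 (rot n j) : ℂˣ) : ℂ) =
    (if j = Fin.last (n + 1) then (qC q : ℂ)⁻¹ else 1) * (p.1 (rot n j) : ℂ)
  split_ifs <;> simp

theorem act_iota_xM {n : ℕ} (j : Fin (n + 2)) : act n iotaB (xM j) = (yM j)⁻¹ := by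
  refine eq_inv_of_mul_eq_one_left ?_
  rw [xM, act_algebraMap, yM, ← map_mul, ← map_one (algebraMap (Hol n) (Mer n))]
  congr 1
  refine Subtype.ext (funext fun p => ?_)
  change (((p.2 j)⁻¹ : ℂˣ) : ℂ) * (p.2 j : ℂ) = 1
  simp

theorem act_iota_yM {n : ℕ} (j : Fin (n + 2)) : act n iotaB (yM j) = (xM j)⁻¹ := by
  refine eq_inv_of_mul_eq_one_left ?_
  rw [yM, act_algebraMap, xM, ← map_mul, ← map_one (algebraMap (Hol n) (Mer n))]
  congr 1
  refine Subtype.ext (funext fun p => ?_)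
  change (((p.1 j)⁻¹ : ℂˣ) : ℂ) * (p.1 j : ℂ) = 1
  simp

theorem algebraMap_Hol_injective (n : ℕ) : Function.Injective (algebraMap (Hol n) (Mer n)) :=
  IsFractionRing.injective _ _

theorem xM_ne_zero {n : ℕ} (j : Fin (n + 2)) : (xM j : Mer n) ≠ 0 := by
  rw [xM, Ne, ← map_zero (algebraMap (Hol n) (Mer n)), (algebraMap_Hol_injective n).eq_iff]
  intro h
  have := congrFun (congrArg Subtype.val h) (1, 1)
  simp at this

theorem yM_ne_zero {n : ℕ} (j : Fin (n + 2)) : (yM j : Mer n) ≠ 0 := by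
  rw [yM, Ne, ← map_zero (algebraMap (Hol n) (Mer n)), (algebraMap_Hol_injective n).eq_iff]
  intro h
  have := congrFun (congrArg Subtype.val h) (1, 1)
  simp at this

theorem sub_xM_ne_zero {n : ℕ} (c d : ℂ) (hd : d ≠ 0) {a b : Fin (n + 2)} (hab : a ≠ b) :
    algebraMap ℂ (Mer n) c * xM a - algebraMap ℂ (Mer n) d * xM b ≠ 0 := by
  rw [IsScalarTower.algebraMap_apply ℂ (Hol n) (Mer n),
    IsScalarTower.algebraMap_apply ℂ (Hol n) (Mer n), xM, xM, ← map_mul, ← map_mul, ← map_sub, Ne,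
    ← map_zero (algebraMap (Hol n) (Mer n)), (algebraMap_Hol_injective n).eq_iff]
  intro h
  have h1 := congrFun (congrArg Subtype.val h) (1, 1)
  have h2 := congrFun (congrArg Subtype.val h) (Function.update 1 b (Units.mk0 2 two_ne_zero), 1)
  change c * 1 - d * 1 = 0 at h1
  change c * ((Function.update (1 : Torus n) b (Units.mk0 2 two_ne_zero) a : ℂˣ) : ℂ) -
    d * ((Function.update (1 : Torus n) b (Units.mk0 2 two_ne_zero) b : ℂˣ) : ℂ) = 0 at h2
  simp only [Function.update_of_ne hab, Function.update_self, Pi.one_apply, Units.val_one,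
    Units.val_mk0] at h2
  exact hd (by linear_combination h1 - h2)

/-- The space `H_0^𝕂 = 𝕂 ⊗ H_0`, where `H_0` is the finite Hecke algebra of type `A_{N-1}`:
an element is given by its coordinates with respect to the standard basis `T_w` (`w ∈ S_N`). -/
abbrev H0K (n : ℕ) : Type := Equiv.Perm (Fin (n + 2)) → Mer n

/-- The action of an automorphism of `𝕂` on the coefficients of an element of `H_0^𝕂`. -/
def coefAct {n : ℕ} (φ : Bihol n) : H0K n ≃ₗ[ℂ] H0K n where
  toFun f w := act n φ (f w)
  invFun f w := act n φ⁻¹ (f w)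
  left_inv f := funext fun w => by
    change (act n φ⁻¹ * act n φ) (f w) = f w
    rw [← map_mul, inv_mul_cancel, map_one]
    rfl
  right_inv f := funext fun w => by
    change (act n φ * act n φ⁻¹) (f w) = f w
    rw [← map_mul, mul_inv_cancel, map_one]
    rfl
  map_add' f g := funext fun w => map_add (act n φ) _ _
  map_smul' c f := funext fun w => map_smul (act n φ) _ _

theorem coefAct_apply {n : ℕ} (φ : Bihol n) (f : H0K n) (w : Equiv.Perm (Fin (n + 2))) :
    coefAct φ f w = act n φ (f w) := rfl

theorem coefAct_coefAct {n : ℕ} (φ ψ : Bihol n) (f : H0K n) :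
    coefAct φ (coefAct ψ f) = coefAct (φ * ψ) f :=
  funext fun w => by simp only [coefAct_apply, map_mul, AlgEquiv.mul_apply]

theorem coefAct_smul {n : ℕ} (φ : Bihol n) (c : Mer n) (f : H0K n) :
    coefAct φ (c • f) = act n φ c • coefAct φ f :=
  funext fun _ => map_mul (act n φ) _ _

/-- The simple transposition `s_i = (i, i + 1)` of `S_N`, for `i = 0, …, N - 2`. -/
abbrev si {n : ℕ} (i : Fin (n + 1)) : Equiv.Perm (Fin (n + 2)) := Equiv.swap i.castSucc i.succ

/-- Left multiplication by `T_i` on the Hecke algebra: `T_i T_w = T_{s_i w}` if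
`ℓ(s_i w) = ℓ(w) + 1`, and `T_i T_w = (k - k⁻¹) T_w + T_{s_i w}` if `ℓ(s_i w) = ℓ(w) - 1`.
The latter case is characterized by `w⁻¹(i + 1) < w⁻¹(i)`. -/
def heckeL {n : ℕ} (k : ℂˣ) (i : Fin (n + 1)) : Module.End (Mer n) (H0K n) where
  toFun f w := f (si i * w) +
    (if w⁻¹ i.succ < w⁻¹ i.castSucc then
      algebraMap ℂ (Mer n) ((k : ℂ) - (k : ℂ)⁻¹) * f w else 0)
  map_add' f g := funext fun w => by
    simp only [Pi.add_apply]
    split_ifs <;> ring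
  map_smul' c f := funext fun w => by
    simp only [Pi.smul_apply, smul_eq_mul, RingHom.id_apply]
    split_ifs <;> ring

/-- The function `d_{s_i} = k - k⁻¹ x_{i+1} / x_i`. -/
def dS {n : ℕ} (k : ℂˣ) (i : Fin (n + 1)) : Mer n :=
  algebraMap ℂ (Mer n) k - algebraMap ℂ (Mer n) (k : ℂ)⁻¹ * (xM i.succ / xM i.castSucc)

/-- The map `f ↦ S̃_i f`: left multiplication by the intertwiner
`S̃_i = (1 - X_{i+1} / X_i) (T_i - k) + k - k⁻¹ X_{i+1} / X_i`, which satisfies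
`S̃_i g(X) = (s_i g)(X) S̃_i`. -/
def sigmaS {n : ℕ} (k : ℂˣ) (i : Fin (n + 1)) (f : H0K n) : H0K n :=
  (1 - xM i.succ / xM i.castSucc : Mer n) •
    (heckeL k i (coefAct (permB (si i)) f) - (k : ℂ) • coefAct (permB (si i)) f) +
  dS k i • coefAct (permB (si i)) f

/-- The coefficient `(1 - x_b / x_a) / (k - k⁻¹ x_b / x_a)`. -/
def cM {n : ℕ} (k : ℂˣ) (a b : Fin (n + 2)) : Mer n :=
  (1 - xM b / xM a) /
    (algebraMap ℂ (Mer n) k - algebraMap ℂ (Mer n) (k : ℂ)⁻¹ * (xM b / xM a))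

theorem cM_den {n : ℕ} (k : ℂˣ) {a b : Fin (n + 2)} (hab : a ≠ b) :
    algebraMap ℂ (Mer n) k - algebraMap ℂ (Mer n) (k : ℂ)⁻¹ * (xM b / xM a) ≠ 0 := by
  have h := sub_xM_ne_zero (n := n) k (k : ℂ)⁻¹ (by simp) hab
  intro h0
  apply h
  have := xM_ne_zero (n := n) a
  rw [← mul_div_assoc, sub_eq_zero, eq_div_iff this] at h0
  rw [h0, sub_self]

/-- The operator `T_i - k` on `H_0^𝕂`. -/
def heckeA {n : ℕ} (k : ℂˣ) (i : Fin (n + 1)) : Module.End (Mer n) (H0K n) :=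
  heckeL k i - algebraMap ℂ (Mer n) k • (1 : Module.End (Mer n) (H0K n))

theorem heckeA_apply {n : ℕ} (k : ℂˣ) (i : Fin (n + 1)) (f : H0K n)
    (w : Equiv.Perm (Fin (n + 2))) :
    heckeA k i f w = f (si i * w) +
      (if w⁻¹ i.succ < w⁻¹ i.castSucc then algebraMap ℂ (Mer n) (-(k : ℂ)⁻¹)
        else algebraMap ℂ (Mer n) (-(k : ℂ))) * f w := by
  simp only [heckeA, heckeL, LinearMap.sub_apply, LinearMap.coe_mk, AddHom.coe_mk,
    LinearMap.smul_apply, Module.End.one_apply, Pi.sub_apply, Pi.smul_apply, smul_eq_mul]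
  split_ifs
  · simp only [map_sub, map_neg]
    ring
  · simp only [map_neg]
    ring

/-- The map `τ(s_i, e) = d_{s_i}⁻¹ S̃_i` as a function. -/
def tauSFun {n : ℕ} (k : ℂˣ) (i : Fin (n + 1)) (f : H0K n) : H0K n :=
  (dS k i)⁻¹ • sigmaS k i f

theorem tauSFun_eq {n : ℕ} (k : ℂˣ) (i : Fin (n + 1)) (f : H0K n) :
    tauSFun k i f = (1 + cM k i.castSucc i.succ • heckeA k i : Module.End (Mer n) (H0K n))
      (coefAct (permB (si i)) f) := by
  have hd := cM_den (n := n) k (Fin.castSucc_lt_succ (i := i)).ne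
  funext w
  simp only [tauSFun, sigmaS, dS, heckeA, cM, Pi.smul_apply, Pi.add_apply, Pi.sub_apply,
    LinearMap.add_apply, LinearMap.smul_apply, LinearMap.sub_apply, Module.End.one_apply,
    smul_eq_mul, algebraMap_smul]
  rw [mul_add, inv_mul_cancel_left₀ hd, Algebra.smul_def]
  ring

theorem act_cM {n : ℕ} (k : ℂˣ) (w : Equiv.Perm (Fin (n + 2))) (a b : Fin (n + 2)) :
    act n (permB w) (cM k a b) = cM k (w a) (w b) := by
  simp only [cM, map_div₀, map_sub, map_mul, map_one, act_perm_xM, AlgEquiv.commutes]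

theorem coefAct_heckeA {n : ℕ} (k : ℂˣ) (i : Fin (n + 1)) (φ : Bihol n) (f : H0K n) :
    coefAct φ (heckeA k i f) = heckeA k i (coefAct φ f) := by
  funext w
  simp only [coefAct_apply, heckeA_apply, map_add, map_mul]
  split_ifs <;> simp only [AlgEquiv.commutes]

/-- The quadratic relation. -/
theorem heckeA_sq {n : ℕ} (k : ℂˣ) (i : Fin (n + 1)) :
    (heckeA k i * heckeA k i : Module.End (Mer n) (H0K n)) =
      (-(algebraMap ℂ (Mer n) k + algebraMap ℂ (Mer n) (k : ℂ)⁻¹)) • heckeA k i := by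
  have hk : algebraMap ℂ (Mer n) k * algebraMap ℂ (Mer n) (k : ℂ)⁻¹ = 1 := by
    rw [← map_mul, mul_inv_cancel₀ k.ne_zero, map_one]
  refine LinearMap.ext fun f => funext fun w => ?_
  have hne : w⁻¹ i.succ ≠ w⁻¹ i.castSucc := by
    simp [(Fin.castSucc_lt_succ (i := i)).ne']
  simp only [Module.End.mul_apply, LinearMap.smul_apply, Pi.smul_apply, heckeA_apply, smul_eq_mul,
    ← mul_assoc, Equiv.swap_mul_self, one_mul, mul_inv_rev, Equiv.swap_inv, Equiv.Perm.mul_apply,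
    Equiv.swap_apply_left, Equiv.swap_apply_right, map_neg]
  rcases hne.lt_or_gt with h | h
  · simp only [h, h.not_gt, if_true, if_false]
    linear_combination -(f w) * hk
  · simp only [h, h.not_gt, if_true, if_false]
    linear_combination -(f w) * hk

theorem coef_aux₁ {K : Type*} [Field K] {a b x y : K} (h1 : a * x - b * y ≠ 0)
    (h2 : a * y - b * x ≠ 0) :
    (x - y) / (a * x - b * y) + (y - x) / (a * y - b * x) -
      (x - y) / (a * x - b * y) * ((y - x) / (a * y - b * x)) * (a + b) = 0 := by
  generalize e1 : a * x - b * y = d1 at *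
  generalize e2 : a * y - b * x = d2 at *
  field_simp
  subst e1 e2
  ring

theorem coef_aux₂ {K : Type*} [Field K] {a b x y z : K} (hab : a * b = 1)
    (h1 : a * x - b * y ≠ 0) (h2 : a * y - b * z ≠ 0) (h3 : a * x - b * z ≠ 0) :
    (x - y) / (a * x - b * y) + (y - z) / (a * y - b * z) - (x - z) / (a * x - b * z) +
      -(a + b) * ((x - y) / (a * x - b * y) * ((y - z) / (a * y - b * z))) +
      (x - y) / (a * x - b * y) * ((x - z) / (a * x - b * z)) * ((y - z) / (a * y - b * z)) =
      0 := by
  generalize e1 : a * x - b * y = d1 at *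
  generalize e2 : a * y - b * z = d2 at *
  generalize e3 : a * x - b * z = d3 at *
  field_simp
  subst e1 e2 e3
  linear_combination (-(x - y) * (x - z) * (y - z)) * hab

theorem swap_braid {α : Type*} [DecidableEq α] {a b c : α} (hab : a ≠ b) (hbc : b ≠ c)
    (hac : a ≠ c) :
    Equiv.swap b c * Equiv.swap a b * Equiv.swap b c =
      Equiv.swap a b * Equiv.swap b c * Equiv.swap a b := by
  rw [Equiv.swap_mul_swap_mul_swap hab hac, Equiv.swap_comm a b, Equiv.swap_comm b c,
    Equiv.swap_mul_swap_mul_swap hbc.symm hac.symm, Equiv.swap_comm]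

theorem cM_den' {n : ℕ} (k : ℂˣ) {a b : Fin (n + 2)} (hab : a ≠ b) :
    algebraMap ℂ (Mer n) k * xM a - algebraMap ℂ (Mer n) (k : ℂ)⁻¹ * xM b ≠ 0 :=
  sub_xM_ne_zero (n := n) k (k : ℂ)⁻¹ (by simp) hab

theorem cM_eq {n : ℕ} (k : ℂˣ) (a b : Fin (n + 2)) :
    (cM k a b : Mer n) = (xM a - xM b) /
      (algebraMap ℂ (Mer n) k * xM a - algebraMap ℂ (Mer n) (k : ℂ)⁻¹ * xM b) := by
  have ha := xM_ne_zero (n := n) a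
  rw [cM, ← mul_div_mul_right _ _ ha]
  congr 1
  · rw [sub_mul, one_mul, div_mul_cancel₀ _ ha]
  · rw [sub_mul, mul_assoc, div_mul_cancel₀ _ ha]

theorem tauS_tauS {n : ℕ} (k : ℂˣ) (i : Fin (n + 1)) (f : H0K n) :
    tauSFun k i (tauSFun k i f) = f := by
  have hne : (i.castSucc : Fin (n + 2)) ≠ i.succ := Fin.castSucc_lt_succ.ne
  have hpp : (permB (si i) * permB (si i) : Bihol n) = 1 :=
    Subtype.ext (Equiv.ext fun p => Prod.ext (funext fun j => by
      change p.1 ((si i)⁻¹ ((si i)⁻¹ j)) = p.1 j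
      simp) rfl)
  have hc : cM k i.castSucc i.succ + cM k i.succ i.castSucc -
      cM k i.castSucc i.succ * cM k i.succ i.castSucc *
        (algebraMap ℂ (Mer n) k + algebraMap ℂ (Mer n) (k : ℂ)⁻¹) = 0 := by
    rw [cM_eq, cM_eq]
    exact coef_aux₁ (cM_den' k hne) (cM_den' k hne.symm)
  rw [tauSFun_eq, tauSFun_eq]
  simp only [LinearMap.add_apply, LinearMap.smul_apply, Module.End.one_apply, map_add,
    coefAct_smul, coefAct_heckeA, coefAct_coefAct, act_cM, hpp, Equiv.swap_apply_left,
    Equiv.swap_apply_right]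
  have hf : coefAct (1 : Bihol n) f = f := funext fun w => by
    simp only [coefAct_apply, map_one, AlgEquiv.one_apply]
  have hA : heckeA k i (heckeA k i f) =
      (-(algebraMap ℂ (Mer n) k + algebraMap ℂ (Mer n) (k : ℂ)⁻¹)) • heckeA k i f := by
    rw [← Module.End.mul_apply, heckeA_sq]
    rfl
  rw [hf, map_smul, hA]
  funext w
  simp only [Pi.add_apply, Pi.smul_apply, smul_eq_mul]
  linear_combination hc * heckeA k i f w

theorem yang_baxter_aux {K R : Type*} [Field K] [Ring R] [Algebra K R] {A B : R} {m a b c : K}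
    (hA : A * A = m • A) (hB : B * B = m • B) (hAB : A * (B * A) - B * (A * B) = A - B)
    (h : a + c - b + m * (a * c) + a * b * c = 0) :
    (1 + a • A) * ((1 + b • B) * (1 + c • A)) = (1 + c • B) * ((1 + b • A) * (1 + a • B)) := by
  simp only [add_mul, mul_add, one_mul, mul_one, smul_mul_assoc, mul_smul_comm, hA, hB, smul_smul]
  rw [← sub_eq_zero]
  have e : (a + c - b + m * (a * c) + a * b * c) • (A - B) +
      (a * b * c) • (A * (B * A) - B * (A * B) - (A - B)) = 0 := by
    rw [h, hAB, sub_self, smul_zero, zero_smul, add_zero]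
  rw [← e]
  module

/-- The braid relation. -/
theorem heckeA_braid {n : ℕ} (k : ℂˣ) (i : Fin n) :
    (heckeA k i.castSucc * (heckeA k i.succ * heckeA k i.castSucc) -
      heckeA k i.succ * (heckeA k i.castSucc * heckeA k i.succ) : Module.End (Mer n) (H0K n)) =
      heckeA k i.castSucc - heckeA k i.succ := by
  have hk : algebraMap ℂ (Mer n) k * algebraMap ℂ (Mer n) (k : ℂ)⁻¹ = 1 := by
    rw [← map_mul, mul_inv_cancel₀ k.ne_zero, map_one]
  have e : (i.succ.castSucc : Fin (n + 2)) = i.castSucc.succ := rfl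
  have h01 : (i.castSucc.castSucc : Fin (n + 2)) ≠ i.castSucc.succ := Fin.castSucc_lt_succ.ne
  have h12 : (i.castSucc.succ : Fin (n + 2)) ≠ i.succ.succ := by
    rw [← e]
    exact Fin.castSucc_lt_succ.ne
  have h02 : (i.castSucc.castSucc : Fin (n + 2)) ≠ i.succ.succ := by
    rw [Ne, Fin.ext_iff]
    simp only [Fin.val_castSucc, Fin.val_succ]
    omega
  refine LinearMap.ext fun f => funext fun w => ?_
  have hs : si i.succ * (si i.castSucc * (si i.succ * w)) =
      si i.castSucc * (si i.succ * (si i.castSucc * w)) := by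
    simp only [← mul_assoc]
    congr 1
    exact swap_braid h01 h12 h02
  have hss : ∀ (i : Fin (n + 1)) (v : Equiv.Perm (Fin (n + 2))), si i * (si i * v) = v := by
    intro i v
    rw [← mul_assoc, Equiv.swap_mul_self, one_mul]
  simp only [Module.End.mul_apply, LinearMap.sub_apply, Pi.sub_apply, heckeA_apply, hss, mul_inv_rev,
    Equiv.swap_inv, Equiv.Perm.mul_apply, e, Equiv.swap_apply_left, Equiv.swap_apply_right, hs,
    Equiv.swap_apply_of_ne_of_ne h02.symm h12.symm, Equiv.swap_apply_of_ne_of_ne h01 h02, map_neg]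
  have w01 : w⁻¹ i.castSucc.castSucc ≠ w⁻¹ i.castSucc.succ := by simpa using h01
  have w12 : w⁻¹ i.castSucc.succ ≠ w⁻¹ i.succ.succ := by simpa using h12
  have w02 : w⁻¹ i.castSucc.castSucc ≠ w⁻¹ i.succ.succ := by simpa using h02
  generalize w⁻¹ i.castSucc.castSucc = p0 at *
  generalize w⁻¹ i.castSucc.succ = p1 at *
  generalize w⁻¹ i.succ.succ = p2 at *
  generalize algebraMap ℂ (Mer n) (k : ℂ) = a at *
  generalize algebraMap ℂ (Mer n) (k : ℂ)⁻¹ = b at *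
  generalize f w = t0
  generalize f (si i.castSucc * w) = t1
  generalize f (si i.succ * w) = t2
  generalize f (si i.castSucc * (si i.succ * w)) = t3
  generalize f (si i.succ * (si i.castSucc * w)) = t4
  clear hss hs
  rcases w01.lt_or_gt with h1 | h1 <;> rcases w12.lt_or_gt with h2 | h2 <;>
    rcases w02.lt_or_gt with h3 | h3 <;> first
    | exact absurd (h1.trans h2) h3.not_gt
    | exact absurd (h2.trans h1) h3.not_gt
    | (simp only [h1, h2, h3, h1.not_gt, h2.not_gt, h3.not_gt, if_true, if_false]
       linear_combination (t1 - t2) * hk)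
    | (simp only [h1, h2, h3, h1.not_gt, h2.not_gt, h3.not_gt, if_true, if_false]
       linear_combination (t1 - t2 + (b - a) * t0) * hk)
    | (simp only [h1, h2, h3, h1.not_gt, h2.not_gt, h3.not_gt, if_true, if_false]
       linear_combination (t1 - t2 + (a - b) * t0) * hk)

theorem permB_mul {n : ℕ} (v w : Equiv.Perm (Fin (n + 2))) :
    (permB (v * w) : Bihol n) = permB v * permB w := rfl

theorem coefAct_one_add {n : ℕ} (k : ℂˣ) (i : Fin (n + 1)) (φ : Bihol n) (c : Mer n)
    (f : H0K n) :
    coefAct φ ((1 + c • heckeA k i : Module.End (Mer n) (H0K n)) f) =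
      (1 + act n φ c • heckeA k i : Module.End (Mer n) (H0K n)) (coefAct φ f) := by
  simp only [LinearMap.add_apply, LinearMap.smul_apply, Module.End.one_apply, map_add,
    coefAct_smul, coefAct_heckeA]

theorem tauS_braid {n : ℕ} (k : ℂˣ) (i : Fin n) (f : H0K n) :
    tauSFun k i.castSucc (tauSFun k i.succ (tauSFun k i.castSucc f)) =
      tauSFun k i.succ (tauSFun k i.castSucc (tauSFun k i.succ f)) := by
  have e : (i.succ.castSucc : Fin (n + 2)) = i.castSucc.succ := rfl
  have h01 : (i.castSucc.castSucc : Fin (n + 2)) ≠ i.castSucc.succ := Fin.castSucc_lt_succ.ne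
  have h12 : (i.castSucc.succ : Fin (n + 2)) ≠ i.succ.succ := by
    rw [← e]
    exact Fin.castSucc_lt_succ.ne
  have h02 : (i.castSucc.castSucc : Fin (n + 2)) ≠ i.succ.succ := by
    rw [Ne, Fin.ext_iff]
    simp only [Fin.val_castSucc, Fin.val_succ]
    omega
  have hk : algebraMap ℂ (Mer n) k * algebraMap ℂ (Mer n) (k : ℂ)⁻¹ = 1 := by
    rw [← map_mul, mul_inv_cancel₀ k.ne_zero, map_one]
  have hs := swap_braid h01 h12 h02
  have key := yang_baxter_aux (A := heckeA (n := n) k i.castSucc) (B := heckeA k i.succ)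
    (a := cM k i.castSucc.castSucc i.castSucc.succ) (b := cM k i.castSucc.castSucc i.succ.succ)
    (c := cM k i.castSucc.succ i.succ.succ)
    (heckeA_sq k _) (heckeA_sq k _) (heckeA_braid k i) (by
      simp only [cM_eq]
      exact coef_aux₂ hk (cM_den' k h01) (cM_den' k h12) (cM_den' k h02))
  have key' := LinearMap.congr_fun key (coefAct (permB (si i.castSucc * si i.succ *
    si i.castSucc)) f)
  simp only [Module.End.mul_apply] at key'
  have s1 : si i.succ i.castSucc.castSucc = i.castSucc.castSucc :=
    Equiv.swap_apply_of_ne_of_ne h01 h02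
  have s2 : si i.succ i.castSucc.succ = i.succ.succ := Equiv.swap_apply_left _ _
  have s3 : si i.castSucc i.castSucc.castSucc = i.castSucc.succ := Equiv.swap_apply_left _ _
  have s4 : si i.castSucc i.succ.succ = i.succ.succ :=
    Equiv.swap_apply_of_ne_of_ne h02.symm h12.symm
  have s5 : si i.castSucc i.castSucc.succ = i.castSucc.castSucc := Equiv.swap_apply_right _ _
  have s6 : si i.succ i.succ.succ = i.castSucc.succ := Equiv.swap_apply_right _ _
  simp only [tauSFun_eq, coefAct_one_add, coefAct_coefAct, act_cM, ← permB_mul,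
    e, s1, s2, s3, s4, s5, s6, ← mul_assoc]
  rw [key']
  simp only [si, e] at hs ⊢
  rw [hs]

/-- `T_i` and `T_j` commute if `|i - j| > 1`. -/
theorem heckeA_comm {n : ℕ} (k : ℂˣ) {i j : Fin (n + 1)} (h : (i : ℕ) + 1 < j) (f : H0K n) :
    heckeA k i (heckeA k j f) = heckeA k j (heckeA k i f) := by
  have n1 : (i.castSucc : Fin (n + 2)) ≠ j.castSucc := by rw [Ne, Fin.ext_iff]; simp; omega
  have n2 : (i.castSucc : Fin (n + 2)) ≠ j.succ := by rw [Ne, Fin.ext_iff]; simp; omega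
  have n3 : (i.succ : Fin (n + 2)) ≠ j.castSucc := by rw [Ne, Fin.ext_iff]; simp; omega
  have n4 : (i.succ : Fin (n + 2)) ≠ j.succ := by rw [Ne, Fin.ext_iff]; simp; omega
  funext w
  have hs : si j * (si i * w) = si i * (si j * w) := by
    rw [← mul_assoc, ← mul_assoc]
    congr 1
    exact (Equiv.Perm.disjoint_swap_swap (by simp [n1, n2, n3, n4, Fin.castSucc_lt_succ.ne])).commute.symm
  simp only [heckeA_apply, hs, mul_inv_rev, Equiv.swap_inv, Equiv.Perm.mul_apply,
    Equiv.swap_apply_of_ne_of_ne n1 n2, Equiv.swap_apply_of_ne_of_ne n3 n4,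
    Equiv.swap_apply_of_ne_of_ne n1.symm n3.symm, Equiv.swap_apply_of_ne_of_ne n2.symm n4.symm]
  ring

theorem tauS_comm {n : ℕ} (k : ℂˣ) {i j : Fin (n + 1)} (h : (i : ℕ) + 1 < j) (f : H0K n) :
    tauSFun k i (tauSFun k j f) = tauSFun k j (tauSFun k i f) := by
  have n1 : (i.castSucc : Fin (n + 2)) ≠ j.castSucc := by rw [Ne, Fin.ext_iff]; simp; omega
  have n2 : (i.castSucc : Fin (n + 2)) ≠ j.succ := by rw [Ne, Fin.ext_iff]; simp; omega
  have n3 : (i.succ : Fin (n + 2)) ≠ j.castSucc := by rw [Ne, Fin.ext_iff]; simp; omega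
  have n4 : (i.succ : Fin (n + 2)) ≠ j.succ := by rw [Ne, Fin.ext_iff]; simp; omega
  have hs : si j * si i = si i * si j :=
    (Equiv.Perm.disjoint_swap_swap (by simp [n1, n2, n3, n4, Fin.castSucc_lt_succ.ne])).commute.symm
  simp only [tauSFun_eq, coefAct_one_add, coefAct_coefAct, act_cM, ← permB_mul, hs,
    Equiv.swap_apply_of_ne_of_ne n1 n2, Equiv.swap_apply_of_ne_of_ne n3 n4,
    Equiv.swap_apply_of_ne_of_ne n1.symm n3.symm, Equiv.swap_apply_of_ne_of_ne n2.symm n4.symm]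
  funext w
  simp only [LinearMap.add_apply, LinearMap.smul_apply, Module.End.one_apply, map_add, map_smul,
    heckeA_comm k h, Pi.add_apply, Pi.smul_apply, smul_eq_mul]
  ring

/-- The operator `η(π)` on `H_0^𝕂`, with `η(π)(γ) T_w = γ_{w⁻¹(N)} T_{σ w}`: left multiplication
by `π`, in view of the relation `π T_w = T_{σ w} Y_{w⁻¹(N)}`. -/
def etaPi {n : ℕ} : H0K n ≃ₗ[Mer n] H0K n where
  toFun f v := yM (((rot n)⁻¹ * v)⁻¹ (Fin.last (n + 1))) * f ((rot n)⁻¹ * v)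
  invFun f w := (yM (w⁻¹ (Fin.last (n + 1))))⁻¹ * f (rot n * w)
  left_inv f := funext fun w => by
    simp only [← mul_assoc, inv_mul_cancel, one_mul, inv_mul_cancel₀ (yM_ne_zero _)]
  right_inv f := funext fun w => by
    simp only [← mul_assoc, mul_inv_cancel, one_mul, mul_inv_cancel₀ (yM_ne_zero _)]
  map_add' f g := funext fun w => mul_add _ _ _
  map_smul' c f := funext fun w => mul_left_comm _ _ _

theorem etaPi_apply {n : ℕ} (f : H0K n) (v : Equiv.Perm (Fin (n + 2))) :
    etaPi f v = yM (v⁻¹ 0) * f ((rot n)⁻¹ * v) := by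
  change yM (((rot n)⁻¹ * v)⁻¹ (Fin.last (n + 1))) * f ((rot n)⁻¹ * v) = _
  rw [mul_inv_rev, inv_inv, Equiv.Perm.mul_apply, rot_last]

/-- The cocycle value `C_ι`: the `𝕂`-linear extension of the anti-algebra involution of `H_0`
mapping `T_w` to `T_{w⁻¹}`. -/
def Ciota {n : ℕ} : H0K n ≃ₗ[Mer n] H0K n where
  toFun f w := f w⁻¹
  invFun f w := f w⁻¹
  left_inv f := funext fun w => by simp
  right_inv f := funext fun w => by simp
  map_add' f g := rfl
  map_smul' c f := rfl

/-- `τ(s_i, e)` for `i = 1, …, N - 1`. -/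
def tauS {n : ℕ} (k : ℂˣ) (i : Fin (n + 1)) : H0K n ≃ₗ[ℂ] H0K n where
  toFun := tauSFun k i
  invFun := tauSFun k i
  left_inv := tauS_tauS k i
  right_inv := tauS_tauS k i
  map_add' f g := by simp only [tauSFun_eq, map_add]
  map_smul' c f := by
    simp only [tauSFun_eq, map_smul, RingHom.id_apply]
    rw [← algebraMap_smul (Mer n) c, map_smul, algebraMap_smul]

theorem tauS_apply {n : ℕ} (k : ℂˣ) (i : Fin (n + 1)) (f : H0K n) :
    tauS k i f = tauSFun k i f := rfl

/-- `τ(π, e)`: `f ↦ η(π) (π f)`. -/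
def tauPi {n : ℕ} (q : Set.Ioo (0 : ℝ) 1) : H0K n ≃ₗ[ℂ] H0K n :=
  (coefAct (piB q)).trans (etaPi.restrictScalars ℂ)

theorem tauPi_apply {n : ℕ} (q : Set.Ioo (0 : ℝ) 1) (f : H0K n) :
    tauPi q f = etaPi (coefAct (piB q) f) := rfl

/-- `τ(ι)`: `(τ(ι) f)(t, γ) = C_ι f(γ⁻¹, t⁻¹)`. -/
def tauIota {n : ℕ} : H0K n ≃ₗ[ℂ] H0K n :=
  (coefAct iotaB).trans (Ciota.restrictScalars ℂ)

theorem tauIota_apply {n : ℕ} (f : H0K n) : tauIota f = Ciota (coefAct iotaB f) := rfl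

theorem piB_permB {n : ℕ} (q : Set.Ioo (0 : ℝ) 1) (w : Equiv.Perm (Fin (n + 2)))
    (hw : w (Fin.last (n + 1)) = Fin.last (n + 1)) :
    piB q * permB w = permB (rot n * w * (rot n)⁻¹) * piB q := by
  refine Subtype.ext (Equiv.ext fun p => Prod.ext (funext fun j => ?_) rfl)
  change (if j = 0 then qC q else 1) * p.1 (w⁻¹ ((rot n)⁻¹ j)) =
    (if (rot n * w * (rot n)⁻¹)⁻¹ j = 0 then qC q else 1) *
      p.1 ((rot n)⁻¹ ((rot n * w * (rot n)⁻¹)⁻¹ j))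
  have h : (rot n * w * (rot n)⁻¹)⁻¹ j = 0 ↔ j = 0 := by
    rw [Equiv.Perm.inv_eq_iff_eq, ← rot_last]
    simp [hw]
  rw [if_congr h rfl rfl]
  simp

theorem rot_si {n : ℕ} (i : Fin n) :
    rot n * si i.castSucc * (rot n)⁻¹ = si i.succ := by
  rw [si, ← Equiv.swap_apply_apply]
  rw [rot_castSucc, show (i.castSucc.succ : Fin (n + 2)) = i.succ.castSucc from rfl, rot_castSucc]

theorem si_castSucc_last {n : ℕ} (i : Fin n) :
    si i.castSucc (Fin.last (n + 1)) = Fin.last (n + 1) := by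
  refine Equiv.swap_apply_of_ne_of_ne ?_ ?_ <;> rw [Ne, Fin.ext_iff] <;>
    simp only [Fin.val_castSucc, Fin.val_succ, Fin.val_last] <;> omega

theorem tauPi_tauS {n : ℕ} (q : Set.Ioo (0 : ℝ) 1) (k : ℂˣ) (i : Fin n) (f : H0K n) :
    tauPi q (tauS k i.castSucc f) = tauS k i.succ (tauPi q f) := by
  have hA : ∀ g : H0K n, etaPi (heckeA k i.castSucc g) = heckeA k i.succ (etaPi g) := by
    intro g
    funext v
    have h0 : si i.succ 0 = 0 := by
      refine Equiv.swap_apply_of_ne_of_ne ?_ ?_ <;> rw [Ne, Fin.ext_iff] <;>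
        simp only [Fin.val_castSucc, Fin.val_succ, Fin.val_zero] <;> omega
    have hs : si i.castSucc * ((rot n)⁻¹ * v) = (rot n)⁻¹ * (si i.succ * v) := by
      rw [← rot_si]
      simp only [mul_assoc, inv_mul_cancel_left]
    simp only [etaPi_apply, heckeA_apply, hs, mul_inv_rev, inv_inv, Equiv.Perm.mul_apply,
      rot_castSucc, Equiv.swap_inv, h0,
      show (i.castSucc.succ : Fin (n + 2)) = i.succ.castSucc from rfl]
    ring
  have hc : coefAct (piB q) (coefAct (permB (si i.castSucc)) f) =
      coefAct (permB (si i.succ)) (coefAct (piB q) f) := by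
    rw [coefAct_coefAct, coefAct_coefAct, piB_permB q _ (si_castSucc_last i), rot_si]
  have he : ∀ g : H0K n, coefAct (permB (si i.succ)) (etaPi g) =
      etaPi (coefAct (permB (si i.succ)) g) := by
    intro g
    funext v
    simp only [etaPi_apply, coefAct_apply, map_mul, act_perm_yM]
  have hx : act n (piB q) (cM k i.castSucc.castSucc i.castSucc.succ) =
      cM k i.succ.castSucc i.succ.succ := by
    have n1 : (i.castSucc.castSucc : Fin (n + 2)) ≠ Fin.last (n + 1) := Fin.castSucc_ne_last _
    have n2 : (i.castSucc.succ : Fin (n + 2)) ≠ Fin.last (n + 1) :=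
      Fin.castSucc_ne_last i.succ
    simp only [cM, map_div₀, map_sub, map_mul, map_one, act_pi_xM, AlgEquiv.commutes, n1, n2,
      if_false, one_mul, rot_castSucc]
    rw [show (i.castSucc.succ : Fin (n + 2)) = i.succ.castSucc from rfl, rot_castSucc]
  simp only [tauPi_apply, tauS_apply, tauSFun_eq, coefAct_one_add, hc, hx, he]
  simp only [LinearMap.add_apply, LinearMap.smul_apply, Module.End.one_apply, map_add, map_smul, hA]

theorem perm_inv_apply {α : Type*} (w : Equiv.Perm α) (x : α) : w⁻¹ (w x) = x :=
  w.symm_apply_apply x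

theorem coefAct_perm_etaPi {n : ℕ} (w : Equiv.Perm (Fin (n + 2))) (g : H0K n) :
    coefAct (permB w) (etaPi g) = etaPi (coefAct (permB w) g) := by
  funext v
  simp only [etaPi_apply, coefAct_apply, map_mul, act_perm_yM]

theorem coefAct_pi_etaPi {n : ℕ} (q : Set.Ioo (0 : ℝ) 1) (g : H0K n) :
    coefAct (piB q) (etaPi g) = etaPi (coefAct (piB q) g) := by
  funext v
  simp only [etaPi_apply, coefAct_apply, map_mul, act_pi_yM]

theorem rot_zero (n : ℕ) : rot n 0 = (0 : Fin (n + 1)).succ :=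
  rot_castSucc (0 : Fin (n + 1))

theorem rot_rot_si {n : ℕ} :
    rot n * (rot n * si (Fin.last n) * (rot n)⁻¹) * (rot n)⁻¹ = si 0 := by
  rw [si, ← Equiv.swap_apply_apply, ← Equiv.swap_apply_apply, rot_castSucc, Fin.succ_last,
    rot_last, rot_zero]
  rfl

theorem tauPi_tauPi_tauS {n : ℕ} (q : Set.Ioo (0 : ℝ) 1) (k : ℂˣ) (f : H0K n) :
    tauPi q (tauPi q (tauS k (Fin.last n) f)) = tauS k 0 (tauPi q (tauPi q f)) := by
  have hA : ∀ g : H0K n,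
      etaPi (etaPi (heckeA k (Fin.last n) g)) = heckeA k 0 (etaPi (etaPi g)) := by
    intro g
    funext v
    have hs : si (Fin.last n) * ((rot n)⁻¹ * ((rot n)⁻¹ * v)) =
        (rot n)⁻¹ * ((rot n)⁻¹ * (si 0 * v)) := by
      rw [← rot_rot_si]
      simp only [mul_assoc, inv_mul_cancel_left]
    simp only [etaPi_apply, heckeA_apply, hs, mul_inv_rev, inv_inv, Equiv.Perm.mul_apply,
      rot_castSucc, Equiv.swap_inv, Fin.succ_last, rot_last, rot_zero, Fin.castSucc_zero,
      Equiv.swap_apply_left, Equiv.swap_apply_right]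
    by_cases hlt : v⁻¹ (0 : Fin (n + 1)).succ < v⁻¹ 0
    · erw [if_pos hlt]
      ring
    · erw [if_neg hlt]
      ring
  have hB : piB q * (piB q * permB (si (Fin.last n))) =
      permB (si (0 : Fin (n + 1))) * (piB q * piB q) := by
    refine Subtype.ext (Equiv.ext fun p => Prod.ext (funext fun j => ?_) rfl)
    have e : (si (0 : Fin (n + 1)))⁻¹ =
        rot n * (rot n * si (Fin.last n) * (rot n)⁻¹) * (rot n)⁻¹ := by
      rw [rot_rot_si, Equiv.swap_inv]
    change (if j = 0 then qC q else 1) * ((if (rot n)⁻¹ j = 0 then qC q else 1) *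
        p.1 ((si (Fin.last n))⁻¹ ((rot n)⁻¹ ((rot n)⁻¹ j)))) =
      (if (si (0 : Fin (n + 1)))⁻¹ j = 0 then qC q else 1) *
        ((if (rot n)⁻¹ ((si (0 : Fin (n + 1)))⁻¹ j) = 0 then qC q else 1) *
        p.1 ((rot n)⁻¹ ((rot n)⁻¹ ((si (0 : Fin (n + 1)))⁻¹ j))))
    have e1 : (rot n)⁻¹ j = 0 ↔ (si (0 : Fin (n + 1)))⁻¹ j = 0 := by
      rw [Equiv.Perm.inv_eq_iff_eq, Equiv.Perm.inv_eq_iff_eq, rot_zero,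
        show si (0 : Fin (n + 1)) 0 = (0 : Fin (n + 1)).succ from Equiv.swap_apply_left _ _]
    have e2 : (rot n)⁻¹ ((si (0 : Fin (n + 1)))⁻¹ j) = 0 ↔ j = 0 := by
      rw [Equiv.Perm.inv_eq_iff_eq, Equiv.Perm.inv_eq_iff_eq, rot_zero,
        show si (0 : Fin (n + 1)) (0 : Fin (n + 1)).succ = 0 from Equiv.swap_apply_right _ _]
    have e3 : (rot n)⁻¹ ((rot n)⁻¹ ((si (0 : Fin (n + 1)))⁻¹ j)) =
        (si (Fin.last n))⁻¹ ((rot n)⁻¹ ((rot n)⁻¹ j)) := by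
      rw [e, Equiv.swap_inv]
      simp only [Equiv.Perm.mul_apply, perm_inv_apply, si]
    rw [if_congr e1 rfl rfl, if_congr e2 rfl rfl, e3, mul_left_comm]
  have hc : coefAct (piB q) (coefAct (piB q) (coefAct (permB (si (Fin.last n))) f)) =
      coefAct (permB (si 0)) (coefAct (piB q) (coefAct (piB q) f)) := by
    simp only [coefAct_coefAct, hB]
  have hx : act n (piB q) (act n (piB q) (cM k (Fin.last n).castSucc (Fin.last n).succ)) =
      cM k (0 : Fin (n + 1)).castSucc (0 : Fin (n + 1)).succ := by
    have n1 : ((Fin.last n).castSucc : Fin (n + 2)) ≠ Fin.last (n + 1) := Fin.castSucc_ne_last _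
    have n2 : (0 : Fin (n + 2)) ≠ Fin.last (n + 1) := by
      rw [Ne, Fin.ext_iff]
      simp
    have hq : algebraMap ℂ (Mer n) (qC q : ℂ)⁻¹ ≠ 0 := by simp
    simp only [cM, map_div₀, map_sub, map_mul, map_one, act_pi_xM, AlgEquiv.commutes, n1, n2,
      if_true, if_false, one_mul, rot_castSucc, Fin.succ_last, rot_last, rot_zero,
      Fin.castSucc_zero, mul_div_mul_left _ _ hq]
  simp only [tauPi_apply, tauS_apply, tauSFun_eq, coefAct_one_add, coefAct_pi_etaPi,
    coefAct_perm_etaPi, hc]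
  simp only [LinearMap.add_apply, LinearMap.smul_apply, Module.End.one_apply, map_add, map_smul,
    hA, hx]

theorem tauIota_tauIota {n : ℕ} (f : H0K n) : tauIota (tauIota f) = f := by
  have h : (iotaB * iotaB : Bihol n) = 1 :=
    Subtype.ext (Equiv.ext fun p => Prod.ext (inv_inv p.1) (inv_inv p.2))
  funext w
  change (act n iotaB * act n iotaB) (f w⁻¹⁻¹) = f w
  rw [← map_mul, h, map_one, inv_inv]
  rfl

/-- Right multiplication by `T_j - k`. -/
def heckeB {n : ℕ} (k : ℂˣ) (j : Fin (n + 1)) (f : H0K n) : H0K n :=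
  Ciota (heckeA k j (Ciota f))

theorem heckeB_apply {n : ℕ} (k : ℂˣ) (j : Fin (n + 1)) (f : H0K n)
    (w : Equiv.Perm (Fin (n + 2))) :
    heckeB k j f w = f (w * si j) +
      (if w j.succ < w j.castSucc then algebraMap ℂ (Mer n) (-(k : ℂ)⁻¹)
        else algebraMap ℂ (Mer n) (-(k : ℂ))) * f w := by
  change heckeA k j (Ciota f) w⁻¹ = _
  rw [heckeA_apply]
  change f (si j * w⁻¹)⁻¹ + _ * f w⁻¹⁻¹ = _
  rw [mul_inv_rev, inv_inv, Equiv.swap_inv]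

theorem si_lt_iff {n : ℕ} (i : Fin (n + 1)) {a b : Fin (n + 2)}
    (h1 : ¬(a = i.castSucc ∧ b = i.succ)) (h2 : ¬(a = i.succ ∧ b = i.castSucc)) :
    si i a < si i b ↔ a < b := by
  simp only [si, Equiv.swap_apply_def, Fin.lt_def, Fin.ext_iff, Fin.val_castSucc,
    Fin.val_succ] at *
  split_ifs <;> simp only [Fin.val_castSucc, Fin.val_succ] <;> omega

theorem si_conj_cases {n : ℕ} {i j : Fin (n + 1)} {w : Equiv.Perm (Fin (n + 2))}
    (h : w j.castSucc = i.castSucc ∧ w j.succ = i.succ ∨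
      w j.castSucc = i.succ ∧ w j.succ = i.castSucc) : si i * w = w * si j := by
  rw [← eq_mul_inv_iff_mul_eq, si, si, ← Equiv.swap_apply_apply]
  rcases h with ⟨h1, h2⟩ | ⟨h1, h2⟩
  · rw [h1, h2]
  · rw [h1, h2, Equiv.swap_comm]

theorem si_conj_lt {n : ℕ} {i j : Fin (n + 1)} {w : Equiv.Perm (Fin (n + 2))}
    (h : si i * w = w * si j) : w⁻¹ i.succ < w⁻¹ i.castSucc ↔ w j.succ < w j.castSucc := by
  have hc : w j.castSucc = i.castSucc ∧ w j.succ = i.succ ∨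
      w j.castSucc = i.succ ∧ w j.succ = i.castSucc := by
    rw [← eq_mul_inv_iff_mul_eq, si, si, ← Equiv.swap_apply_apply] at h
    have e := Equiv.congr_fun h i.castSucc
    have e' := Equiv.congr_fun h i.succ
    have hne : (i.castSucc : Fin (n + 2)) ≠ i.succ := Fin.castSucc_lt_succ.ne
    rw [Equiv.swap_apply_left, Equiv.swap_apply_def] at e
    split_ifs at e with h1 h2
    · exact Or.inl ⟨h1.symm, e.symm⟩
    · exact Or.inr ⟨e.symm, h2.symm⟩
    · exact absurd e.symm hne
  have hj : (j.castSucc : Fin (n + 2)) < j.succ := Fin.castSucc_lt_succ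
  have hi : (i.castSucc : Fin (n + 2)) < i.succ := Fin.castSucc_lt_succ
  rcases hc with ⟨h1, h2⟩ | ⟨h1, h2⟩
  · rw [h1, h2, ← h1, ← h2, perm_inv_apply, perm_inv_apply, h1, h2]
    simp only [hi.not_gt, hj.not_gt]
  · rw [h1, h2, ← h1, ← h2, perm_inv_apply, perm_inv_apply, h1, h2]
    simp only [hi, hj]

theorem heckeA_heckeB {n : ℕ} (k : ℂˣ) (i j : Fin (n + 1)) (f : H0K n) :
    heckeA k i (heckeB k j f) = heckeB k j (heckeA k i f) := by
  funext w
  rw [heckeA_apply, heckeB_apply, heckeB_apply, heckeB_apply, heckeA_apply, heckeA_apply]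
  by_cases h : si i * w = w * si j
  · have h' : si i * (si i * w) = si i * w * si j := by rw [mul_assoc, ← h]
    rw [if_congr (si_conj_lt h) rfl rfl, ← if_congr (si_conj_lt h') rfl rfl, ← h, h']
  · have hr : (si i * w) j.succ < (si i * w) j.castSucc ↔ w j.succ < w j.castSucc := by
      refine si_lt_iff i (fun hh => h ?_) (fun hh => h ?_)
      · exact si_conj_cases (Or.inr ⟨hh.2, hh.1⟩)
      · exact si_conj_cases (Or.inl ⟨hh.2, hh.1⟩)
    have hl : (w * si j)⁻¹ i.succ < (w * si j)⁻¹ i.castSucc ↔ w⁻¹ i.succ < w⁻¹ i.castSucc := by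
      rw [mul_inv_rev, Equiv.swap_inv]
      refine si_lt_iff j (fun hh => h ?_) (fun hh => h ?_)
      · rw [Equiv.Perm.inv_eq_iff_eq, Equiv.Perm.inv_eq_iff_eq] at hh
        exact si_conj_cases (Or.inr ⟨hh.1.symm, hh.2.symm⟩)
      · rw [Equiv.Perm.inv_eq_iff_eq, Equiv.Perm.inv_eq_iff_eq] at hh
        exact si_conj_cases (Or.inl ⟨hh.2.symm, hh.1.symm⟩)
    rw [if_congr hr rfl rfl, if_congr hl rfl rfl, mul_assoc]
    ring

/-- The action on `𝕂` of `(e, w) = ι (w, e) ι`. -/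
theorem conj_commute {n : ℕ} (φ ψ : Bihol n)
    (hφ : ∀ p, (φ.1 p).2 = p.2 ∧ ∀ γ, (φ.1 (p.1, γ)).1 = (φ.1 p).1)
    (hψ : ∀ p, (ψ.1 p).2 = p.2 ∧ ∀ γ, (ψ.1 (p.1, γ)).1 = (ψ.1 p).1) :
    φ * (iotaB * ψ * iotaB) = iotaB * ψ * iotaB * φ := by
  have e : ∀ p : Torus n × Torus n, (iotaB * ψ * iotaB : Bihol n).1 p =
      (p.1, (ψ.1 (p.2⁻¹, 1)).1⁻¹) := by
    intro p
    change ((ψ.1 (p.2⁻¹, p.1⁻¹)).2⁻¹, (ψ.1 (p.2⁻¹, p.1⁻¹)).1⁻¹) = _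
    rw [(hψ _).1, inv_inv, ← (hψ (p.2⁻¹, p.1⁻¹)).2 1]
  refine Subtype.ext (Equiv.ext fun p => ?_)
  change φ.1 ((iotaB * ψ * iotaB : Bihol n).1 p) = (iotaB * ψ * iotaB : Bihol n).1 (φ.1 p)
  rw [e, e]
  refine Prod.ext ?_ ?_
  · exact (hφ p).2 _
  · rw [(hφ _).1, (hφ p).1]

theorem heckeB_add {n : ℕ} (k : ℂˣ) (j : Fin (n + 1)) (f g : H0K n) :
    heckeB k j (f + g) = heckeB k j f + heckeB k j g := by
  simp only [heckeB, map_add]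

theorem heckeB_smul {n : ℕ} (k : ℂˣ) (j : Fin (n + 1)) (c : Mer n) (f : H0K n) :
    heckeB k j (c • f) = c • heckeB k j f := by
  simp only [heckeB, map_smul]

theorem coefAct_Ciota {n : ℕ} (φ : Bihol n) (f : H0K n) :
    coefAct φ (Ciota f) = Ciota (coefAct φ f) := rfl

theorem Ciota_Ciota {n : ℕ} (f : H0K n) : Ciota (Ciota f) = f := by
  funext w
  change f w⁻¹⁻¹ = f w
  rw [inv_inv]

theorem coefAct_heckeB {n : ℕ} (k : ℂˣ) (j : Fin (n + 1)) (φ : Bihol n) (f : H0K n) :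
    coefAct φ (heckeB k j f) = heckeB k j (coefAct φ f) := by
  rw [heckeB, coefAct_Ciota, coefAct_heckeA, coefAct_Ciota, heckeB]

theorem tauIota_tauS {n : ℕ} (k : ℂˣ) (j : Fin (n + 1)) (f : H0K n) :
    tauIota (tauS k j (tauIota f)) =
      coefAct (iotaB * permB (si j) * iotaB) f + act n iotaB (cM k j.castSucc j.succ) •
        heckeB k j (coefAct (iotaB * permB (si j) * iotaB) f) := by
  rw [tauS_apply, tauSFun_eq, tauIota_apply, tauIota_apply, coefAct_one_add, coefAct_Ciota,
    coefAct_Ciota, coefAct_coefAct, coefAct_coefAct, mul_assoc]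
  simp only [LinearMap.add_apply, LinearMap.smul_apply, Module.End.one_apply, map_add, map_smul,
    Ciota_Ciota, heckeB]

theorem act_conj_perm_xM {n : ℕ} (w : Equiv.Perm (Fin (n + 2))) (a : Fin (n + 2)) :
    act n (iotaB * permB w * iotaB) (xM a) = xM a := by
  rw [map_mul, map_mul, AlgEquiv.mul_apply, AlgEquiv.mul_apply, act_iota_xM, map_inv₀,
    act_perm_yM, map_inv₀, act_iota_yM, inv_inv]

theorem act_conj_pi_xM {n : ℕ} (q : Set.Ioo (0 : ℝ) 1) (a : Fin (n + 2)) :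
    act n (iotaB * piB q * iotaB) (xM a) = xM a := by
  rw [map_mul, map_mul, AlgEquiv.mul_apply, AlgEquiv.mul_apply, act_iota_xM, map_inv₀,
    act_pi_yM, map_inv₀, act_iota_yM, inv_inv]

theorem conj_commute_perm_perm {n : ℕ} (v w : Equiv.Perm (Fin (n + 2))) :
    (permB v * (iotaB * permB w * iotaB) : Bihol n) = iotaB * permB w * iotaB * permB v :=
  conj_commute _ _ (fun _ => ⟨rfl, fun _ => rfl⟩) (fun _ => ⟨rfl, fun _ => rfl⟩)

theorem conj_commute_perm_pi {n : ℕ} (q : Set.Ioo (0 : ℝ) 1) (v : Equiv.Perm (Fin (n + 2))) :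
    (permB v * (iotaB * piB q * iotaB) : Bihol n) = iotaB * piB q * iotaB * permB v :=
  conj_commute _ _ (fun _ => ⟨rfl, fun _ => rfl⟩) (fun _ => ⟨rfl, fun _ => rfl⟩)

theorem conj_commute_pi_pi {n : ℕ} (q : Set.Ioo (0 : ℝ) 1) :
    (piB q * (iotaB * piB q * iotaB) : Bihol n) = iotaB * piB q * iotaB * piB q :=
  conj_commute _ _ (fun _ => ⟨rfl, fun _ => rfl⟩) (fun _ => ⟨rfl, fun _ => rfl⟩)

theorem tauS_conj_tauS {n : ℕ} (k : ℂˣ) (i j : Fin (n + 1)) (f : H0K n) :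
    tauS k i (tauIota (tauS k j (tauIota f))) = tauIota (tauS k j (tauIota (tauS k i f))) := by
  have h1 : act n (permB (si i)) (act n iotaB (cM k j.castSucc j.succ)) =
      act n iotaB (cM k j.castSucc j.succ) := by
    simp only [cM, map_div₀, map_sub, map_mul, map_one, act_iota_xM, map_inv₀, act_perm_yM,
      AlgEquiv.commutes]
  have h2 : act n (iotaB * permB (si j) * iotaB) (cM k i.castSucc i.succ) =
      cM k i.castSucc i.succ := by
    simp only [cM, map_div₀, map_sub, map_mul (act n _), map_one, act_conj_perm_xM,
      AlgEquiv.commutes]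
  rw [tauIota_tauS, tauIota_tauS, tauS_apply, tauS_apply, tauSFun_eq, tauSFun_eq,
    coefAct_one_add, map_add, coefAct_smul, coefAct_heckeB, coefAct_coefAct, coefAct_coefAct,
    conj_commute_perm_perm, h1, h2]
  generalize coefAct (iotaB * permB (si j) * iotaB * permB (si i)) f = g
  generalize act n iotaB (cM k j.castSucc j.succ) = c'
  generalize cM k i.castSucc i.succ = c
  simp only [LinearMap.add_apply, LinearMap.smul_apply, Module.End.one_apply, map_add, map_smul,
    heckeB_add, heckeB_smul, heckeA_heckeB]

theorem tauIota_tauPi {n : ℕ} (q : Set.Ioo (0 : ℝ) 1) (f : H0K n)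
    (v : Equiv.Perm (Fin (n + 2))) :
    tauIota (tauPi q (tauIota f)) v =
      (xM (v 0))⁻¹ * act n (iotaB * piB q * iotaB) (f (v * rot n)) := by
  change act n iotaB (etaPi (coefAct (piB q) (tauIota f)) v⁻¹) = _
  rw [etaPi_apply, map_mul, act_iota_yM, inv_inv, coefAct_apply]
  change _ * act n iotaB (act n (piB q) (act n iotaB (f ((rot n)⁻¹ * v⁻¹)⁻¹))) = _
  rw [mul_inv_rev, inv_inv, inv_inv, map_mul (act n), map_mul (act n)]
  rfl

theorem tauS_apply_apply {n : ℕ} (k : ℂˣ) (i : Fin (n + 1)) (f : H0K n)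
    (v : Equiv.Perm (Fin (n + 2))) :
    tauS k i f v = act n (permB (si i)) (f v) + cM k i.castSucc i.succ *
      (act n (permB (si i)) (f (si i * v)) +
        (if v⁻¹ i.succ < v⁻¹ i.castSucc then algebraMap ℂ (Mer n) (-(k : ℂ)⁻¹)
          else algebraMap ℂ (Mer n) (-(k : ℂ))) * act n (permB (si i)) (f v)) := by
  rw [tauS_apply, tauSFun_eq, LinearMap.add_apply, Pi.add_apply, LinearMap.smul_apply,
    Pi.smul_apply, smul_eq_mul, heckeA_apply]
  rfl

theorem rot_symm_lt {n : ℕ} {a b : Fin (n + 2)} (ha : a ≠ 0) (hb : b ≠ 0) :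
    (rot n)⁻¹ a < (rot n)⁻¹ b ↔ a < b := by
  obtain ⟨a, rfl⟩ := Fin.exists_succ_eq.2 ha
  obtain ⟨b, rfl⟩ := Fin.exists_succ_eq.2 hb
  rw [← rot_castSucc, ← rot_castSucc, perm_inv_apply, perm_inv_apply, rot_castSucc, rot_castSucc]
  simp

theorem rot_inv_zero (n : ℕ) : (rot n)⁻¹ 0 = Fin.last (n + 1) := rot_symm_zero n

theorem cM_key {n : ℕ} (k : ℂˣ) {a b : Fin (n + 2)} (hab : a ≠ b) :
    ((xM b)⁻¹ * (1 + cM k a b * algebraMap ℂ (Mer n) (-(k : ℂ))) : Mer n) =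
      (xM a)⁻¹ * (1 + cM k a b * algebraMap ℂ (Mer n) (-(k : ℂ)⁻¹)) := by
  have hd := cM_den' k hab
  have ha := xM_ne_zero (n := n) a
  have hb := xM_ne_zero (n := n) b
  rw [cM_eq]
  simp only [map_neg]
  generalize algebraMap ℂ (Mer n) (k : ℂ) = s at *
  generalize algebraMap ℂ (Mer n) (k : ℂ)⁻¹ = t at *
  generalize e : s * xM a - t * xM b = d at *
  field_simp
  subst e
  ring

theorem tauS_conj_tauPi {n : ℕ} (q : Set.Ioo (0 : ℝ) 1) (k : ℂˣ) (i : Fin (n + 1)) (f : H0K n) :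
    tauS k i (tauIota (tauPi q (tauIota f))) = tauIota (tauPi q (tauIota (tauS k i f))) := by
  have h2 : act n (iotaB * piB q * iotaB) (cM k i.castSucc i.succ) =
      cM k i.castSucc i.succ := by
    simp only [cM, map_div₀, map_sub, map_mul (act n _), map_one, act_conj_pi_xM,
      AlgEquiv.commutes]
  have hne : (i.castSucc : Fin (n + 2)) ≠ i.succ := Fin.castSucc_lt_succ.ne
  funext v
  have hF : ∀ x : Mer n, act n (permB (si i)) (act n (iotaB * piB q * iotaB) x) =
      act n (iotaB * piB q * iotaB) (act n (permB (si i)) x) := by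
    intro x
    rw [← AlgEquiv.mul_apply, ← map_mul, conj_commute_perm_pi, map_mul, AlgEquiv.mul_apply]
  rw [tauS_apply_apply, tauIota_tauPi, tauIota_tauPi, tauIota_tauPi, tauS_apply_apply]
  simp only [map_mul (act n _), map_add, map_inv₀, act_perm_xM, hF, h2, ← mul_assoc]
  have e1 : si i ((si i * v) 0) = v 0 := by simp
  have e2 : act n (iotaB * piB q * iotaB) (if (v * rot n)⁻¹ i.succ < (v * rot n)⁻¹ i.castSucc then
      algebraMap ℂ (Mer n) (-(k : ℂ)⁻¹) else algebraMap ℂ (Mer n) (-(k : ℂ))) =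
      (if (v * rot n)⁻¹ i.succ < (v * rot n)⁻¹ i.castSucc then
      algebraMap ℂ (Mer n) (-(k : ℂ)⁻¹) else algebraMap ℂ (Mer n) (-(k : ℂ))) := by
    split_ifs <;> exact AlgEquiv.commutes _ _
  rw [e1, e2]
  have key : (xM (si i (v 0)))⁻¹ * (1 + cM k i.castSucc i.succ *
      (if v⁻¹ i.succ < v⁻¹ i.castSucc then algebraMap ℂ (Mer n) (-(k : ℂ)⁻¹)
          else algebraMap ℂ (Mer n) (-(k : ℂ)))) =
      (xM (v 0))⁻¹ * (1 + cM k i.castSucc i.succ *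
      (if (v * rot n)⁻¹ i.succ < (v * rot n)⁻¹ i.castSucc then
        algebraMap ℂ (Mer n) (-(k : ℂ)⁻¹) else algebraMap ℂ (Mer n) (-(k : ℂ)))) := by
    rw [mul_inv_rev, Equiv.Perm.mul_apply, Equiv.Perm.mul_apply]
    have hlast : ∀ a : Fin (n + 2), a ≠ 0 → (rot n)⁻¹ a < Fin.last (n + 1) := by
      intro a ha
      rw [Fin.lt_last_iff_ne_last, Ne, Equiv.Perm.inv_eq_iff_eq, rot_last]
      exact ha
    by_cases c1 : v 0 = i.castSucc
    · have d1 : v⁻¹ i.castSucc = 0 := by rw [← c1, perm_inv_apply]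
      have d2 : v⁻¹ i.succ ≠ 0 := by
        rw [Ne, Equiv.Perm.inv_eq_iff_eq, c1]
        exact hne.symm
      rw [d1, rot_inv_zero, if_neg (Fin.not_lt_zero _), if_pos (hlast _ d2), c1,
        Equiv.swap_apply_left, cM_key k hne]
    by_cases c2 : v 0 = i.succ
    · have d1 : v⁻¹ i.succ = 0 := by rw [← c2, perm_inv_apply]
      have d2 : v⁻¹ i.castSucc ≠ 0 := by
        rw [Ne, Equiv.Perm.inv_eq_iff_eq, c2]
        exact hne
      rw [d1, rot_inv_zero, if_pos (Fin.pos_of_ne_zero d2), if_neg (hlast _ d2).not_gt, c2,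
        Equiv.swap_apply_right, cM_key k hne]
    · have d1 : v⁻¹ i.castSucc ≠ 0 := by
        rw [Ne, Equiv.Perm.inv_eq_iff_eq]
        exact fun h => c1 h.symm
      have d2 : v⁻¹ i.succ ≠ 0 := by
        rw [Ne, Equiv.Perm.inv_eq_iff_eq]
        exact fun h => c2 h.symm
      rw [if_congr (rot_symm_lt d2 d1) rfl rfl, Equiv.swap_apply_of_ne_of_ne c1 c2]
  linear_combination (act n (iotaB * piB q * iotaB) (act n (permB (si i)) (f (v * rot n)))) * key

theorem tauPi_conj_tauPi {n : ℕ} (q : Set.Ioo (0 : ℝ) 1) (f : H0K n) :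
    tauPi q (tauIota (tauPi q (tauIota f))) = tauIota (tauPi q (tauIota (tauPi q f))) := by
  funext v
  have hF : ∀ x : Mer n, act n (piB q) (act n (iotaB * piB q * iotaB) x) =
      act n (iotaB * piB q * iotaB) (act n (piB q) x) := by
    intro x
    rw [← AlgEquiv.mul_apply, ← map_mul, conj_commute_pi_pi, map_mul, AlgEquiv.mul_apply]
  have hy : ∀ j : Fin (n + 2), act n (iotaB * piB q * iotaB) (yM j) =
      (algebraMap ℂ (Mer n) (if j = Fin.last (n + 1) then (qC q : ℂ)⁻¹ else 1))⁻¹ *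
        yM (rot n j) := by
    intro j
    rw [map_mul, map_mul, AlgEquiv.mul_apply, AlgEquiv.mul_apply, act_iota_yM, map_inv₀,
      act_pi_xM, map_inv₀, map_mul (act n _), AlgEquiv.commutes, act_iota_xM, mul_inv, inv_inv]
  rw [tauPi_apply, etaPi_apply, coefAct_apply, tauIota_tauPi, tauIota_tauPi, tauPi_apply,
    etaPi_apply, coefAct_apply, map_mul (act n _), map_mul (act n _), map_inv₀, act_pi_xM, hy, hF]
  have hv1 : ((rot n)⁻¹ * v) 0 = (rot n)⁻¹ (v 0) := rfl
  have hv2 : (v * rot n)⁻¹ 0 = (rot n)⁻¹ (v⁻¹ 0) := rfl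
  rw [hv1, hv2]
  have r : ∀ a, rot n ((rot n)⁻¹ a) = a := fun a => (rot n).apply_symm_apply a
  have hc : (rot n)⁻¹ (v 0) = Fin.last (n + 1) ↔ (rot n)⁻¹ (v⁻¹ 0) = Fin.last (n + 1) := by
    rw [Equiv.Perm.inv_eq_iff_eq, Equiv.Perm.inv_eq_iff_eq, rot_last, Equiv.Perm.inv_eq_iff_eq,
      eq_comm]
  rw [r, r, if_congr hc rfl rfl, mul_inv, mul_assoc (rot n)⁻¹]
  ring

/-- The generators `s_i` (`i ∈ ℤ_N`) and `π` of the extended affine Weyl group. -/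
inductive WGen (n : ℕ) : Type
  | s (i : Fin (n + 2)) : WGen n
  | pi : WGen n

/-- The defining relations `s_i² = 1`, `s_i s_{i+1} s_i = s_{i+1} s_i s_{i+1}` and
`s_i s_j = s_j s_i` for `i - j ≠ 0, ±1` (the latter two if `N ≥ 3`), and `π s_i π⁻¹ = s_{i+1}`. The
indices are taken modulo `N`. -/
def WRel (n : ℕ) : Set (FreeGroup (WGen n)) :=
  {r | ∃ i, r = .of (.s i) * .of (.s i)} ∪
  {r | 3 ≤ n + 2 ∧ ∃ i, r = .of (.s i) * .of (.s (i + 1)) * .of (.s i) *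
    (.of (.s (i + 1)) * .of (.s i) * .of (.s (i + 1)))⁻¹} ∪
  {r | 3 ≤ n + 2 ∧ ∃ i j : Fin (n + 2), i - j ≠ 0 ∧ i - j ≠ 1 ∧ i - j ≠ -1 ∧
    r = .of (.s i) * .of (.s j) * (.of (.s j) * .of (.s i))⁻¹} ∪
  {r | ∃ i, r = .of .pi * .of (.s i) * (.of .pi)⁻¹ * (.of (.s (i + 1)))⁻¹}

/-- The extended affine Weyl group `W = Ω ⋉ W_Q ≃ S_N ⋉ ℤ^N`. -/
abbrev W (n : ℕ) : Type := PresentedGroup (WRel n)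

/-- The values of `τ(·, e)` on the generators of `W`; here `s_0 = π s_{N-1} π⁻¹`. -/
def tauGen (n : ℕ) (q : Set.Ioo (0 : ℝ) 1) (k : ℂˣ) : WGen n → (H0K n ≃ₗ[ℂ] H0K n)
  | .s i => Fin.cases (motive := fun _ => H0K n ≃ₗ[ℂ] H0K n)
      (tauPi q * tauS k (Fin.last n) * (tauPi q)⁻¹) (tauS k) i
  | .pi => tauPi q

theorem tauGen_succ {n : ℕ} (q : Set.Ioo (0 : ℝ) 1) (k : ℂˣ) (j : Fin (n + 1)) :
    tauGen n q k (.s j.succ) = tauS k j := rfl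

theorem tauGen_zero {n : ℕ} (q : Set.Ioo (0 : ℝ) 1) (k : ℂˣ) :
    tauGen n q k (.s 0) = tauPi q * tauS k (Fin.last n) * (tauPi q)⁻¹ := rfl

theorem tauGen_pi {n : ℕ} (q : Set.Ioo (0 : ℝ) 1) (k : ℂˣ) :
    tauGen n q k .pi = tauPi q := rfl

theorem tauGen_conj {n : ℕ} (q : Set.Ioo (0 : ℝ) 1) (k : ℂˣ) (i : Fin (n + 2)) :
    tauPi q * tauGen n q k (.s i) * (tauPi q)⁻¹ = tauGen n q k (.s (i + 1)) := by
  induction i using Fin.cases with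
  | zero =>
    have h1 : (0 + 1 : Fin (n + 2)) = (0 : Fin (n + 1)).succ := by simp
    rw [tauGen_zero, h1, tauGen_succ, mul_inv_eq_iff_eq_mul, ← mul_assoc, mul_inv_eq_iff_eq_mul]
    exact LinearEquiv.ext fun f => tauPi_tauPi_tauS q k f
  | succ j =>
    induction j using Fin.lastCases with
    | last =>
      have h1 : ((Fin.last n).succ + 1 : Fin (n + 2)) = 0 := by simp
      rw [h1, tauGen_zero, tauGen_succ]
    | cast j =>
      have h1 : (j.castSucc.succ + 1 : Fin (n + 2)) = j.succ.succ := by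
        rw [show j.castSucc.succ = j.succ.castSucc from rfl, Fin.coeSucc_eq_succ]
      rw [h1, tauGen_succ, tauGen_succ, mul_inv_eq_iff_eq_mul]
      exact LinearEquiv.ext fun f => tauPi_tauS q k j f

theorem fin_shift {n : ℕ} {R : Fin (n + 2) → Prop} (i₀ : Fin (n + 2)) (h₀ : R i₀)
    (hs : ∀ i, R i → R (i + 1)) (i : Fin (n + 2)) : R i := by
  have h : ∀ d : Fin (n + 2), R (i₀ + d) := by
    intro d
    induction d using Fin.induction with
    | zero => simpa using h₀
    | succ d ih =>
      have := hs _ ih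
      rwa [add_assoc, Fin.coeSucc_eq_succ] at this
  simpa using h (i - i₀)

theorem tauGen_rel (n : ℕ) (q : Set.Ioo (0 : ℝ) 1) (k : ℂˣ) :
    ∀ r ∈ WRel n, FreeGroup.lift (tauGen n q k) r = 1 := by
  have hconj : ∀ i, tauGen n q k (.s (i + 1)) = MulAut.conj (tauPi q) (tauGen n q k (.s i)) :=
    fun i => (tauGen_conj q k i).symm
  rintro r (((⟨i, rfl⟩ | ⟨hn, i, rfl⟩) | ⟨hn, i, j, h0, h1, h2, rfl⟩) | ⟨i, rfl⟩)
  · simp only [map_mul, FreeGroup.lift_apply_of]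
    refine fin_shift (R := fun i => tauGen n q k (.s i) * tauGen n q k (.s i) = 1)
      (0 : Fin (n + 1)).succ ?_ ?_ i
    · rw [tauGen_succ]
      exact LinearEquiv.ext fun f => tauS_tauS k 0 f
    · intro i hi
      rw [hconj, ← map_mul, hi, map_one]
  · simp only [map_mul, map_inv, FreeGroup.lift_apply_of]
    rw [mul_inv_eq_one]
    obtain ⟨m, rfl⟩ : ∃ m, n = m + 1 := ⟨n - 1, by omega⟩
    refine fin_shift (R := fun i => tauGen (m + 1) q k (.s i) * tauGen (m + 1) q k (.s (i + 1)) *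
      tauGen (m + 1) q k (.s i) = tauGen (m + 1) q k (.s (i + 1)) * tauGen (m + 1) q k (.s i) *
      tauGen (m + 1) q k (.s (i + 1))) (0 : Fin (m + 1)).castSucc.succ ?_ ?_ i
    · have e : ((0 : Fin (m + 1)).castSucc.succ + 1 : Fin (m + 3)) =
          (0 : Fin (m + 1)).succ.succ := by
        rw [show (0 : Fin (m + 1)).castSucc.succ = (0 : Fin (m + 1)).succ.castSucc from rfl,
          Fin.coeSucc_eq_succ]
      rw [e, tauGen_succ, tauGen_succ]
      exact LinearEquiv.ext fun f => tauS_braid k 0 f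
    · intro i hi
      have := congrArg (MulAut.conj (tauPi q)) hi
      simpa only [map_mul, ← hconj] using this
  · simp only [map_mul, map_inv, FreeGroup.lift_apply_of]
    rw [mul_inv_eq_one]
    obtain ⟨d, rfl⟩ : ∃ d, i = j + d := ⟨i - j, by simp⟩
    rw [add_sub_cancel_left] at h0 h1 h2
    refine fin_shift (R := fun j => tauGen n q k (.s (j + d)) * tauGen n q k (.s j) =
      tauGen n q k (.s j) * tauGen n q k (.s (j + d))) (0 : Fin (n + 1)).succ ?_ ?_ j
    · obtain ⟨e, he⟩ : ∃ e : Fin (n + 1), (0 : Fin (n + 1)).succ + d = e.succ := by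
        obtain ⟨e, he⟩ := Fin.exists_succ_eq.2 (show (0 : Fin (n + 1)).succ + d ≠ 0 by
          intro h
          apply h2
          rw [Fin.succ_zero_eq_one] at h
          exact (neg_eq_of_add_eq_zero_right h).symm)
        exact ⟨e, he.symm⟩
      have hlt : ((0 : Fin (n + 1)) : ℕ) + 1 < e := by
        have hd : (e.succ : Fin (n + 2)) - 1 = d := by
          rw [← he, Fin.succ_zero_eq_one, add_sub_cancel_left]
        by_contra! hc
        have hc' : (e : ℕ) = 0 ∨ (e : ℕ) = 1 := by
          rw [Fin.val_zero] at hc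
          omega
        rcases hc' with hc' | hc'
        · apply h0
          rw [← hd, sub_eq_zero, Fin.ext_iff, Fin.val_succ, hc']
          simp
        · apply h1
          rw [← hd, sub_eq_iff_eq_add, Fin.ext_iff, Fin.val_succ, hc', Fin.val_add]
          simp only [Fin.val_one]
          rw [Nat.mod_eq_of_lt]
          omega
      rw [he, tauGen_succ, tauGen_succ]
      exact LinearEquiv.ext fun f => (tauS_comm k hlt f).symm
    · intro j hj
      rw [show j + 1 + d = j + d + 1 by abel, hconj, hconj, ← map_mul, ← map_mul, hj]
  · simp only [map_mul, map_inv, FreeGroup.lift_apply_of]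
    rw [mul_inv_eq_one]
    exact tauGen_conj q k i

/-- The representation `w ↦ τ(w, e)` of `W` on `H_0^𝕂`. -/
def tauL (n : ℕ) (q : Set.Ioo (0 : ℝ) 1) (k : ℂˣ) : W n →* (H0K n ≃ₗ[ℂ] H0K n) :=
  PresentedGroup.toGroup (tauGen_rel n q k)

theorem tauIota_mul_self (n : ℕ) : (tauIota * tauIota : H0K n ≃ₗ[ℂ] H0K n) = 1 :=
  LinearEquiv.ext tauIota_tauIota

/-- The representation `w ↦ τ(e, w) = τ(ι) τ(w, e) τ(ι)` of `W` on `H_0^𝕂`. -/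
def tauR (n : ℕ) (q : Set.Ioo (0 : ℝ) 1) (k : ℂˣ) : W n →* (H0K n ≃ₗ[ℂ] H0K n) :=
  (MulAut.conj (tauIota (n := n))).toMonoidHom.comp (tauL n q k)

theorem conj_tauIota_apply {n : ℕ} (g : H0K n ≃ₗ[ℂ] H0K n) (f : H0K n) :
    MulAut.conj (tauIota (n := n)) g f = tauIota (g (tauIota f)) := by
  have h : (tauIota (n := n))⁻¹ = tauIota := inv_eq_of_mul_eq_one_left (tauIota_mul_self n)
  rw [MulAut.conj_apply, h]
  rfl

theorem conj_conj_tauIota {n : ℕ} (g : H0K n ≃ₗ[ℂ] H0K n) :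
    MulAut.conj (tauIota (n := n)) (MulAut.conj (tauIota (n := n)) g) = g := by
  rw [← MulAut.mul_apply, ← map_mul, tauIota_mul_self, map_one, MulAut.one_apply]

theorem commute_of_basic {n : ℕ} (q : Set.Ioo (0 : ℝ) 1) (k : ℂˣ) (g : H0K n ≃ₗ[ℂ] H0K n)
    (hS : ∀ i, Commute g (MulAut.conj tauIota (tauS k i)))
    (hP : Commute g (MulAut.conj tauIota (tauPi q))) (x : WGen n) :
    Commute g (MulAut.conj tauIota (tauGen n q k x)) := by
  cases x with
  | s i =>
    induction i using Fin.cases with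
    | zero =>
      rw [tauGen_zero, map_mul, map_mul, map_inv]
      exact (hP.mul_right (hS _)).mul_right hP.inv_right
    | succ j => exact hS j
  | pi => exact hP

theorem tauGen_commute {n : ℕ} (q : Set.Ioo (0 : ℝ) 1) (k : ℂˣ) (x y : WGen n) :
    Commute (tauGen n q k x) (MulAut.conj tauIota (tauGen n q k y)) := by
  have hSS : ∀ i j, Commute (tauS (n := n) k i) (MulAut.conj tauIota (tauS k j)) := by
    refine fun i j => LinearEquiv.ext fun f => ?_
    rw [LinearEquiv.mul_apply, LinearEquiv.mul_apply, conj_tauIota_apply, conj_tauIota_apply]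
    exact tauS_conj_tauS k i j f
  have hSP : ∀ i, Commute (tauS (n := n) k i) (MulAut.conj tauIota (tauPi q)) := by
    refine fun i => LinearEquiv.ext fun f => ?_
    rw [LinearEquiv.mul_apply, LinearEquiv.mul_apply, conj_tauIota_apply, conj_tauIota_apply]
    exact tauS_conj_tauPi q k i f
  have hPP : Commute (tauPi (n := n) q) (MulAut.conj tauIota (tauPi q)) := by
    refine LinearEquiv.ext fun f => ?_
    rw [LinearEquiv.mul_apply, LinearEquiv.mul_apply, conj_tauIota_apply, conj_tauIota_apply]
    exact tauPi_conj_tauPi q f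
  have hPS : ∀ i, Commute (tauPi (n := n) q) (MulAut.conj tauIota (tauS k i)) := by
    intro i
    have := ((hSP i).map (MulAut.conj (tauIota (n := n)))).symm
    rwa [conj_conj_tauIota] at this
  refine commute_of_basic q k _ (fun j => ?_) ?_ y
  · have := commute_of_basic q k (tauS (n := n) k j) (hSS j) (hSP j) x
    have := (this.map (MulAut.conj (tauIota (n := n)))).symm
    rwa [conj_conj_tauIota] at this
  · have := commute_of_basic q k (tauPi (n := n) q) hPS hPP x
    have := (this.map (MulAut.conj (tauIota (n := n)))).symm
    rwa [conj_conj_tauIota] at this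

theorem tauL_commute_tauR {n : ℕ} (q : Set.Ioo (0 : ℝ) 1) (k : ℂˣ) (v w : W n) :
    Commute (tauL n q k v) (tauR n q k w) := by
  have hind : ∀ (p : W n → Prop), (∀ x, p (PresentedGroup.of x)) → p 1 →
      (∀ a b, p a → p b → p (a * b)) → (∀ a, p a → p a⁻¹) → ∀ w, p w := by
    intro p hof h1 hmul hinv w
    have hw : w ∈ Subgroup.closure (Set.range (PresentedGroup.of (rels := WRel n))) := by
      rw [PresentedGroup.closure_range_of]
      trivial
    induction hw using Subgroup.closure_induction with
    | mem x hx =>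
      obtain ⟨y, rfl⟩ := hx
      exact hof y
    | one => exact h1
    | mul a b _ _ ha hb => exact hmul a b ha hb
    | inv a _ ha => exact hinv a ha
  refine hind (fun v => Commute (tauL n q k v) (tauR n q k w)) (fun x => ?_) ?_ ?_ ?_ v
  · refine hind (fun w => Commute (tauL n q k (.of x)) (tauR n q k w)) (fun y => ?_) ?_ ?_ ?_ w
    · have := tauGen_commute q k x y
      rw [← PresentedGroup.toGroup.of (tauGen_rel n q k),
        ← PresentedGroup.toGroup.of (tauGen_rel n q k)] at this
      exact this
    · rw [map_one]
      exact Commute.one_right _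
    · intro a b ha hb
      rw [map_mul]
      exact ha.mul_right hb
    · intro a ha
      rw [map_inv]
      exact ha.inv_right
  · rw [map_one]
    exact Commute.one_left _
  · intro a b ha hb
    rw [map_mul]
    exact ha.mul_left hb
  · intro a ha
    rw [map_inv]
    exact ha.inv_left

/-- The homomorphism from the group of order two determined by an element `g` with `g² = 1`. -/
def z2Hom {G : Type*} [Group G] (g : G) (hg : g * g = 1) : Multiplicative (ZMod 2) →* G where
  toFun a := g ^ (Multiplicative.toAdd a).val
  map_one' := by simp
  map_mul' a b := by
    have h2 : g ^ 2 = 1 := by rw [pow_two, hg]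
    rw [toAdd_mul, ZMod.val_add, ← pow_add]
    exact (pow_eq_pow_mod _ h2).symm

/-- The swap automorphism `(w, w') ↦ (w', w)` of `W × W`. -/
def swapW (n : ℕ) : MulAut (W n × W n) := MulEquiv.prodComm

/-- The group `𝕎 = ℤ_2 ⋉ (W × W)`, with `ι (w, w') = (w', w) ι` for the generator `ι` of `ℤ_2`. -/
abbrev WW (n : ℕ) : Type :=
  (W n × W n) ⋊[z2Hom (swapW n) (MulEquiv.ext fun _ => rfl)] Multiplicative (ZMod 2)

/-- The element `ι` of `𝕎`. -/
def iota (n : ℕ) : WW n := SemidirectProduct.inr (Multiplicative.ofAdd 1)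

/-- The action `τ` of `𝕎` on `H_0^𝕂` by complex linear automorphisms. It is determined by
`τ(s_i, e)`, `τ(π, e)` and `τ(ι)`. -/
def tau (n : ℕ) (q : Set.Ioo (0 : ℝ) 1) (k : ℂˣ) : WW n →* (H0K n ≃ₗ[ℂ] H0K n) :=
  SemidirectProduct.lift
    (MonoidHom.noncommCoprod (tauL n q k) (tauR n q k) (tauL_commute_tauR q k))
    (z2Hom tauIota (tauIota_mul_self n)) (by
      intro a
      have ha : a = 1 ∨ a = Multiplicative.ofAdd 1 := by
        revert a
        decide
      refine MonoidHom.ext fun w => ?_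
      rcases ha with rfl | rfl
      · simp
      · have h : z2Hom (tauIota (n := n)) (tauIota_mul_self n) (Multiplicative.ofAdd 1) = tauIota :=
          pow_one _
        have h' : z2Hom (swapW n) (MulEquiv.ext fun _ => rfl) (Multiplicative.ofAdd 1) = swapW n :=
          pow_one _
        rw [h, h']
        change tauL n q k w.2 * tauR n q k w.1 =
          MulAut.conj tauIota (tauL n q k w.1 * tauR n q k w.2)
        rw [map_mul]
        change _ = tauR n q k w.1 * MulAut.conj tauIota (MulAut.conj tauIota (tauL n q k w.2))
        rw [conj_conj_tauIota]
        exact tauL_commute_tauR q k _ _)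

theorem tau_iota {n : ℕ} (q : Set.Ioo (0 : ℝ) 1) (k : ℂˣ) : tau n q k (iota n) = tauIota := by
  rw [tau, iota, SemidirectProduct.lift_inr]
  exact pow_one _

/-- The translation element
`ε_{j+1} = s_j ⋯ s_2 s_1 π s_{N-1} s_{N-2} ⋯ s_{j+1}` of `W`, for `j = 0, …, N - 1`. -/
def eps {n : ℕ} (j : Fin (n + 2)) : W n :=
  (((List.finRange (n + 2)).filter fun i => 0 < i ∧ i ≤ j).reverse.map fun i =>
    PresentedGroup.of (.s i)).prod * PresentedGroup.of .pi *
  (((List.finRange (n + 2)).filter fun i => j < i).reverse.map fun i =>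
    PresentedGroup.of (.s i)).prod

/-- The element of `W` given by `λ ∈ ℤ^N`, i.e. the product of the powers of the (mutually
commuting) elements `ε_j`. -/
def transl {n : ℕ} (l : Fin (n + 2) → ℤ) : W n :=
  ((List.finRange (n + 2)).map fun j => eps j ^ l j).prod

/-- The element `(λ, μ)` of `ℤ^N × ℤ^N ⊆ 𝕎`. -/
def translWW {n : ℕ} (l m : Fin (n + 2) → ℤ) : WW n :=
  SemidirectProduct.inl (transl l, transl m)

/-- The asymptotic region `B_ε⁻¹ × B_ε`, where `B_ε = {t ∈ T | |t^{α_i}| < ε for all i}` and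
`t^{α_i} = t_i / t_{i+1}`. -/
def region (n : ℕ) (ε : ℝ) : Set (Torus n × Torus n) :=
  {p | ∀ i : Fin (n + 1), ‖(p.1 i.succ / p.1 i.castSucc : ℂ)‖ < ε ∧
    ‖(p.2 i.castSucc / p.2 i.succ : ℂ)‖ < ε}

/-- The pairs `(α, β) ∈ Q_+ × Q_+`, by their coordinates with respect to the simple roots `α_i`. -/
abbrev QIdx (n : ℕ) : Type := (Fin (n + 1) → ℕ) × (Fin (n + 1) → ℕ)

/-- The monomial `t^{-α} γ^β`. -/
def monomial {n : ℕ} (ab : QIdx n) (p : Torus n × Torus n) : ℂ :=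
  ∏ i : Fin (n + 1), (p.1 i.succ / p.1 i.castSucc : ℂ) ^ ab.1 i *
    (p.2 i.castSucc / p.2 i.succ : ℂ) ^ ab.2 i

/-- The holomorphic function `g` on the open set `U` is the restriction of the meromorphic
function `F`. -/
def AgreesOn {n : ℕ} (F : Mer n) (g : Torus n × Torus n → ℂ) (U : Set (Torus n × Torus n)) :
    Prop :=
  ∃ a b : Hol n, b ≠ 0 ∧ F = algebraMap (Hol n) (Mer n) a / algebraMap (Hol n) (Mer n) b ∧
    ∀ p ∈ U, g p * b.1 p = a.1 p

/-- `Ψ` has a power series expansion `Ψ(t, γ) = ∑_{α, β} K_{α, β} t^{-α} γ^β`, normally convergent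
on compacta of `B_ε⁻¹ × B_ε`, with `K_{0, 0} = T_{w₀}`, for some `ε > 0`. -/
def HasExpansion {n : ℕ} (Ψ : H0K n) : Prop :=
  ∃ ε : ℝ, 0 < ε ∧ ∃ K : QIdx n → Equiv.Perm (Fin (n + 2)) → ℂ,
    (∀ C ⊆ region n ε, IsCompact C → ∀ w, ∃ M : QIdx n → ℝ, Summable M ∧
      ∀ ab, ∀ p ∈ C, ‖K ab w * monomial ab p‖ ≤ M ab) ∧
    (∀ w, AgreesOn (Ψ w) (fun p => ∑' ab, K ab w * monomial ab p) (region n ε)) ∧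
    K 0 = Pi.single Fin.revPerm 1

/-- `Ψ` is a solution of the gauged bispectral quantum KZ equations
`D_{(λ, μ)}(t, γ) Ψ(q^{-λ} t, q^μ γ) = Ψ(t, γ)`, where
`D_{(λ, μ)}(t, γ) = W_κ(t, γ)⁻¹ C_{(λ, μ)}(t, γ) W_κ(q^{-λ} t, q^μ γ)` and
`(τ(λ, μ) f)(t, γ) = C_{(λ, μ)}(t, γ) f(q^{-λ} t, q^μ γ)`. -/
def IsGaugedSolution (n : ℕ) (q : Set.Ioo (0 : ℝ) 1) (k κ : ℂˣ) (Ψ : H0K n) : Prop :=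
  ∀ l m : Fin (n + 2) → ℤ,
    (Wk n q k κ)⁻¹ • tau n q k (translWW l m) (Wk n q k κ • Ψ) = Ψ

/-- The properties that characterize `Ψ`. -/
def IsAsymptoticallyFree (n : ℕ) (q : Set.Ioo (0 : ℝ) 1) (k κ : ℂˣ) (Ψ : H0K n) : Prop :=
  IsGaugedSolution n q k κ Ψ ∧ HasExpansion Ψ

/-- The solution `Ψ` of the gauged equations with the given asymptotic expansion. -/
def Psi (n : ℕ) (q : Set.Ioo (0 : ℝ) 1) (k κ : ℂˣ) : H0K n :=
  Classical.epsilon (IsAsymptoticallyFree n q k κ)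

/-- The basic asymptotically free solution `Φ_κ = W_κ Ψ`. -/
def Phi (n : ℕ) (q : Set.Ioo (0 : ℝ) 1) (k κ : ℂˣ) : H0K n :=
  Wk n q k κ • Psi n q k κ

end

end BqKZ

/-! On $B_\varepsilon^{-1}\times B_\varepsilon$ the expansion says that $\Psi$ is analytic in the
simple root variables $x_i=t_{i+1}/t_i$ and $y_i=\gamma_i/\gamma_{i+1}$ near the origin, with value
$T_{w_0}$ there. The equations thus form a commuting family of $q$-difference systems at one point.
The proof finds a single member of this family that multiplies all variables by $q$ and whose
coefficient matrix is a projection at the origin.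

The translations are generated by $\omega_l=\epsilon_1+\dots+\epsilon_{N-l}$, $0\le l<N$. In $W$ one
has $\omega_l=g_l^{N-l}$ with $g_l=\pi s_{N-1}\cdots s_{N-l}$, and $\omega_l$ rescales only the
variable $x_{N-l}$ (none if $l=0$). Expanding $\tau(g_l)^{N-l}$ (`tauL_gW_pow`) exhibits three
ingredients: factors $1+c\,(T_i-k)$, which tend to $kT_i^{-1}$ at the origin; left multiplications
by $\sigma$ on the index $w$ of $T_w$; and monomials in $\gamma$. The limit without the monomials
maps $T_{w_0}$ to $k^{l(N-l)}T_{w_0}$ (`valQ_single_self`). Among the monomials the one at $w_0$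
dominates, with a nonzero limit of the quotient only for those $w$ such that $w^{-1}$ maps the first
$N-l$ indices to the last $N-l$ (`reg_yP_div`). The quasi-periodicity of $\theta$ makes $W_\kappa$
contribute exactly the inverse of $k^{l(N-l)}$ times the dominant monomial (`act_bB_pow_Wk`). So the
gauged operator of $\omega_l$ is regular at the origin, and its limit fixes $T_{w_0}$ and has its
image in the span of these $T_w$ (`isRegOp_gau`).

The limits commute because the operators do. Hence the limit of the product over all $l$ has its
image in the intersection of these spans, which is the line of $T_{w_0}$. Multiplying by the
conjugate under $\tau(\iota)$, which rescales the $y_i$, gives the master operator $T$ of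
`exists_master`. The equation $T\Psi=\Psi$ reads $F(x)=M(x)F(qx)$ with $M$ rational and $M(0)$
idempotent. It has a solution with value $T_{w_0}$ that is a quotient of entire functions of the
root variables, hence meromorphic on all of $T\times T$ (`IsRegOp.exists_solution`), and a solution
with value $0$ vanishes (`IsRegOp.eq_zero`). If $T'$ is another operator of the family, then
$T'\Psi-\Psi$ is fixed by $T$ and has value $0$, so $\Psi$ solves every equation
(`IsRegOp.apply_eq_self`).

Self-duality follows from uniqueness: $W_\kappa$ is $\iota$-invariant, $\tau(\iota)$ exchanges the
two halves of the system and the variables $x_i$, $y_i$, and it preserves the leading term because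
$w_0^{-1}=w_0$. -/

namespace BqKZ

noncomputable section

/-! ### The translations $\epsilon_1+\dots+\epsilon_{N-l}$ in the extended affine Weyl group. -/

/-- The generator `s_m` of `W`, with the index read modulo `N`. -/
def sW {n : ℕ} (m : ℕ) : W n := PresentedGroup.of (.s (Fin.ofNat (n + 2) m))

/-- The generator `π` of `W`. -/
def piW {n : ℕ} : W n := PresentedGroup.of .pi

theorem ofNat_val_eq {n : ℕ} (i : Fin (n + 2)) : Fin.ofNat (n + 2) i = i := by
  ext
  simp

theorem sW_val {n : ℕ} (i : Fin (n + 2)) : sW (i : ℕ) = (PresentedGroup.of (.s i) : W n) := by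
  rw [sW, ofNat_val_eq]

theorem ofNat_succ_eq {n : ℕ} (m : ℕ) :
    Fin.ofNat (n + 2) (m + 1) = Fin.ofNat (n + 2) m + 1 := by
  ext
  simp [Fin.val_add]

theorem sW_mul_self {n : ℕ} (m : ℕ) : (sW m * sW m : W n) = 1 := by
  refine PresentedGroup.one_of_mem (rels := WRel n) (x := .of (.s _) * .of (.s _)) ?_
  exact Or.inl (Or.inl (Or.inl ⟨_, rfl⟩))

theorem sW_mul_sW_mul {n : ℕ} (m : ℕ) (x : W n) : sW m * (sW m * x) = x := by
  rw [← mul_assoc, sW_mul_self, one_mul]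

theorem sW_braid {n : ℕ} (hn : 1 ≤ n) (m : ℕ) :
    (sW m * sW (m + 1) * sW m : W n) = sW (m + 1) * sW m * sW (m + 1) := by
  have h : (PresentedGroup.mk (WRel n)) (.of (.s (Fin.ofNat (n + 2) m)) *
      .of (.s (Fin.ofNat (n + 2) m + 1)) * .of (.s (Fin.ofNat (n + 2) m)) *
      (.of (.s (Fin.ofNat (n + 2) m + 1)) * .of (.s (Fin.ofNat (n + 2) m)) *
        .of (.s (Fin.ofNat (n + 2) m + 1)))⁻¹) = 1 := by
    refine PresentedGroup.one_of_mem ?_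
    exact Or.inl (Or.inl (Or.inr ⟨by omega, _, rfl⟩))
  rw [map_mul, map_inv, mul_inv_eq_one, ← ofNat_succ_eq] at h
  exact h

theorem sW_comm {n : ℕ} {a b : ℕ} (ha : 1 ≤ a) (hab : a + 2 ≤ b) (hb : b ≤ n + 1) :
    Commute (sW a : W n) (sW b) := by
  have h : (PresentedGroup.mk (WRel n)) (.of (.s (Fin.ofNat (n + 2) b)) *
      .of (.s (Fin.ofNat (n + 2) a)) *
      (.of (.s (Fin.ofNat (n + 2) a)) * .of (.s (Fin.ofNat (n + 2) b)))⁻¹) = 1 := by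
    refine PresentedGroup.one_of_mem ?_
    refine Or.inl (Or.inr ⟨by omega, _, _, ?_, ?_, ?_, rfl⟩)
    · rw [sub_ne_zero, Ne, Fin.ext_iff]
      simp only [Fin.val_ofNat]
      rw [Nat.mod_eq_of_lt (by omega), Nat.mod_eq_of_lt (by omega)]
      omega
    · rw [Ne, sub_eq_iff_eq_add', ← ofNat_succ_eq, Fin.ext_iff]
      simp only [Fin.val_ofNat]
      rw [Nat.mod_eq_of_lt (by omega), Nat.mod_eq_of_lt (by omega)]
      omega
    · rw [Ne, sub_eq_iff_eq_add, neg_add_eq_sub, eq_sub_iff_add_eq, ← ofNat_succ_eq, Fin.ext_iff]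
      simp only [Fin.val_ofNat]
      rw [Nat.mod_eq_of_lt (show a < n + 2 by omega)]
      rcases (show b + 1 = n + 2 ∨ b + 1 < n + 2 by omega) with h | h
      · rw [h, Nat.mod_self]
        omega
      · rw [Nat.mod_eq_of_lt h]
        omega
  rw [map_mul, map_inv, mul_inv_eq_one] at h
  exact h.symm

theorem piW_mul_sW {n : ℕ} (m : ℕ) : (piW * sW m : W n) = sW (m + 1) * piW := by
  have h : (PresentedGroup.mk (WRel n)) (.of .pi * .of (.s (Fin.ofNat (n + 2) m)) * (.of .pi)⁻¹ *
      (.of (.s (Fin.ofNat (n + 2) m + 1)))⁻¹) = 1 :=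
    PresentedGroup.one_of_mem (Or.inr ⟨_, rfl⟩)
  rw [map_mul, map_mul, map_inv, map_inv, mul_inv_eq_one, mul_inv_eq_iff_eq_mul,
    ← ofNat_succ_eq] at h
  exact h

/-- The descending product `s_a s_{a-1} ⋯ s_{a-l+1}`. -/
def descW {n : ℕ} (a : ℕ) : ℕ → W n
  | 0 => 1
  | l + 1 => descW a l * sW (a - l)

theorem descW_succ {n : ℕ} (a l : ℕ) : (descW a (l + 1) : W n) = descW a l * sW (a - l) := rfl

theorem descW_succ' {n : ℕ} (a l : ℕ) :
    (descW (a + 1) (l + 1) : W n) = sW (a + 1) * descW a l := by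
  induction l with
  | zero => simp [descW]
  | succ l ih => rw [descW_succ, ih, descW_succ, mul_assoc, Nat.add_sub_add_right]

theorem descW_mul_of {n : ℕ} (x : W n) (a l : ℕ) (hl : l ≤ a)
    (h : ∀ m, m < l → x * sW (a + 1 - m) = sW (a - m) * x) :
    x * descW (a + 1) l = descW a l * x := by
  induction l with
  | zero => simp [descW]
  | succ l ih =>
    rw [descW_succ, ← mul_assoc, ih (by omega) fun m hm => h m (by omega), mul_assoc,
      h l (by omega), descW_succ, mul_assoc]

theorem piW_mul_descW {n : ℕ} (a l : ℕ) (hl : l ≤ a) :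
    (piW * descW a l : W n) = descW (a + 1) l * piW := by
  induction l with
  | zero => simp [descW]
  | succ l ih =>
    rw [descW_succ, ← mul_assoc, ih (by omega), mul_assoc, piW_mul_sW, descW_succ, mul_assoc,
      show a - l + 1 = a + 1 - l by omega]

theorem descW_comm_sW {n : ℕ} {l m : ℕ} (hm : 1 ≤ m) (h : m + l ≤ n) :
    Commute (descW (n + 1) l : W n) (sW m) := by
  induction l with
  | zero => exact Commute.one_left _
  | succ l ih =>
    exact (ih (by omega)).mul_left (sW_comm hm (by omega) (by omega)).symm

/-- The factors of small index commute with $s_{m+1}$; when it meets the pair $s_{m+1}s_m$, one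
braid move turns it into $s_m$, which commutes with the remaining factors of large index. -/
theorem descW_mul_sW {n : ℕ} {l m : ℕ} (h1 : n + 2 ≤ m + l) (h2 : m ≤ n) (h3 : l ≤ n + 1) :
    (descW (n + 1) l * sW (m + 1) : W n) = sW m * descW (n + 1) l := by
  induction l with
  | zero => omega
  | succ l ih =>
    rcases (show n + 2 ≤ m + l ∨ n + 1 = m + l by omega) with h | h
    · rw [descW_succ, mul_assoc,
        ((sW_comm (n := n) (show 1 ≤ n + 1 - l by omega) (show n + 1 - l + 2 ≤ m + 1 by omega)
        (by omega)).eq), ← mul_assoc, ih h (by omega), mul_assoc]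
    · obtain ⟨l, rfl⟩ : ∃ l', l = l' + 1 := ⟨l - 1, by omega⟩
      have e : n + 1 - (l + 1) = m := by omega
      have e' : n + 1 - l = m + 1 := by omega
      have hb := sW_braid (n := n) (by omega) m
      rw [descW_succ, descW_succ, e, e', mul_assoc, mul_assoc, ← mul_assoc (sW (m + 1)), ← hb]
      simp only [← mul_assoc]
      rw [(descW_comm_sW (n := n) (l := l) (m := m) (by omega) (by omega)).eq]

/-- The element `π s_{N-1} ⋯ s_{N-l}`: it acts on `T` by the cyclic permutation of the first
`N - l` coordinates, followed by the multiplication of the first one by `q`. -/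
def gW {n : ℕ} (l : ℕ) : W n := piW * descW (n + 1) l

theorem gW_succ {n : ℕ} (l : ℕ) : (gW (l + 1) : W n) = gW l * sW (n + 1 - l) := by
  rw [gW, descW_succ, ← mul_assoc, gW]

/-- Together with `gW_sq_mul_sW` this shows that $g_l$ relates to $s_1,\dots,s_{N-1-l}$ as $\pi$
does to the finite reflections for $\mathrm{GL}_{N-l}$. -/
theorem gW_mul_sW {n : ℕ} {l m : ℕ} (hm : 1 ≤ m) (h : m + l ≤ n) :
    (gW l * sW m : W n) = sW (m + 1) * gW l := by
  rw [gW, mul_assoc, (descW_comm_sW hm h).eq, ← mul_assoc, piW_mul_sW, mul_assoc]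

theorem gW_pow_mul_sW {n : ℕ} {l m : ℕ} (a : ℕ) (hm : 1 ≤ m) (h : m + a + l ≤ n + 1) :
    (gW l ^ a * sW m : W n) = sW (m + a) * gW l ^ a := by
  induction a with
  | zero => simp
  | succ a ih =>
    rw [pow_succ', mul_assoc, ih (by omega), ← mul_assoc, gW_mul_sW (by omega) (by omega),
      mul_assoc]
    rfl

/-- The wrap-around relation for $\mathrm{GL}_{N-l}$: conjugation by $g_l$ takes the last reflection
to the affine one, and a second conjugation takes that to $s_1$. Squaring avoids naming the affine
reflection of the smaller group. -/
theorem gW_sq_mul_sW {n : ℕ} {l : ℕ} (hl : l ≤ n) :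
    (gW l ^ 2 * sW (n + 1 - l) : W n) = sW 1 * gW l ^ 2 := by
  have e : (gW l ^ 2 : W n) = piW * piW * (descW n l * descW (n + 1) l) := by
    rw [pow_two, gW, mul_assoc, ← mul_assoc (descW (n + 1) l), ← piW_mul_descW _ _ hl]
    simp only [mul_assoc]
  -- Indices are read modulo $N$, so $s_1=s_{N+1}$, and $\pi^2$ shifts indices by two.
  have e1 : (sW 1 : W n) * (piW * piW) = piW * piW * sW (n + 1) := by
    have : (sW 1 : W n) = sW (n + 1 + 1 + 1) := by
      rw [sW, sW]
      congr 2
      ext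
      simp [show n + 1 + 1 + 1 = 1 + (n + 2) by ring]
    rw [this, ← mul_assoc, ← piW_mul_sW, mul_assoc, ← piW_mul_sW, mul_assoc]
  have e2 : (descW n l * descW (n + 1) (l + 1) : W n) =
      descW (n + 1) (l + 1) * descW (n + 1) l := by
    refine (descW_mul_of _ n l hl ?_).symm
    intro m hm
    rw [show n + 1 - m = n - m + 1 by omega]
    exact descW_mul_sW (by omega) (by omega) (by omega)
  calc gW l ^ 2 * sW (n + 1 - l)
      = piW * piW * (descW n l * descW (n + 1) (l + 1)) := by
        rw [e, descW_succ]
        simp only [mul_assoc]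
    _ = sW 1 * gW l ^ 2 := by
        rw [e2, e, ← mul_assoc (sW 1), e1, descW_succ']
        simp only [mul_assoc]

/-- The translation `ε_1 + ⋯ + ε_{N-l}` as an element of `W`. -/
def omW {n : ℕ} (l : ℕ) : W n := gW l ^ (n + 2 - l)

/-- Conjugating $s_m$ by $g_l$ repeatedly takes it up to the last index in $N-1-l-m$ steps, around
to $s_1$ in two, and back up to $s_m$ in $m-1$. These add up to the exponent $N-l$ of $\omega_l$. -/
theorem omW_comm_sW {n : ℕ} {l m : ℕ} (hm : 1 ≤ m) (h : m + l ≤ n + 1) :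
    Commute (omW l : W n) (sW m) := by
  have e : n + 2 - l = (m - 1) + (2 + (n + 1 - l - m)) := by omega
  change _ * _ = _ * _
  rw [omW, e, pow_add, pow_add, mul_assoc, mul_assoc, gW_pow_mul_sW _ hm (by omega),
    ← mul_assoc (gW l ^ 2), show m + (n + 1 - l - m) = n + 1 - l by omega,
    gW_sq_mul_sW (by omega), mul_assoc, ← mul_assoc (gW l ^ (m - 1)),
    gW_pow_mul_sW _ le_rfl (by omega), show 1 + (m - 1) = m by omega, mul_assoc]

/-- Passing from $g_l$ to $g_{l'}$ appends reflections $s_i$ with $i\le N-1-l$, all of which commute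
with $\omega_l$. -/
theorem omW_comm_gW {n : ℕ} {l l' : ℕ} (h : l ≤ l') (h' : l' ≤ n + 1) :
    Commute (omW l : W n) (gW l') := by
  induction l', h using Nat.le_induction with
  | base => exact (Commute.refl _).pow_left _
  | succ l' hl ih =>
    rw [gW_succ]
    exact (ih (by omega)).mul_right (omW_comm_sW (by omega) (by omega))

theorem omW_comm {n : ℕ} {l l' : ℕ} (h : l ≤ n + 1) (h' : l' ≤ n + 1) :
    Commute (omW l : W n) (omW l') := by
  rcases le_total l l' with hl | hl
  · exact (omW_comm_gW hl h').pow_right _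
  · exact ((omW_comm_gW hl h).pow_right _).symm

/-- The product telescopes: $g_{l+1}=g_ls_j$, while moving $s_{j-m}$ to the left through $g_l^m$
turns it into $s_j$, so the two cancel. -/
theorem gW_pow_mul_descW {n : ℕ} {l j : ℕ} (hj : j + l = n + 1) (m : ℕ) (hm : m ≤ j) :
    (gW (l + 1) ^ m * descW j m : W n) = gW l ^ m := by
  induction m with
  | zero => simp [descW]
  | succ m ih =>
    rw [descW_succ, pow_succ', mul_assoc, ← mul_assoc (gW (l + 1) ^ m), ih (by omega),
      gW_pow_mul_sW _ (by omega) (by omega), gW_succ, show n + 1 - l = j by omega,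
      show j - m + m = j by omega, mul_assoc, sW_mul_sW_mul, ← pow_succ']

theorem filter_range_pos_le (N j : ℕ) (h : j < N) :
    (List.range N).filter (fun i => 0 < i ∧ i ≤ j) = List.range' 1 j := by
  refine List.Pairwise.eq_of_mem_iff (r := (· < ·)) ?_ ?_ ?_
  · exact List.pairwise_lt_range.filter _
  · exact List.pairwise_lt_range'
  · intro a
    simp only [List.mem_filter, List.mem_range, List.mem_range'_1, decide_eq_true_eq]
    omega

theorem filter_range_lt (N j : ℕ) (h : j < N) :
    (List.range N).filter (fun i => j < i) = List.range' (j + 1) (N - 1 - j) := by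
  refine List.Pairwise.eq_of_mem_iff (r := (· < ·)) ?_ ?_ ?_
  · exact List.pairwise_lt_range.filter _
  · exact List.pairwise_lt_range'
  · intro a
    simp only [List.mem_filter, List.mem_range, List.mem_range'_1, decide_eq_true_eq]
    omega

theorem prod_reverse_range' {n : ℕ} (a l : ℕ) :
    ((List.range' (a + 1) l).reverse.map (sW : ℕ → W n)).prod = descW (a + l) l := by
  induction l with
  | zero => simp [descW]
  | succ l ih =>
    rw [List.range'_concat, List.reverse_append, List.map_append, List.prod_append, ih,
      ← add_assoc, descW_succ']
    simp [show a + 1 + l = a + l + 1 by ring]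

theorem prod_filter_finRange {n : ℕ} (p : ℕ → Bool) :
    (((List.finRange (n + 2)).filter fun i : Fin (n + 2) => p i).reverse.map fun i =>
      (PresentedGroup.of (.s i) : W n)).prod =
    (((List.range (n + 2)).filter p).reverse.map sW).prod := by
  have e : (List.range (n + 2)).filter p =
      ((List.finRange (n + 2)).filter fun i : Fin (n + 2) => p i).map (fun i : Fin (n + 2) => (i : ℕ)) := by
    rw [← List.map_coe_finRange_eq_range, List.filter_map]
    rfl
  rw [e, ← List.map_reverse, List.map_map]
  congr 2
  funext i
  exact (sW_val i).symm

theorem eps_eq {n : ℕ} (j : Fin (n + 2)) :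
    eps j = descW j j * piW * descW (n + 1) (n + 1 - j) := by
  have h1 := prod_filter_finRange (n := n) (fun i => 0 < i ∧ i ≤ j)
  have h2 := prod_filter_finRange (n := n) (fun i => j < i)
  rw [filter_range_pos_le _ _ j.isLt, ← zero_add 1, prod_reverse_range', zero_add] at h1
  rw [filter_range_lt _ _ j.isLt, prod_reverse_range',
    show (j : ℕ) + (n + 2 - 1 - j) = n + 1 by omega,
    show n + 2 - 1 - (j : ℕ) = n + 1 - j by omega] at h2
  rw [eps, ← h1, ← h2]
  rfl

/-- In additive notation, $\omega_{l+1}+\epsilon_{N-l}=\omega_l$ with $l=N-1-j$ for the zero-based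
index $j$. This triangular relation makes the $\omega_l$ and the $\epsilon_j$ generate the same
subgroup. -/
theorem omW_succ_mul_eps {n : ℕ} (j : Fin (n + 2)) :
    omW (n + 1 - j + 1) * eps j = omW (n + 1 - j) := by
  rw [omW, omW, eps_eq, show n + 2 - (n + 1 - (j : ℕ) + 1) = j by omega, mul_assoc, ← mul_assoc,
    gW_pow_mul_descW (by omega) _ le_rfl, show n + 2 - (n + 1 - (j : ℕ)) = j + 1 by omega,
    pow_succ]
  rfl

theorem omW_last {n : ℕ} : (omW (n + 2) : W n) = 1 := by
  rw [omW, Nat.sub_self, pow_zero]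

/-- Phrased for an arbitrary subgroup, so that it can be applied to the stabilizer of a solution. -/
theorem eps_mem_of_omW_mem {n : ℕ} (S : Subgroup (W n)) (h : ∀ l ≤ n + 1, omW l ∈ S)
    (j : Fin (n + 2)) : eps j ∈ S := by
  have h' : ∀ l ≤ n + 2, omW l ∈ S := by
    intro l hl
    rcases (show l ≤ n + 1 ∨ l = n + 2 by omega) with h1 | rfl
    · exact h l h1
    · rw [omW_last]
      exact S.one_mem
  rw [← S.mul_mem_cancel_left (h' (n + 1 - j + 1) (by omega)), omW_succ_mul_eps]
  exact h' _ (by omega)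

theorem omW_mem_of_eps_mem {n : ℕ} (S : Subgroup (W n)) (h : ∀ j : Fin (n + 2), eps j ∈ S)
    (l : ℕ) (hl : l ≤ n + 1) : omW l ∈ S := by
  have h' : ∀ i l, i + l = n + 2 → omW l ∈ S := by
    intro i
    induction i with
    | zero =>
      intro l hl
      rw [show l = n + 2 by omega, omW_last]
      exact S.one_mem
    | succ i ih =>
      intro l hl
      have := omW_succ_mul_eps (n := n) ⟨i, by omega⟩
      rw [show n + 1 - i = l by omega] at this
      rw [← this]
      exact S.mul_mem (ih _ (by omega)) (h _)
  exact h' (n + 2 - l) l (by omega)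

theorem transl_mem {n : ℕ} (S : Subgroup (W n)) (h : ∀ j : Fin (n + 2), eps j ∈ S)
    (l : Fin (n + 2) → ℤ) : transl l ∈ S := by
  refine S.list_prod_mem fun x hx => ?_
  obtain ⟨j, -, rfl⟩ := List.mem_map.1 hx
  exact S.zpow_mem (h j) _

theorem transl_single {n : ℕ} (j : Fin (n + 2)) : transl (Pi.single j 1) = eps j := by
  rw [transl, List.prod_map_eq_pow_single j]
  · simp [List.count_eq_one_of_mem (List.nodup_finRange _) (List.mem_finRange j)]
  · intro i hi _
    simp [hi]

theorem transl_zero {n : ℕ} : transl (0 : Fin (n + 2) → ℤ) = 1 := by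
  simp [transl]

/-! ### Convergent power series in several variables, indexed by exponent vectors. -/

section PowerSeries

variable {σ : Type*} [Fintype σ]

/-- The monomial `x^a`. -/
def mon (a : σ →₀ ℕ) (x : σ → ℂ) : ℂ := ∏ i, x i ^ a i

theorem mon_zero (x : σ → ℂ) : mon 0 x = 1 := by simp [mon]

theorem mon_add (a b : σ →₀ ℕ) (x : σ → ℂ) : mon (a + b) x = mon a x * mon b x := by
  simp [mon, pow_add, Finset.prod_mul_distrib]

theorem mon_smul (c : ℂ) (a : σ →₀ ℕ) (x : σ → ℂ) : mon a (c • x) = c ^ a.degree * mon a x := by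
  simp [mon, mul_pow, Finset.prod_mul_distrib, Finset.prod_pow_eq_pow_sum, Finsupp.degree_eq_sum]

theorem norm_mon_le {a : σ →₀ ℕ} {x : σ → ℂ} {r : ℝ} (hx : ∀ i, ‖x i‖ ≤ r) :
    ‖mon a x‖ ≤ r ^ a.degree := by
  rw [mon, norm_prod, Finsupp.degree_eq_sum, ← Finset.prod_pow_eq_pow_sum]
  refine Finset.prod_le_prod (fun _ _ => norm_nonneg _) fun i _ => ?_
  rw [norm_pow]
  exact pow_le_pow_left₀ (norm_nonneg _) (hx i) _

theorem mon_apply_zero {a : σ →₀ ℕ} (ha : a ≠ 0) : mon a (0 : σ → ℂ) = 0 := by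
  obtain ⟨i, hi⟩ := Finsupp.ne_iff.1 ha
  exact Finset.prod_eq_zero (Finset.mem_univ i) (by simpa using hi)

/-- A finite partial sum is dominated by the sum over a box of exponents, which factors into partial
sums of geometric series. -/
theorem summable_pow_degree {r : ℝ} (h0 : 0 ≤ r) (h1 : r < 1) :
    Summable fun a : σ →₀ ℕ => r ^ a.degree := by
  classical
  refine summable_of_sum_le (c := ((1 - r)⁻¹) ^ Fintype.card σ) (fun a => pow_nonneg h0 _) ?_
  intro s
  obtain ⟨m, hm⟩ : ∃ m, ∀ a ∈ s, a.degree < m := by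
    refine ⟨s.sup Finsupp.degree + 1, fun a ha => Nat.lt_succ_of_le (Finset.le_sup ha)⟩
  calc ∑ a ∈ s, r ^ a.degree
      = ∑ a ∈ s.map ⟨fun a : σ →₀ ℕ => (a : σ → ℕ), DFunLike.coe_injective⟩, ∏ i, r ^ a i := by
        rw [Finset.sum_map]
        refine Finset.sum_congr rfl fun a _ => ?_
        rw [Finset.prod_pow_eq_pow_sum, Finsupp.degree_eq_sum]
        rfl
    _ ≤ ∑ a ∈ Fintype.piFinset fun _ : σ => Finset.range m, ∏ i, r ^ a i := by
        refine Finset.sum_le_sum_of_subset_of_nonneg ?_ fun a _ _ =>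
          Finset.prod_nonneg fun i _ => pow_nonneg h0 _
        intro a ha
        obtain ⟨b, hb, rfl⟩ := Finset.mem_map.1 ha
        simp only [Function.Embedding.coeFn_mk, Fintype.mem_piFinset, Finset.mem_range]
        exact fun i => (Finsupp.le_degree i b).trans_lt (hm b hb)
    _ = ∏ _i : σ, ∑ j ∈ Finset.range m, r ^ j := (Finset.prod_univ_sum _ _).symm
    _ ≤ ∏ _i : σ, (1 - r)⁻¹ := by
        refine Finset.prod_le_prod (fun i _ => Finset.sum_nonneg fun j _ => pow_nonneg h0 _) ?_
        intro i _
        rw [← tsum_geometric_of_lt_one h0 h1]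
        exact (summable_geometric_of_lt_one h0 h1).sum_le_tsum _ fun j _ => pow_nonneg h0 _
    _ = _ := by simp

/-- The sum of a power series in several variables. -/
def ser (K : (σ →₀ ℕ) → ℂ) (x : σ → ℂ) : ℂ := ∑' a, K a * mon a x

theorem summable_norm_ser {K : (σ →₀ ℕ) → ℂ} {R M r : ℝ} (hR : 0 < R)
    (hK : ∀ a, ‖K a‖ * R ^ a.degree ≤ M) (hr : 0 ≤ r) (hrR : r < R) :
    Summable fun a => ‖K a‖ * r ^ a.degree := by
  have h := (summable_pow_degree (σ := σ) (div_nonneg hr hR.le) ((div_lt_one hR).2 hrR)).mul_left M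
  refine Summable.of_nonneg_of_le (fun a => by positivity) (fun a => ?_) h
  calc ‖K a‖ * r ^ a.degree = ‖K a‖ * R ^ a.degree * (r / R) ^ a.degree := by
        rw [div_pow, mul_assoc, mul_div_cancel₀ _ (pow_pos hR _).ne']
    _ ≤ _ := mul_le_mul_of_nonneg_right (hK a) (pow_nonneg (div_nonneg hr hR.le) _)

theorem summable_ser {K : (σ →₀ ℕ) → ℂ} {R M : ℝ} (hR : 0 < R)
    (hK : ∀ a, ‖K a‖ * R ^ a.degree ≤ M) {x : σ → ℂ} (hx : ‖x‖ < R) :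
    Summable fun a => ‖K a * mon a x‖ := by
  refine Summable.of_nonneg_of_le (fun a => norm_nonneg _) (fun a => ?_)
    (summable_norm_ser hR hK (norm_nonneg x) hx)
  rw [norm_mul]
  exact mul_le_mul_of_nonneg_left (norm_mon_le (norm_le_pi_norm x)) (norm_nonneg _)

theorem ser_zero (K : (σ →₀ ℕ) → ℂ) : ser K 0 = K 0 := by
  rw [ser, tsum_eq_single 0]
  · rw [mon_zero, mul_one]
  · intro a ha
    rw [mon_apply_zero ha, mul_zero]

/-- A list of variables with exponent vector $a$ displays the monomial as the diagonal of a
multilinear form of norm at most one. -/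
theorem exists_prod_eq_mon (a : σ →₀ ℕ) (n : ℕ) (hn : a.degree = n) :
    ∃ c : Fin n → σ, ∀ x : σ → ℂ, ∏ j, x (c j) = mon a x := by
  classical
  have hl : (Finsupp.toMultiset a).toList.length = n := by
    rw [Multiset.length_toList, Finsupp.card_toMultiset, ← hn]
    rfl
  subst hl
  refine ⟨fun j => (Finsupp.toMultiset a).toList.get j, fun x => ?_⟩
  have h1 : ∏ j, x ((Finsupp.toMultiset a).toList.get j) =
      ((Finsupp.toMultiset a).toList.map x).prod := by
    rw [← List.prod_ofFn]
    congr 1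
    conv_rhs => rw [← List.ofFn_get (Finsupp.toMultiset a).toList, List.map_ofFn]
    rfl
  rw [h1, ← Multiset.prod_coe, ← Multiset.map_coe, Multiset.coe_toList, Finsupp.toMultiset_map,
    Finsupp.prod_toMultiset, Finsupp.prod_mapDomain_index (by simp) (by simp [pow_add]),
    Finsupp.prod_fintype _ _ (by simp)]
  rfl

/-- The multi-indices of degree `n`. -/
def degFin [DecidableEq σ] (n : ℕ) : Finset (σ →₀ ℕ) := Finset.finsuppAntidiag Finset.univ n

theorem mem_degFin [DecidableEq σ] {n : ℕ} {a : σ →₀ ℕ} : a ∈ degFin n ↔ a.degree = n := by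
  rw [degFin, Finset.mem_finsuppAntidiag, Finsupp.degree_eq_sum]
  simp

theorem hasSum_degFin [DecidableEq σ] {f : (σ →₀ ℕ) → ℂ} (hf : Summable f) :
    HasSum (fun n => ∑ a ∈ degFin n, f a) (∑' a, f a) := by
  have h := (Equiv.sigmaFiberEquiv (Finsupp.degree (σ := σ) (R := ℕ))).hasSum_iff.2 hf.hasSum
  refine h.sigma fun n => ?_
  have : Fintype {a : σ →₀ ℕ // a.degree = n} :=
    Fintype.subtype (degFin n) fun a => mem_degFin
  have e : ∑ a ∈ degFin n, f a = ∑ a : {a : σ →₀ ℕ // a.degree = n}, f a := by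
    rw [Finset.sum_subtype _ fun a => mem_degFin]
  rw [e]
  exact hasSum_fintype _

/-- Grouping the terms by degree gives a formal multilinear series. Its $n$-th norm is at most
$\sum_{|a|=n}|K_a|$, so its radius of convergence is at least $R$. -/
theorem analyticOnNhd_ser {K : (σ →₀ ℕ) → ℂ} {R M : ℝ} (hR : 0 < R)
    (hK : ∀ a, ‖K a‖ * R ^ a.degree ≤ M) : AnalyticOnNhd ℂ (ser K) (Metric.ball 0 R) := by
  classical
  have hc : ∀ n : ℕ, ∀ a : σ →₀ ℕ, ∃ c : ContinuousMultilinearMap ℂ (fun _ : Fin n => σ → ℂ) ℂ,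
      ‖c‖ ≤ 1 ∧ (a.degree = n → ∀ x, c (fun _ => x) = mon a x) := by
    intro n a
    by_cases h : a.degree = n
    · obtain ⟨c, hc⟩ := exists_prod_eq_mon a n h
      refine ⟨(ContinuousMultilinearMap.mkPiAlgebra ℂ (Fin n) ℂ).compContinuousLinearMap
        fun j => ContinuousLinearMap.proj (c j), ?_, fun _ x => ?_⟩
      · refine ContinuousMultilinearMap.opNorm_le_bound zero_le_one fun m => ?_
        rw [one_mul]
        simp only [ContinuousMultilinearMap.compContinuousLinearMap_apply,
          ContinuousMultilinearMap.mkPiAlgebra_apply, ContinuousLinearMap.proj_apply, norm_prod]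
        exact Finset.prod_le_prod (fun _ _ => norm_nonneg _) fun j _ => norm_le_pi_norm _ _
      · simp [hc]
    · exact ⟨0, by simp, fun h' => absurd h' h⟩
  choose c hc1 hc2 using hc
  let p : FormalMultilinearSeries ℂ (σ → ℂ) ℂ := fun n => ∑ a ∈ degFin n, K a • c n a
  have hp : ∀ n x, p n (fun _ => x) = ∑ a ∈ degFin n, K a * mon a x := by
    intro n x
    change (∑ a ∈ degFin n, K a • c n a) (fun _ => x) = _
    rw [sum_apply]
    refine Finset.sum_congr rfl fun a ha => ?_
    rw [smul_apply, hc2 n a (mem_degFin.1 ha), smul_eq_mul]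
  have hrad : ∀ r : NNReal, (r : ℝ) < R → (r : ENNReal) ≤ p.radius := by
    intro r hr
    have hs := summable_norm_ser hR hK r.2 hr
    refine p.le_radius_of_bound (∑' a, ‖K a‖ * (r : ℝ) ^ a.degree) fun n => ?_
    calc ‖p n‖ * (r : ℝ) ^ n ≤ (∑ a ∈ degFin n, ‖K a‖) * (r : ℝ) ^ n := by
          refine mul_le_mul_of_nonneg_right ((norm_sum_le _ _).trans ?_) (by positivity)
          refine Finset.sum_le_sum fun a _ => ?_
          rw [norm_smul]
          exact mul_le_of_le_one_right (norm_nonneg _) (hc1 n a)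
      _ = ∑ a ∈ degFin n, ‖K a‖ * (r : ℝ) ^ a.degree := by
          rw [Finset.sum_mul]
          exact Finset.sum_congr rfl fun a ha => by rw [mem_degFin.1 ha]
      _ ≤ _ := hs.sum_le_tsum _ fun a _ => by positivity
  intro x hx
  have hx' : ‖x‖ < R := by simpa using hx
  obtain ⟨r, hr1, hr2⟩ := exists_between hx'
  have hr0 : 0 < r := (norm_nonneg x).trans_lt hr1
  have h : HasFPowerSeriesOnBall (ser K) p 0 (ENNReal.ofReal r) := by
    refine ⟨hrad r.toNNReal (by rwa [Real.coe_toNNReal _ hr0.le]), by simpa using hr0, ?_⟩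
    intro y hy
    have hy' : ‖y‖ < R := by
      rw [Metric.eball_ofReal] at hy
      exact (by simpa using hy : ‖y‖ < r).trans hr2
    rw [zero_add]
    simp only [hp]
    exact hasSum_degFin (summable_ser hR hK hy').of_norm
  refine h.analyticOnNhd x ?_
  rw [Metric.eball_ofReal]
  simpa using hr1

/-- The exponent vector of a list of indices. -/
def content {n : ℕ} (c : Fin n → σ) : σ →₀ ℕ := ∑ j, Finsupp.single (c j) 1

omit [Fintype σ] in
theorem degree_content {n : ℕ} (c : Fin n → σ) : (content c).degree = n := by
  simp [content, Finsupp.degree_single]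

theorem mon_content {n : ℕ} (c : Fin n → σ) (x : σ → ℂ) : mon (content c) x = ∏ j, x (c j) := by
  classical
  have : ∀ s : Finset (Fin n), mon (∑ j ∈ s, Finsupp.single (c j) 1) x = ∏ j ∈ s, x (c j) := by
    intro s
    induction s using Finset.induction_on with
    | empty => simp [mon_zero]
    | insert j s hj ih =>
      rw [Finset.sum_insert hj, Finset.prod_insert hj, mon_add, ih]
      congr 1
      rw [mon, Finset.prod_eq_single (c j)]
      · simp
      · intro i _ hi
        simp [hi.symm]
      · simp
  exact this _

/-- The converse of `analyticOnNhd_ser`: expanding the vector argument of each multilinear term in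
the standard basis yields the coefficients by exponent vector. -/
theorem exists_ser_of_analyticAt {f : (σ → ℂ) → ℂ} (hf : AnalyticAt ℂ f 0) :
    ∃ (K : (σ →₀ ℕ) → ℂ) (R M : ℝ), 0 < R ∧ (∀ a, ‖K a‖ * R ^ a.degree ≤ M) ∧
      ∀ x, ‖x‖ < R → f x = ser K x := by
  classical
  obtain ⟨p, r, hp⟩ := hf
  obtain ⟨s, hs0, hs⟩ := ENNReal.lt_iff_exists_nnreal_btwn.1 hp.r_pos
  have hs0' : 0 < (s : ℝ) := by exact_mod_cast hs0
  obtain ⟨C, hC, hb⟩ := p.norm_mul_pow_le_of_lt_radius (hs.trans_le hp.r_le)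
  -- All lists of basis vectors with the same exponent vector contribute to the same monomial.
  let K : (σ →₀ ℕ) → ℂ := fun a =>
    ∑ c : Fin a.degree → σ, if content c = a then p a.degree (fun j => Pi.single (c j) 1) else 0
  have hpx : ∀ n x, p n (fun _ => x) = ∑ a ∈ degFin n, K a * mon a x := by
    intro n x
    have e1 : p n (fun _ => x) =
        ∑ c : Fin n → σ, mon (content c) x * p n (fun j => Pi.single (c j) 1) := by
      have e0 : (fun _ : Fin n => x) = fun _ => ∑ i, x i • (Pi.single i 1 : σ → ℂ) := by
        funext _
        exact pi_eq_sum_univ' x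
      rw [e0]
      change (p n).toMultilinearMap _ = _
      rw [MultilinearMap.map_sum]
      refine Finset.sum_congr rfl fun c _ => ?_
      rw [MultilinearMap.map_smul_univ, mon_content, smul_eq_mul]
      rfl
    rw [e1, ← Finset.sum_fiberwise_of_maps_to (t := degFin n) (g := content)
      (fun c _ => mem_degFin.2 (degree_content c))]
    refine Finset.sum_congr rfl fun a ha => ?_
    obtain rfl := mem_degFin.1 ha
    rw [Finset.sum_mul, Finset.sum_filter]
    refine Finset.sum_congr rfl fun c _ => ?_
    split_ifs with h
    · rw [h, mul_comm]
    · simp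
  have hd : (0 : ℝ) ≤ Fintype.card σ := Nat.cast_nonneg _
  -- With $d$ variables there are $d^m$ lists of length $m$, so the radius has to shrink by a factor
  -- of at least $d$; using $d+1$ also covers $d=0$.
  have hR : (0 : ℝ) < s / (Fintype.card σ + 1) := by positivity
  have hK : ∀ a, ‖K a‖ * (s / (Fintype.card σ + 1)) ^ a.degree ≤ C := by
    intro a
    have h1 : ‖K a‖ ≤ (Fintype.card σ : ℝ) ^ a.degree * ‖p a.degree‖ := by
      calc ‖K a‖ ≤ ∑ c : Fin a.degree → σ, ‖p a.degree‖ := by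
            refine (norm_sum_le _ _).trans (Finset.sum_le_sum fun c _ => ?_)
            split_ifs
            · refine ((p a.degree).le_opNorm _).trans ?_
              refine mul_le_of_le_one_right (norm_nonneg _) (Finset.prod_le_one
                (fun _ _ => norm_nonneg _) fun j _ => ?_)
              rw [pi_norm_le_iff_of_nonneg zero_le_one]
              intro i
              by_cases h : i = c j
              · subst h
                simp
              · simp [h]
            · simp
        _ = _ := by simp
    calc ‖K a‖ * (s / (Fintype.card σ + 1)) ^ a.degree
        ≤ (Fintype.card σ : ℝ) ^ a.degree * ‖p a.degree‖ *
          (s / (Fintype.card σ + 1)) ^ a.degree := mul_le_mul_of_nonneg_right h1 (by positivity)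
      _ = ‖p a.degree‖ * (s : ℝ) ^ a.degree *
          ((Fintype.card σ : ℝ) / (Fintype.card σ + 1)) ^ a.degree := by
          rw [div_pow, div_pow]
          ring
      _ ≤ ‖p a.degree‖ * (s : ℝ) ^ a.degree := by
          refine mul_le_of_le_one_right (by positivity) (pow_le_one₀ (by positivity) ?_)
          rw [div_le_one (by positivity)]
          linarith
      _ ≤ C := hb _
  refine ⟨K, s / (Fintype.card σ + 1), C, hR, hK, fun x hx => ?_⟩
  have hle : (s : ℝ) / (Fintype.card σ + 1) ≤ s := div_le_self hs0'.le (by linarith)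
  have h1 := hp.hasSum (y := x) (by
    rw [Metric.mem_eball, edist_zero_right]
    refine lt_trans ?_ hs
    rw [enorm_lt_coe]
    exact_mod_cast hx.trans_le hle)
  rw [zero_add] at h1
  simp only [hpx] at h1
  exact h1.unique (hasSum_degFin (summable_ser hR hK hx).of_norm)

end PowerSeries

/-! ### Entire solutions of $F(x)=P(x)F(qx)$ with polynomial $P$. -/

section QDifference

variable {σ J : Type*} [Fintype σ] [DecidableEq σ] [Fintype J]

theorem tsum_mul_tsum_mon {A K : (σ →₀ ℕ) → ℂ} {x : σ → ℂ}
    (hA : Summable fun a => ‖A a * mon a x‖) (hK : Summable fun a => ‖K a * mon a x‖) :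
    Summable (fun a =>
      (∑ p ∈ Finset.HasAntidiagonal.antidiagonal a, A p.1 * K p.2) * mon a x) ∧
    (∑' a, A a * mon a x) * ∑' a, K a * mon a x =
      ∑' a, (∑ p ∈ Finset.HasAntidiagonal.antidiagonal a, A p.1 * K p.2) * mon a x := by
  obtain ⟨f, hf⟩ : ∃ f : (σ →₀ ℕ) → ℂ, f = fun a => A a * mon a x := ⟨_, rfl⟩
  obtain ⟨g, hg⟩ : ∃ g : (σ →₀ ℕ) → ℂ, g = fun a => K a * mon a x := ⟨_, rfl⟩
  have e : (fun a => (∑ p ∈ Finset.HasAntidiagonal.antidiagonal a, A p.1 * K p.2) * mon a x) =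
      fun a => ∑ p ∈ Finset.HasAntidiagonal.antidiagonal a, f p.1 * g p.2 := by
    funext a
    rw [Finset.sum_mul]
    refine Finset.sum_congr rfl fun p hp => ?_
    rw [← Finset.HasAntidiagonal.mem_antidiagonal.1 hp, mon_add, hf, hg]
    ring
  rw [e, ← hf, ← hg]
  have hA' : Summable fun a => ‖f a‖ := by rw [hf]; exact hA
  have hK' : Summable fun a => ‖g a‖ := by rw [hg]; exact hK
  have hprod : Summable fun p : (σ →₀ ℕ) × (σ →₀ ℕ) => f p.1 * g p.2 :=
    summable_mul_of_summable_norm hA' hK'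
  exact ⟨summable_sum_mul_antidiagonal_of_summable_mul hprod,
    hA'.of_norm.tsum_mul_tsum_eq_tsum_sum_antidiagonal hK'.of_norm hprod⟩

theorem ser_eval_mul {K : (σ →₀ ℕ) → ℂ} {R M : ℝ} (hR : 0 < R)
    (hK : ∀ a, ‖K a‖ * R ^ a.degree ≤ M) (P : MvPolynomial σ ℂ) {x : σ → ℂ} (hx : ‖x‖ < R) :
    Summable (fun a =>
      (∑ p ∈ Finset.HasAntidiagonal.antidiagonal a, P.coeff p.1 * K p.2) * mon a x) ∧
    MvPolynomial.eval x P * ser K x =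
      ∑' a, (∑ p ∈ Finset.HasAntidiagonal.antidiagonal a, P.coeff p.1 * K p.2) * mon a x := by
  have hP : Summable fun a => ‖P.coeff a * mon a x‖ := by
    refine summable_of_ne_finset_zero (s := P.support) fun a ha => ?_
    rw [MvPolynomial.notMem_support_iff.1 ha, zero_mul, norm_zero]
  have hPe : MvPolynomial.eval x P = ∑' a, P.coeff a * mon a x := by
    rw [tsum_eq_sum (s := P.support) fun a ha => by
      rw [MvPolynomial.notMem_support_iff.1 ha, zero_mul], MvPolynomial.eval_eq']
    rfl
  have h := tsum_mul_tsum_mon (A := fun a => P.coeff a) hP (summable_ser hR hK hx)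
  rw [hPe, ser]
  exact h

/-- The coefficients of the solution of the `q`-difference equation `F(x) = P(x) F(q x)`. -/
def qCoef [DecidableEq J] (q : ℂ) (P : Matrix J J (MvPolynomial σ ℂ)) (v : J → ℂ)
    (a : σ →₀ ℕ) : J → ℂ :=

  if a = 0 then v else
    (1 + (q ^ a.degree / (1 - q ^ a.degree)) • P.map (MvPolynomial.coeff 0)).mulVec
      (∑ p ∈ (Finset.HasAntidiagonal.antidiagonal a).attach, if _h : p.1.1 = 0 then 0 else
        q ^ p.1.2.degree • (P.map (MvPolynomial.coeff p.1.1)).mulVec (qCoef q P v p.1.2))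
termination_by a.degree
decreasing_by
  -- The recursion is well founded because a term with nonzero first index has a second index of
  -- smaller degree.
  have h1 := Finset.HasAntidiagonal.mem_antidiagonal.1 p.2
  have h2 : p.1.1.degree ≠ 0 := by simpa [Finsupp.degree_eq_zero_iff] using _h
  have h3 := congrArg Finsupp.degree h1
  rw [map_add] at h3
  omega

omit [Fintype σ] in
theorem qCoef_zero [DecidableEq J] (q : ℂ) (P : Matrix J J (MvPolynomial σ ℂ)) (v : J → ℂ) :
    qCoef q P v 0 = v := by
  rw [qCoef, if_pos rfl]

omit [Fintype σ] in
theorem qCoef_of_ne [DecidableEq J] (q : ℂ) (P : Matrix J J (MvPolynomial σ ℂ)) (v : J → ℂ)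
    {a : σ →₀ ℕ} (ha : a ≠ 0) : qCoef q P v a =
    (1 + (q ^ a.degree / (1 - q ^ a.degree)) • P.map (MvPolynomial.coeff 0)).mulVec
      (∑ p ∈ (Finset.HasAntidiagonal.antidiagonal a).erase (0, a),
        q ^ p.2.degree • (P.map (MvPolynomial.coeff p.1)).mulVec (qCoef q P v p.2)) := by
  rw [qCoef, if_neg ha]
  congr 1
  simp only [dite_eq_ite]
  rw [Finset.sum_attach (Finset.HasAntidiagonal.antidiagonal a) (fun p => if p.1 = 0 then 0 else
        q ^ p.2.degree • (P.map (MvPolynomial.coeff p.1)).mulVec (qCoef q P v p.2)),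
    ← Finset.sum_erase (a := (0, a)) _ (by simp)]
  refine Finset.sum_congr rfl fun p hp => ?_
  rw [if_neg]
  intro h
  obtain ⟨h1, h2⟩ := Finset.mem_erase.1 hp
  apply h1
  have h3 := Finset.HasAntidiagonal.mem_antidiagonal.1 h2
  rw [h, zero_add] at h3
  exact Prod.ext h h3

/-- Comparing coefficients in $F(x)=P(x)F(qx)$ gives $(1-zA)K_a=u$, where $z=q^{|a|}$, $A=P(0)$ and
$u$ involves only coefficients of lower degree. As $A^2=A$ and $z\ne1$, the inverse of $1-zA$ is
$1+\frac{z}{1-z}A$, the matrix used in `qCoef`. For $a=0$ the relation is the condition $Av=v$. -/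
theorem qCoef_eq [DecidableEq J] {q : ℂ} (hq : ‖q‖ < 1) (P : Matrix J J (MvPolynomial σ ℂ))
    (v : J → ℂ) (hA : P.map (MvPolynomial.coeff 0) * P.map (MvPolynomial.coeff 0) =
      P.map (MvPolynomial.coeff 0)) (hv : (P.map (MvPolynomial.coeff 0)).mulVec v = v)
    (a : σ →₀ ℕ) : qCoef q P v a = ∑ p ∈ Finset.HasAntidiagonal.antidiagonal a,
      q ^ p.2.degree • (P.map (MvPolynomial.coeff p.1)).mulVec (qCoef q P v p.2) := by
  by_cases ha : a = 0
  · subst ha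
    simp [qCoef_zero, hv]
  · rw [← Finset.add_sum_erase _ _ (show ((0, a) : (σ →₀ ℕ) × (σ →₀ ℕ)) ∈ _ by simp)]
    have h := qCoef_of_ne q P v ha
    set u := ∑ p ∈ (Finset.HasAntidiagonal.antidiagonal a).erase (0, a),
      q ^ p.2.degree • (P.map (MvPolynomial.coeff p.1)).mulVec (qCoef q P v p.2)
    simp only
    rw [h]
    set A := P.map (MvPolynomial.coeff 0)
    set z := q ^ a.degree with hz
    have hd : a.degree ≠ 0 := by simpa [Finsupp.degree_eq_zero_iff] using ha
    have hz1 : 1 - z ≠ 0 := by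
      intro h0
      have h1 : ‖z‖ < 1 := by
        rw [hz, norm_pow]
        exact pow_lt_one₀ (norm_nonneg _) hq hd
      rw [← sub_eq_zero.1 h0] at h1
      simp at h1
    rw [Matrix.mulVec_mulVec, Matrix.mul_add, Matrix.mul_smul, hA, mul_one, Matrix.add_mulVec,
      Matrix.one_mulVec, Matrix.add_mulVec, Matrix.smul_mulVec]
    have e : z / (1 - z) = z * (1 + z / (1 - z)) := by
      field_simp
      ring
    nth_rewrite 1 [e]
    module

theorem norm_mulVec_le (A : Matrix J J ℂ) (u : J → ℂ) :
    ‖A.mulVec u‖ ≤ (∑ i, ∑ j, ‖A i j‖) * ‖u‖ := by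
  rw [pi_norm_le_iff_of_nonneg (by positivity)]
  intro i
  calc ‖A.mulVec u i‖ ≤ ∑ j, ‖A i j‖ * ‖u‖ := by
        refine (norm_sum_le _ _).trans (Finset.sum_le_sum fun j _ => ?_)
        rw [norm_mul]
        exact mul_le_mul_of_nonneg_left (norm_le_pi_norm u j) (norm_nonneg _)
    _ = (∑ j, ‖A i j‖) * ‖u‖ := by rw [Finset.sum_mul]
    _ ≤ _ := by
        refine mul_le_mul_of_nonneg_right ?_ (norm_nonneg _)
        exact Finset.single_le_sum (f := fun i => ∑ j, ‖A i j‖)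
          (fun i _ => Finset.sum_nonneg fun j _ => norm_nonneg _) (Finset.mem_univ i)

/-- In the recursion $K_{a-b}$ carries the factor $q^{|a|-|b|}$, where $b$ runs through the finite
set of exponents of $P$. After multiplication by $R^{|a|}$ the sum is at most $|q|^{|a|}B$ times the
earlier bound, with $B$ independent of $a$. The factor $|q|^{|a|}$ beats every constant, so the
estimate holds for all $R$ and the series is entire. -/
theorem qCoef_bound [DecidableEq J] {q : ℂ} (hq0 : q ≠ 0) (hq : ‖q‖ < 1)
    (P : Matrix J J (MvPolynomial σ ℂ)) (v : J → ℂ) {R : ℝ} (hR : 0 < R) :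
    ∃ M, ∀ a, ‖qCoef q P v a‖ * R ^ a.degree ≤ M := by
  have hq0' : 0 < ‖q‖ := norm_pos_iff.2 hq0
  set e : (σ →₀ ℕ) → ℝ := fun b => ∑ i, ∑ j, ‖(P i j).coeff b‖ with he
  have he0 : ∀ b, 0 ≤ e b := fun b => by positivity
  set S : Finset (σ →₀ ℕ) := Finset.univ.biUnion fun i => Finset.univ.biUnion fun j =>
    (P i j).support with hS
  have heS : ∀ b ∉ S, e b = 0 := by
    intro b hb
    refine Finset.sum_eq_zero fun i _ => Finset.sum_eq_zero fun j _ => ?_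
    rw [norm_eq_zero, ← MvPolynomial.notMem_support_iff]
    intro h
    exact hb (by simp only [hS, Finset.mem_biUnion, Finset.mem_univ, true_and]; exact ⟨i, j, h⟩)
  set B : ℝ := ∑ b ∈ S, e b * (R / ‖q‖) ^ b.degree with hB
  have hB0 : 0 ≤ B := Finset.sum_nonneg fun b _ => by have := he0 b; positivity
  set C : ℝ := 1 + 1 / (1 - ‖q‖) * e 0 with hC
  have hq1 : 0 < 1 - ‖q‖ := by linarith
  have hC0 : 0 ≤ C := by have := he0 0; positivity
  -- In degrees above $m$ the recursion no longer increases the bound, so the maximum $M$ over the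
  -- finitely many lower degrees serves for all.
  obtain ⟨m, hm⟩ : ∃ m : ℕ, C * B * ‖q‖ ^ m ≤ 1 := by
    have := (tendsto_pow_atTop_nhds_zero_of_lt_one hq0'.le hq).const_mul (C * B)
    rw [mul_zero] at this
    obtain ⟨m, hm⟩ := (this.eventually (gt_mem_nhds zero_lt_one)).exists
    exact ⟨m, hm.le⟩
  have hfin : {a : σ →₀ ℕ | a.degree < m + 1}.Finite := Finsupp.finite_of_degree_lt _
  obtain ⟨M, hM⟩ := (hfin.image fun a => ‖qCoef q P v a‖ * R ^ a.degree).bddAbove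
  refine ⟨M, fun a => ?_⟩
  induction hd : a.degree using Nat.strong_induction_on generalizing a with
  | _ d ih =>
    by_cases had : a.degree < m + 1
    · rw [← hd]
      exact hM ⟨a, had, rfl⟩
    · have ha : a ≠ 0 := by
        rintro rfl
        simp at had
      have hM0 : 0 ≤ M := by
        refine le_trans ?_ (hM ⟨0, by simp, rfl⟩)
        positivity
      rw [← hd, qCoef_of_ne q P v ha]
      set u := ∑ p ∈ (Finset.HasAntidiagonal.antidiagonal a).erase (0, a),
        q ^ p.2.degree • (P.map (MvPolynomial.coeff p.1)).mulVec (qCoef q P v p.2) with hu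
      have h1 : ‖u‖ * R ^ a.degree ≤ ‖q‖ ^ a.degree * B * M := by
        calc ‖u‖ * R ^ a.degree
            ≤ (∑ p ∈ (Finset.HasAntidiagonal.antidiagonal a).erase (0, a),
              ‖q‖ ^ p.2.degree * (e p.1 * ‖qCoef q P v p.2‖)) * R ^ a.degree := by
              refine mul_le_mul_of_nonneg_right ((norm_sum_le _ _).trans ?_) (by positivity)
              refine Finset.sum_le_sum fun p _ => ?_
              rw [norm_smul, norm_pow]
              exact mul_le_mul_of_nonneg_left (norm_mulVec_le _ _) (by positivity)
          _ = ∑ p ∈ (Finset.HasAntidiagonal.antidiagonal a).erase (0, a), ‖q‖ ^ a.degree *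
              (e p.1 * (R / ‖q‖) ^ p.1.degree * (‖qCoef q P v p.2‖ * R ^ p.2.degree)) := by
              rw [Finset.sum_mul]
              refine Finset.sum_congr rfl fun p hp => ?_
              have h3 := Finset.HasAntidiagonal.mem_antidiagonal.1 (Finset.mem_of_mem_erase hp)
              rw [← h3, map_add, div_pow, pow_add, pow_add]
              field_simp
          _ ≤ ∑ p ∈ (Finset.HasAntidiagonal.antidiagonal a).erase (0, a), ‖q‖ ^ a.degree *
              (e p.1 * (R / ‖q‖) ^ p.1.degree * M) := by
              refine Finset.sum_le_sum fun p hp => ?_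
              have h3 := Finset.HasAntidiagonal.mem_antidiagonal.1 (Finset.mem_of_mem_erase hp)
              refine mul_le_mul_of_nonneg_left (mul_le_mul_of_nonneg_left (ih _ ?_ _ rfl) ?_)
                (by positivity)
              · rw [← hd, ← h3, map_add]
                have : p.1.degree ≠ 0 := by
                  rw [Ne, Finsupp.degree_eq_zero_iff]
                  intro h
                  apply Finset.ne_of_mem_erase hp
                  rw [h, zero_add] at h3
                  exact Prod.ext h h3
                omega
              · have := he0 p.1
                positivity
          _ ≤ ∑ b ∈ S, ‖q‖ ^ a.degree * (e b * (R / ‖q‖) ^ b.degree * M) := by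
              rw [← Finset.sum_filter_of_ne (p := fun p => p.1 ∈ S)]
              · refine (Finset.sum_image (f := fun b => ‖q‖ ^ a.degree *
                  (e b * (R / ‖q‖) ^ b.degree * M)) (g := Prod.fst) ?_).symm.trans_le ?_
                · intro p hp p' hp' h
                  have h3 := Finset.HasAntidiagonal.mem_antidiagonal.1
                    (Finset.mem_of_mem_erase (Finset.mem_filter.1 hp).1)
                  have h4 := Finset.HasAntidiagonal.mem_antidiagonal.1
                    (Finset.mem_of_mem_erase (Finset.mem_filter.1 hp').1)
                  refine Prod.ext h ?_
                  rw [← h4, h] at h3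
                  exact add_left_cancel h3
                · refine Finset.sum_le_sum_of_subset_of_nonneg ?_ fun b _ _ => ?_
                  · intro b hb
                    obtain ⟨p, hp, rfl⟩ := Finset.mem_image.1 hb
                    exact (Finset.mem_filter.1 hp).2
                  · have := he0 b
                    positivity
              · intro p _ hp
                by_contra h
                exact hp (by rw [heS _ h]; ring)
          _ = ‖q‖ ^ a.degree * B * M := by
              rw [hB, mul_assoc, Finset.sum_mul, Finset.mul_sum]
      have h2 : ‖(1 + (q ^ a.degree / (1 - q ^ a.degree)) •
          P.map (MvPolynomial.coeff 0)).mulVec u‖ ≤ C * ‖u‖ := by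
        rw [Matrix.add_mulVec, Matrix.one_mulVec, Matrix.smul_mulVec, hC, add_mul, one_mul]
        refine (norm_add_le _ _).trans (add_le_add le_rfl ?_)
        rw [norm_smul, mul_assoc]
        -- Since $|a|\ge1$, the inverse matrix $1+\frac{z}{1-z}A$ is bounded uniformly in $a$,
        -- because $|1-z|\ge1-|q|$.
        have hqa : ‖q ^ a.degree‖ ≤ ‖q‖ := by
          rw [norm_pow]
          exact pow_le_of_le_one hq0'.le hq.le (by omega)
        refine mul_le_mul ?_ (norm_mulVec_le _ _) (norm_nonneg _) (by positivity)
        rw [norm_div]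
        refine div_le_div₀ zero_le_one (hqa.trans hq.le) hq1 ?_
        have := norm_sub_norm_le (1 : ℂ) (q ^ a.degree)
        rw [norm_one] at this
        linarith
      calc _ ≤ C * ‖u‖ * R ^ a.degree := mul_le_mul_of_nonneg_right h2 (by positivity)
        _ = C * (‖u‖ * R ^ a.degree) := by ring
        _ ≤ C * (‖q‖ ^ a.degree * B * M) := mul_le_mul_of_nonneg_left h1 hC0
        _ = C * B * ‖q‖ ^ a.degree * M := by ring
        _ ≤ C * B * ‖q‖ ^ m * M := by
            refine mul_le_mul_of_nonneg_right (mul_le_mul_of_nonneg_left ?_ (by positivity)) hM0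
            exact pow_le_pow_of_le_one hq0'.le hq.le (by omega)
        _ ≤ 1 * M := mul_le_mul_of_nonneg_right hm hM0
        _ = M := one_mul M

/-- Existence of an entire solution of the `q`-difference equation `F(x) = P(x) F(q x)` with
polynomial coefficients and with prescribed value `v` at the origin, if `P(0)` is a projection
with `P(0) v = v`. -/
theorem exists_entire_solution [DecidableEq J] {q : ℂ} (hq0 : q ≠ 0) (hq : ‖q‖ < 1)
    (P : Matrix J J (MvPolynomial σ ℂ)) (v : J → ℂ)
    (hA : P.map (MvPolynomial.coeff 0) * P.map (MvPolynomial.coeff 0) =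
      P.map (MvPolynomial.coeff 0)) (hv : (P.map (MvPolynomial.coeff 0)).mulVec v = v) :
    ∃ F : J → (σ → ℂ) → ℂ, (∀ j, AnalyticOnNhd ℂ (F j) Set.univ) ∧ (∀ j, F j 0 = v j) ∧
      ∀ j x, F j x = ∑ l, MvPolynomial.eval x (P j l) * F l (q • x) := by
  have hb : ∀ R : ℝ, 0 < R → ∃ M, ∀ j a, ‖qCoef q P v a j‖ * R ^ a.degree ≤ M := by
    intro R hR
    obtain ⟨M, hM⟩ := qCoef_bound hq0 hq P v hR
    exact ⟨M, fun j a => (mul_le_mul_of_nonneg_right (norm_le_pi_norm _ j)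
      (by positivity)).trans (hM a)⟩
  refine ⟨fun j => ser fun a => qCoef q P v a j, fun j x _ => ?_, fun j => ?_, fun j x => ?_⟩
  · obtain ⟨M, hM⟩ := hb (‖x‖ + 1) (by positivity)
    exact analyticOnNhd_ser (by positivity) (hM j) x (by simp)
  · change ser _ 0 = _
    rw [ser_zero, qCoef_zero]
  · obtain ⟨M, hM⟩ := hb (‖x‖ + 1) (by positivity)
    have hK : ∀ l a, ‖q ^ a.degree * qCoef q P v a l‖ * (‖x‖ + 1) ^ a.degree ≤ M := by
      intro l a
      refine le_trans (mul_le_mul_of_nonneg_right ?_ (by positivity)) (hM l a)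
      rw [norm_mul, norm_pow]
      exact mul_le_of_le_one_left (norm_nonneg _) (pow_le_one₀ (norm_nonneg _) hq.le)
    have hs : ∀ l, ser (fun a => qCoef q P v a l) (q • x) =
        ser (fun a => q ^ a.degree * qCoef q P v a l) x := by
      intro l
      refine tsum_congr fun a => ?_
      rw [mon_smul]
      ring
    have hx : ‖x‖ < ‖x‖ + 1 := by linarith
    have hmul := fun l => ser_eval_mul (by positivity) (hK l) (P j l) hx
    simp only [hs]
    rw [Finset.sum_congr rfl fun l _ => (hmul l).2,
      ← Summable.tsum_finsetSum fun l _ => (hmul l).1]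
    refine tsum_congr fun a => ?_
    rw [← Finset.sum_mul]
    congr 1
    have h := congrFun (qCoef_eq hq P v hA hv a) j
    rw [Finset.sum_comm]
    refine h.trans ?_
    rw [Finset.sum_apply]
    refine Finset.sum_congr rfl fun p _ => ?_
    rw [Pi.smul_apply, smul_eq_mul, Matrix.mulVec, dotProduct, Finset.mul_sum]
    refine Finset.sum_congr rfl fun l _ => ?_
    rw [Matrix.map_apply]
    ring

end QDifference

/-! ### Uniqueness for $q$-difference systems with idempotent value at the origin. -/

section Uniqueness

variable {σ J : Type*} [Fintype σ] [Fintype J] [DecidableEq J]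

/-- The iterated product `M(x) M(q x) ⋯ M(q^{m-1} x)`. -/
def iterMat (q : ℂ) (M : (σ → ℂ) → Matrix J J ℂ) : ℕ → (σ → ℂ) → Matrix J J ℂ
  | 0, _ => 1
  | m + 1, x => iterMat q M m x * M (q ^ m • x)

omit [Fintype σ] in
theorem continuousAt_iterMat (q : ℂ) {M : (σ → ℂ) → Matrix J J ℂ} (hM : ContinuousAt M 0) (m : ℕ) :
    ContinuousAt (iterMat q M m) 0 := by
  induction m with
  | zero => exact continuousAt_const
  | succ m ih =>
    refine ContinuousAt.mul ih ?_
    have h : ContinuousAt (fun x : σ → ℂ => q ^ m • x) 0 := by fun_prop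
    exact ContinuousAt.comp (by rwa [smul_zero]) h

omit [Fintype σ] in
theorem iterMat_zero (q : ℂ) (M : (σ → ℂ) → Matrix J J ℂ) (m : ℕ) :
    iterMat q M m 0 = M 0 ^ m := by
  induction m with
  | zero => rfl
  | succ m ih => rw [iterMat, ih, smul_zero, pow_succ]

theorem eq_iterMat_mulVec {q : ℂ} (hq : ‖q‖ < 1) {M : (σ → ℂ) → Matrix J J ℂ}
    {f : (σ → ℂ) → J → ℂ} {r : ℝ} (h : ∀ x, ‖x‖ < r → f x = (M x).mulVec (f (q • x)))
    (m : ℕ) {x : σ → ℂ} (hx : ‖x‖ < r) : f x = (iterMat q M m x).mulVec (f (q ^ m • x)) := by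
  induction m with
  | zero => simp [iterMat]
  | succ m ih =>
    rw [ih, h (q ^ m • x), iterMat, Matrix.mulVec_mulVec, smul_smul, ← pow_succ']
    rw [norm_smul, norm_pow]
    exact (mul_le_of_le_one_left (norm_nonneg _) (pow_le_one₀ (norm_nonneg _) hq.le)).trans_lt hx

/-- A solution of the `q`-difference equation `f(x) = M(x) f(q x)` which vanishes at the origin is
identically zero near the origin, if `M(0)` is a projection. -/
theorem eventually_eq_zero_of_qDifference {q : ℂ} (hq : ‖q‖ < 1)
    {M : (σ → ℂ) → Matrix J J ℂ} (hM : ContinuousAt M 0) (hA : M 0 * M 0 = M 0)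
    {f : (σ → ℂ) → J → ℂ} (hf : DifferentiableAt ℂ f 0) (hf0 : f 0 = 0)
    (h : ∀ᶠ x in nhds 0, f x = (M x).mulVec (f (q • x))) : ∀ᶠ x in nhds 0, f x = 0 := by
  -- At the origin every iterated product of positive length equals the idempotent $M(0)$. Hence $C$
  -- bounds its entrywise norm near the origin whatever the length, and can be fixed before the
  -- length is chosen.
  set C : ℝ := ∑ i, ∑ j, ‖M 0 i j‖ + 1 with hC
  have hC0 : 0 < C := by positivity
  obtain ⟨m, hm⟩ : ∃ m : ℕ, C * ‖q‖ ^ (m + 1) ≤ 1 / 2 := by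
    have := ((tendsto_pow_atTop_nhds_zero_of_lt_one (norm_nonneg q) hq).const_mul C)
    rw [mul_zero] at this
    have := (this.comp (Filter.tendsto_add_atTop_nat 1)).eventually
      (gt_mem_nhds (show (0 : ℝ) < 1 / 2 by norm_num))
    obtain ⟨m, hm⟩ := this.exists
    exact ⟨m, hm.le⟩
  have hAm : M 0 ^ (m + 1) = M 0 := IsIdempotentElem.pow_succ_eq m hA
  have hP : ∀ᶠ x in nhds (0 : σ → ℂ), ∑ i, ∑ j, ‖iterMat q M (m + 1) x i j‖ < C := by
    have hc := continuousAt_iterMat q hM (m + 1)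
    have hc' : ContinuousAt (fun x => ∑ i, ∑ j, ‖iterMat q M (m + 1) x i j‖) (0 : σ → ℂ) := by
      refine tendsto_finsetSum _ fun i _ => tendsto_finsetSum _ fun j _ => ?_
      exact ((continuousAt_apply j _).comp ((continuousAt_apply i _).comp hc)).norm
    refine hc'.eventually (gt_mem_nhds ?_)
    have e : iterMat q M (m + 1) 0 = M 0 := by rw [iterMat_zero, hAm]
    simp only [e, hC]
    linarith
  have hO : ∃ L : ℝ, ∀ᶠ x in nhds (0 : σ → ℂ), ‖f x‖ ≤ L * ‖x‖ := by
    obtain ⟨L, hL⟩ := hf.isBigO_sub.bound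
    refine ⟨L, ?_⟩
    filter_upwards [hL] with x hx
    simpa [hf0] using hx
  obtain ⟨L, hL⟩ := hO
  obtain ⟨r, hr, hball⟩ := Metric.eventually_nhds_iff_ball.1 (h.and (hP.and hL))
  simp only [mem_ball_zero_iff] at hball
  -- The linear bound $|f(x)|\le L|x|$ improves itself: one use of the $(m+1)$-fold iterated
  -- equation multiplies the constant by $C|q|^{m+1}\le\frac12$ on the same ball.
  have key : ∀ k : ℕ, ∀ x, ‖x‖ < r → ‖f x‖ ≤ L / 2 ^ k * ‖x‖ := by
    intro k
    induction k with
    | zero =>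
      intro x hx
      simpa using (hball x hx).2.2
    | succ k ih =>
      intro x hx
      have hqx : ‖q ^ (m + 1) • x‖ < r := by
        rw [norm_smul, norm_pow]
        exact (mul_le_of_le_one_left (norm_nonneg _)
          (pow_le_one₀ (norm_nonneg _) hq.le)).trans_lt hx
      have h1 := ih _ hqx
      rw [eq_iterMat_mulVec hq (fun x hx => (hball x hx).1) (m + 1) hx]
      refine (norm_mulVec_le _ _).trans ?_
      rw [norm_smul, norm_pow] at h1
      calc _ ≤ C * (L / 2 ^ k * (‖q‖ ^ (m + 1) * ‖x‖)) :=
            mul_le_mul (hball x hx).2.1.le h1 (norm_nonneg _) hC0.le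
        _ = C * ‖q‖ ^ (m + 1) * (L / 2 ^ k * ‖x‖) := by ring
        _ ≤ 1 / 2 * (L / 2 ^ k * ‖x‖) := by
            refine mul_le_mul_of_nonneg_right hm ?_
            exact (norm_nonneg _).trans (ih x hx)
        _ = _ := by rw [pow_succ]; field_simp
  refine Metric.eventually_nhds_iff_ball.2 ⟨r, hr, fun x hx => ?_⟩
  rw [mem_ball_zero_iff] at hx
  have hlim : Filter.Tendsto (fun k : ℕ => L / 2 ^ k * ‖x‖) Filter.atTop (nhds 0) := by
    have h2 := (tendsto_pow_atTop_nhds_zero_of_lt_one (r := (1 / 2 : ℝ)) (by norm_num)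
      (by norm_num)).const_mul (L * ‖x‖)
    rw [mul_zero] at h2
    refine h2.congr fun k => ?_
    rw [div_pow, one_pow]
    ring
  have := ge_of_tendsto' hlim fun k => key k x hx
  exact norm_le_zero_iff.1 this

end Uniqueness

/-! ### Simple root variables and germs at the origin. -/

/-- The index set of the simple root variables `x_i = t^{-α_i}` and `y_i = γ^{α_i}`. -/
abbrev Sig (n : ℕ) : Type := Fin (n + 1) ⊕ Fin (n + 1)

/-- The simple root variables `x_i = t^{-α_i}` and `y_i = γ^{α_i}`. -/
def XY {n : ℕ} (p : Torus n × Torus n) : Sig n → ℂ :=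
  Sum.elim (fun i => (p.1 i.succ / p.1 i.castSucc : ℂ)) fun i => (p.2 i.castSucc / p.2 i.succ : ℂ)

/-- Partial products realise any prescribed nonzero consecutive ratios. The origin is not attained:
it is a point at infinity of the torus, and germs there are tested on points off the coordinate
hyperplanes. -/
theorem exists_XY_eq {n : ℕ} {x : Sig n → ℂ} (hx : ∀ s, x s ≠ 0) :
    ∃ p : Torus n × Torus n, XY p = x := by
  refine ⟨(Fin.partialProd fun i => Units.mk0 (x (.inl i)) (hx _),
    Fin.partialProd fun i => (Units.mk0 (x (.inr i)) (hx _))⁻¹), ?_⟩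
  funext s
  rcases s with i | i
  · simp [XY, Fin.partialProd_succ]
  · simp only [XY, Sum.elim_inr, Fin.partialProd_succ, Units.val_mul, Units.val_inv_eq_inv_val,
      Units.val_mk0]
    rw [div_mul_eq_div_div, div_self (Units.ne_zero _), one_div, inv_inv]

theorem continuous_XY (n : ℕ) : Continuous (XY (n := n)) := by
  refine continuous_pi fun s => ?_
  rcases s with i | i
  · exact (Units.continuous_val.comp ((continuous_apply i.succ).comp continuous_fst)).div
      (Units.continuous_val.comp ((continuous_apply i.castSucc).comp continuous_fst))
      fun p => Units.ne_zero _
  · exact (Units.continuous_val.comp ((continuous_apply i.castSucc).comp continuous_snd)).div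
      (Units.continuous_val.comp ((continuous_apply i.succ).comp continuous_snd))
      fun p => Units.ne_zero _

theorem isOpenEmbedding_emb (n : ℕ) : Topology.IsOpenEmbedding (emb n) := by
  have h : Topology.IsEmbedding (emb n) := by
    have h1 : Topology.IsEmbedding (Pi.map fun (_ : Fin (n + 2)) (u : ℂˣ) => (u : ℂ)) :=
      Topology.IsEmbedding.piMap fun _ => Units.isOpenEmbedding_val.isEmbedding
    exact h1.prodMap h1
  exact ⟨h, isOpen_range_emb n⟩

theorem hol_eq_zero_of_eventually {n : ℕ} {b : Hol n} {p : Torus n × Torus n}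
    (h : ∀ᶠ p' in nhds p, b.1 p' = 0) : b = 0 := by
  obtain ⟨f, F, hF, hf⟩ := b
  have h0 : F =ᶠ[nhds (emb n p)] 0 := by
    rw [← (isOpenEmbedding_emb n).map_nhds_eq]
    refine Filter.eventually_map.2 (h.mono fun p' hp' => ?_)
    rw [← hf]
    exact hp'
  have := hF.eqOn_zero_of_preconnected_of_eventuallyEq_zero (isPreconnected_range_emb n)
    ⟨p, rfl⟩ h0
  exact Subtype.ext (funext fun p' => by
    have := this ⟨p', rfl⟩
    simpa [hf] using this)

/-- This cancels a denominator $b$ even where it vanishes: if $h(p)\ne0$, then $b=0$ near $p$, hence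
everywhere by the identity theorem. -/
theorem eq_zero_of_eventually_mul {n : ℕ} {b : Hol n} (hb : b ≠ 0) {p : Torus n × Torus n}
    {h : Torus n × Torus n → ℂ} (hc : ContinuousAt h p)
    (hm : ∀ᶠ p' in nhds p, h p' * b.1 p' = 0) : h p = 0 := by
  by_contra h0
  refine hb (hol_eq_zero_of_eventually (p := p) ?_)
  filter_upwards [hm, hc.eventually_ne h0] with p' h1 h2
  exact (mul_eq_zero.1 h1).resolve_left h2

theorem isHol_XY {n : ℕ} (F : (Sig n → ℂ) → ℂ) (hF : AnalyticOnNhd ℂ F Set.univ) :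
    IsHol n fun p => F (XY p) := by
  have h : ∀ s, IsHol n fun p => XY p s := by
    rintro (i | i)
    · simpa [XY, div_eq_mul_inv] using
        (isHol_fst i.succ).mul ((isHol_fst (n := n) i.castSucc).inv fun p => Units.ne_zero _)
    · simpa [XY, div_eq_mul_inv] using
        (isHol_snd i.castSucc).mul ((isHol_snd (n := n) i.succ).inv fun p => Units.ne_zero _)
  choose G hG hGe using h
  refine ⟨fun z => F fun s => G s z, ?_, fun p => ?_⟩
  · intro z hz
    exact (hF _ trivial).comp (f := fun z s => G s z) (analyticAt_pi_iff.2 fun s => hG s z hz)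
  · change F (XY p) = F _
    congr 1
    funext s
    exact hGe s p

/-- The holomorphic function `F(x, y)` on `T × T` for an entire function `F`. -/
def pullH {n : ℕ} (F : (Sig n → ℂ) → ℂ) (hF : AnalyticOnNhd ℂ F Set.univ) : Hol n :=
  ⟨fun p => F (XY p), isHol_XY F hF⟩

/-- The coordinates `x_i`, `y_i` as holomorphic functions. -/
def varH {n : ℕ} (s : Sig n) : Hol n :=
  pullH (fun x => x s) fun _ _ => (ContinuousLinearMap.proj (R := ℂ) (φ := fun _ => ℂ) s).analyticAt _

/-- Polynomials in the simple root variables as holomorphic functions. -/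
def evH (n : ℕ) : MvPolynomial (Sig n) ℂ →ₐ[ℂ] Hol n := MvPolynomial.aeval varH

theorem evH_apply {n : ℕ} (P : MvPolynomial (Sig n) ℂ) (p : Torus n × Torus n) :
    (evH n P).1 p = MvPolynomial.eval (XY p) P := by
  let g : MvPolynomial (Sig n) ℂ →ₐ[ℂ] ℂ :=
    (Pi.evalAlgHom ℂ (fun _ : Torus n × Torus n => ℂ) p).comp ((Hol n).val.comp (evH n))
  have h : g = MvPolynomial.aeval (XY p) := by
    refine MvPolynomial.algHom_ext fun s => ?_
    change (evH n (MvPolynomial.X s)).1 p = _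
    rw [evH, MvPolynomial.aeval_X, MvPolynomial.aeval_X]
    rfl
  have h' := DFunLike.congr_fun h P
  rw [MvPolynomial.aeval_eq_eval] at h'
  exact h'

/-- Polynomials in the simple root variables as meromorphic functions. -/
def ev (n : ℕ) : MvPolynomial (Sig n) ℂ →ₐ[ℂ] Mer n :=
  (IsScalarTower.toAlgHom ℂ (Hol n) (Mer n)).comp (evH n)

theorem ev_eq {n : ℕ} (P : MvPolynomial (Sig n) ℂ) :
    ev n P = algebraMap (Hol n) (Mer n) (evH n P) := rfl

theorem algebraMap_ne_zero {n : ℕ} {b : Hol n} (hb : b ≠ 0) : algebraMap (Hol n) (Mer n) b ≠ 0 := by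
  rwa [Ne, ← map_zero (algebraMap (Hol n) (Mer n)), (algebraMap_Hol_injective n).eq_iff]

/-- The analytic function `f` near the origin represents the meromorphic function `ψ` in the
simple root variables. -/
def Germ {n : ℕ} (ψ : Mer n) (f : (Sig n → ℂ) → ℂ) : Prop :=
  AnalyticAt ℂ f 0 ∧ ∃ a b : Hol n, b ≠ 0 ∧
    ψ = algebraMap (Hol n) (Mer n) a / algebraMap (Hol n) (Mer n) b ∧
    ∃ ε > 0, ∀ p, ‖XY p‖ < ε → f (XY p) * b.1 p = a.1 p

variable {n : ℕ}

theorem Germ.add {ψ φ : Mer n} {f g : (Sig n → ℂ) → ℂ} (h1 : Germ ψ f) (h2 : Germ φ g) :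
    Germ (ψ + φ) (f + g) := by
  obtain ⟨hf, a, b, hb, rfl, ε, hε, h⟩ := h1
  obtain ⟨hg, a', b', hb', rfl, ε', hε', h'⟩ := h2
  refine ⟨hf.add hg, a * b' + b * a', b * b', mul_ne_zero hb hb', ?_, min ε ε', lt_min hε hε',
    fun p hp => ?_⟩
  · rw [div_add_div _ _ (algebraMap_ne_zero hb) (algebraMap_ne_zero hb')]
    simp only [map_add, map_mul]
  · have e1 := h p (hp.trans_le (min_le_left _ _))
    have e2 := h' p (hp.trans_le (min_le_right _ _))
    change (f (XY p) + g (XY p)) * (b.1 p * b'.1 p) = a.1 p * b'.1 p + b.1 p * a'.1 p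
    rw [← e1, ← e2]
    ring

theorem Germ.mul {ψ φ : Mer n} {f g : (Sig n → ℂ) → ℂ} (h1 : Germ ψ f) (h2 : Germ φ g) :
    Germ (ψ * φ) (f * g) := by
  obtain ⟨hf, a, b, hb, rfl, ε, hε, h⟩ := h1
  obtain ⟨hg, a', b', hb', rfl, ε', hε', h'⟩ := h2
  refine ⟨hf.mul hg, a * a', b * b', mul_ne_zero hb hb', ?_, min ε ε', lt_min hε hε',
    fun p hp => ?_⟩
  · rw [div_mul_div_comm]
    simp only [map_mul]
  · have e1 := h p (hp.trans_le (min_le_left _ _))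
    have e2 := h' p (hp.trans_le (min_le_right _ _))
    change (f (XY p) * g (XY p)) * (b.1 p * b'.1 p) = a.1 p * a'.1 p
    rw [← e1, ← e2]
    ring

theorem germ_algebraMap {F : (Sig n → ℂ) → ℂ} (hF : AnalyticOnNhd ℂ F Set.univ) :
    Germ (algebraMap (Hol n) (Mer n) (pullH F hF)) F := by
  refine ⟨hF 0 trivial, pullH F hF, 1, one_ne_zero, by simp, 1, one_pos, fun p _ => ?_⟩
  change F (XY p) * 1 = F (XY p)
  rw [mul_one]

theorem analyticOnNhd_eval (P : MvPolynomial (Sig n) ℂ) :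
    AnalyticOnNhd ℂ (fun x => MvPolynomial.eval x P) Set.univ :=
  AnalyticOnNhd.eval_mvPolynomial P

theorem germ_ev (P : MvPolynomial (Sig n) ℂ) : Germ (ev n P) fun x => MvPolynomial.eval x P := by
  have : evH n P = pullH _ (analyticOnNhd_eval P) :=
    Subtype.ext (funext fun p => evH_apply P p)
  rw [ev_eq, this]
  exact germ_algebraMap _

theorem germ_zero : Germ (0 : Mer n) 0 := by
  have := germ_ev (0 : MvPolynomial (Sig n) ℂ)
  simp only [map_zero] at this
  exact this

theorem Germ.sum {ι : Type*} (s : Finset ι) {ψ : ι → Mer n} {f : ι → (Sig n → ℂ) → ℂ}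
    (h : ∀ i ∈ s, Germ (ψ i) (f i)) : Germ (∑ i ∈ s, ψ i) (∑ i ∈ s, f i) := by
  classical
  induction s using Finset.induction_on with
  | empty => simpa using germ_zero
  | insert i s hi ih =>
    rw [Finset.sum_insert hi, Finset.sum_insert hi]
    exact (h i (Finset.mem_insert_self _ _)).add (ih fun j hj => h j (Finset.mem_insert_of_mem hj))

/-- Cross-multiplying the two fractions gives equality at all points near the origin with nonzero
coordinates, which are images of torus points. These are dense, and both functions are continuous.
-/
theorem Germ.unique {ψ : Mer n} {f g : (Sig n → ℂ) → ℂ} (h1 : Germ ψ f) (h2 : Germ ψ g) :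
    f =ᶠ[nhds 0] g := by
  obtain ⟨hf, a, b, hb, h3, ε, hε, h⟩ := h1
  obtain ⟨hg, a', b', hb', h4, ε', hε', h'⟩ := h2
  have hcross : a * b' = a' * b := by
    rw [h3, div_eq_div_iff (algebraMap_ne_zero hb) (algebraMap_ne_zero hb'), ← map_mul,
      ← map_mul, (algebraMap_Hol_injective n).eq_iff] at h4
    exact h4
  have hcross' : ∀ p, a.1 p * b'.1 p = a'.1 p * b.1 p := fun p =>
    congrFun (congrArg Subtype.val hcross) p
  have hev := (hf.eventually_analyticAt.and hg.eventually_analyticAt).and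
    ((Metric.ball_mem_nhds (0 : Sig n → ℂ) (lt_min hε hε')))
  obtain ⟨r, hr, hball⟩ := Metric.eventually_nhds_iff_ball.1 hev
  have hmem : ∀ x ∈ Metric.ball (0 : Sig n → ℂ) r, (∀ s, x s ≠ 0) → f x = g x := by
    intro x hx hx0
    obtain ⟨p, rfl⟩ := exists_XY_eq hx0
    have hX := (continuous_XY n).continuousAt (x := p)
    have hc : ContinuousAt (fun p => f (XY p) - g (XY p)) p :=
      (((hball _ hx).1.1.continuousAt).comp hX).sub (((hball _ hx).1.2.continuousAt).comp hX)
    refine sub_eq_zero.1 (eq_zero_of_eventually_mul (mul_ne_zero hb hb') hc ?_)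
    have hnb : ∀ᶠ p' in nhds p, XY p' ∈ Metric.ball (0 : Sig n → ℂ) r :=
      hX.eventually (Metric.isOpen_ball.mem_nhds hx)
    filter_upwards [hnb] with p' hp'
    have hp2 : ‖XY p'‖ < min ε ε' := by simpa using (hball _ hp').2
    have e1 := h p' (hp2.trans_le (min_le_left _ _))
    have e2 := h' p' (hp2.trans_le (min_le_right _ _))
    change (f (XY p') - g (XY p')) * (b.1 p' * b'.1 p') = 0
    linear_combination b'.1 p' * e1 - b.1 p' * e2 + hcross' p'
  refine Metric.eventually_nhds_iff_ball.2 ⟨r, hr, fun x hx => ?_⟩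
  have hd : Dense {x : Sig n → ℂ | ∀ s, x s ≠ 0} := by
    have : {x : Sig n → ℂ | ∀ s, x s ≠ 0} = Set.univ.pi fun _ => ({0}ᶜ : Set ℂ) := by
      ext x
      simp
    rw [this]
    exact dense_pi Set.univ fun _ _ => dense_compl_singleton 0
  have hcl : x ∈ closure (Metric.ball 0 r ∩ {x : Sig n → ℂ | ∀ s, x s ≠ 0}) :=
    hd.open_subset_closure_inter Metric.isOpen_ball hx
  have hne : (nhdsWithin x (Metric.ball 0 r ∩ {x : Sig n → ℂ | ∀ s, x s ≠ 0})).NeBot :=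
    mem_closure_iff_nhdsWithin_neBot.1 hcl
  have t1 := ((hball x hx).1.1.continuousAt.continuousWithinAt
    (s := Metric.ball 0 r ∩ {x : Sig n → ℂ | ∀ s, x s ≠ 0})).tendsto
  have t2 := ((hball x hx).1.2.continuousAt.continuousWithinAt
    (s := Metric.ball 0 r ∩ {x : Sig n → ℂ | ∀ s, x s ≠ 0})).tendsto
  refine tendsto_nhds_unique t1 (t2.congr' ?_)
  filter_upwards [self_mem_nhdsWithin] with y hy
  exact (hmem y hy.1 hy.2).symm

theorem Germ.congr {ψ : Mer n} {f g : (Sig n → ℂ) → ℂ} (h1 : Germ ψ f) (h : f =ᶠ[nhds 0] g) :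
    Germ ψ g := by
  obtain ⟨hf, a, b, hb, h3, ε, hε, h'⟩ := h1
  obtain ⟨r, hr, hball⟩ := Metric.eventually_nhds_iff_ball.1 h
  refine ⟨hf.congr h, a, b, hb, h3, min ε r, lt_min hε hr, fun p hp => ?_⟩
  rw [← hball _ (by simpa using hp.trans_le (min_le_right _ _))]
  exact h' p (hp.trans_le (min_le_left _ _))

/-- The numerator vanishes on a nonempty open subset of $T\times T$, hence everywhere. -/
theorem Germ.eq_zero {ψ : Mer n} {f : (Sig n → ℂ) → ℂ} (h1 : Germ ψ f) (h : f =ᶠ[nhds 0] 0) :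
    ψ = 0 := by
  obtain ⟨-, a, b, hb, rfl, ε, hε, h'⟩ := h1.congr h
  suffices a = 0 by rw [this, map_zero, zero_div]
  -- A torus point in the region where the germ represents $\psi$, needed to start the identity
  -- theorem.
  obtain ⟨p, hp⟩ : ∃ p : Torus n × Torus n, XY p = fun _ => ((ε / 2 : ℝ) : ℂ) :=
    exists_XY_eq fun s => by exact_mod_cast (half_pos hε).ne'
  refine hol_eq_zero_of_eventually (p := p) ?_
  have hX := (continuous_XY n).continuousAt (x := p)
  have hx : XY p ∈ Metric.ball (0 : Sig n → ℂ) ε := by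
    rw [mem_ball_zero_iff, hp]
    refine (pi_norm_const_le _).trans_lt ?_
    rw [Complex.norm_real, Real.norm_of_nonneg (half_pos hε).le]
    exact half_lt_self hε
  filter_upwards [hX.eventually (Metric.isOpen_ball.mem_nhds hx)] with p' hp'
  rw [← h' p' (by simpa using hp')]
  simp

theorem Germ.inv {ψ : Mer n} {f : (Sig n → ℂ) → ℂ} (h1 : Germ ψ f) (h0 : f 0 ≠ 0) :
    Germ ψ⁻¹ f⁻¹ := by
  have hne : ψ ≠ 0 := by
    rintro rfl
    have := h1.unique germ_zero
    exact h0 this.self_of_nhds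
  obtain ⟨hf, a, b, hb, rfl, ε, hε, h⟩ := h1
  have ha : a ≠ 0 := by
    rintro rfl
    simp at hne
  obtain ⟨r, hr, hball⟩ := Metric.eventually_nhds_iff_ball.1 (hf.continuousAt.eventually_ne h0)
  refine ⟨hf.inv h0, b, a, ha, inv_div _ _, min ε r, lt_min hε hr, fun p hp => ?_⟩
  rw [← h p (hp.trans_le (min_le_left _ _)), Pi.inv_apply, inv_mul_cancel_left₀]
  exact hball _ (by simpa using hp.trans_le (min_le_right _ _))

/-! ### Rescalings of the root variables, and rational functions regular at the origin. -/

/-- The biholomorphic map `φ` acts on the simple root variables by multiplication by powers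
of `q`. -/
def Scales (q : Set.Ioo (0 : ℝ) 1) (φ : Bihol n) (e : Sig n → ℕ) : Prop :=
  ∀ p s, XY (φ.1.symm p) s = (qC q : ℂ) ^ e s * XY p s

theorem norm_qC (q : Set.Ioo (0 : ℝ) 1) : ‖(qC q : ℂ)‖ = (q : ℝ) := by
  simp only [qC, Units.val_mk0, Complex.norm_real, Real.norm_eq_abs, abs_of_pos q.2.1]

theorem norm_qC_lt_one (q : Set.Ioo (0 : ℝ) 1) : ‖(qC q : ℂ)‖ < 1 := by
  rw [norm_qC]
  exact q.2.2

/-- The rescaling of the simple root variables. -/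
def scale (q : Set.Ioo (0 : ℝ) 1) (e : Sig n → ℕ) (x : Sig n → ℂ) : Sig n → ℂ :=
  fun s => (qC q : ℂ) ^ e s * x s

theorem Scales.XY_eq {q : Set.Ioo (0 : ℝ) 1} {φ : Bihol n} {e : Sig n → ℕ} (h : Scales q φ e)
    (p : Torus n × Torus n) : XY (φ.1.symm p) = scale q e (XY p) := funext (h p)

theorem scale_zero (q : Set.Ioo (0 : ℝ) 1) (e : Sig n → ℕ) : scale q e 0 = 0 := by
  funext s
  simp [scale]

theorem norm_scale_le (q : Set.Ioo (0 : ℝ) 1) (e : Sig n → ℕ) (x : Sig n → ℂ) :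
    ‖scale q e x‖ ≤ ‖x‖ := by
  rw [pi_norm_le_iff_of_nonneg (norm_nonneg _)]
  intro s
  rw [scale, norm_mul, norm_pow]
  exact (mul_le_of_le_one_left (norm_nonneg _)
    (pow_le_one₀ (norm_nonneg _) (norm_qC_lt_one q).le)).trans (norm_le_pi_norm x s)

theorem analyticAt_scale (q : Set.Ioo (0 : ℝ) 1) (e : Sig n → ℕ) (x : Sig n → ℂ) :
    AnalyticAt ℂ (scale q e) x :=
  analyticAt_pi_iff.2 fun s => analyticAt_const.mul
    ((ContinuousLinearMap.proj (R := ℂ) (φ := fun _ => ℂ) s).analyticAt _)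

theorem Germ.act {ψ : Mer n} {f : (Sig n → ℂ) → ℂ} (h1 : Germ ψ f) {q : Set.Ioo (0 : ℝ) 1}
    {φ : Bihol n} {e : Sig n → ℕ} (hφ : Scales q φ e) : Germ (act n φ ψ) (f ∘ scale q e) := by
  obtain ⟨hf, a, b, hb, rfl, ε, hε, h⟩ := h1
  refine ⟨AnalyticAt.comp (by rwa [scale_zero]) (analyticAt_scale q e 0), actHol n φ a,
    actHol n φ b, ?_, ?_, ε, hε, fun p hp => ?_⟩
  · rwa [Ne, EmbeddingLike.map_eq_zero_iff]
  · rw [map_div₀, act_algebraMap, act_algebraMap]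
  · have e1 := hφ.XY_eq p
    have := h (φ.1.symm p) (by
      rw [e1]
      exact (norm_scale_le q e _).trans_lt hp)
    rw [e1] at this
    exact this

/-- The meromorphic function `r` is a quotient of polynomials in the simple root variables which
is regular at the origin, with value `c`. -/
def Reg (r : Mer n) (c : ℂ) : Prop :=
  ∃ P d : MvPolynomial (Sig n) ℂ, P.coeff 0 = c ∧ d.coeff 0 = 1 ∧ ev n d * r = ev n P

theorem coeff_zero_mul (P Q : MvPolynomial (Sig n) ℂ) :
    (P * Q).coeff 0 = P.coeff 0 * Q.coeff 0 := by
  simp only [← MvPolynomial.constantCoeff_eq, map_mul]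

theorem Reg.add {r s : Mer n} {c d : ℂ} (h1 : Reg r c) (h2 : Reg s d) : Reg (r + s) (c + d) := by
  obtain ⟨P, D, hP, hD, h⟩ := h1
  obtain ⟨P', D', hP', hD', h'⟩ := h2
  refine ⟨P * D' + D * P', D * D', ?_, ?_, ?_⟩
  · rw [MvPolynomial.coeff_add, coeff_zero_mul, coeff_zero_mul, hP, hD, hP', hD', mul_one, one_mul]
  · rw [coeff_zero_mul, hD, hD', mul_one]
  · simp only [map_add, map_mul, ← h, ← h']
    ring

theorem Reg.mul {r s : Mer n} {c d : ℂ} (h1 : Reg r c) (h2 : Reg s d) : Reg (r * s) (c * d) := by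
  obtain ⟨P, D, hP, hD, h⟩ := h1
  obtain ⟨P', D', hP', hD', h'⟩ := h2
  refine ⟨P * P', D * D', ?_, ?_, ?_⟩
  · rw [coeff_zero_mul, hP, hP']
  · rw [coeff_zero_mul, hD, hD', mul_one]
  · simp only [map_mul, ← h, ← h']
    ring

theorem reg_ev (P : MvPolynomial (Sig n) ℂ) : Reg (ev n P) (P.coeff 0) :=
  ⟨P, 1, rfl, by simp, by simp⟩

theorem reg_algebraMap (c : ℂ) : Reg (algebraMap ℂ (Mer n) c) c := by
  have h := reg_ev (n := n) (MvPolynomial.C c)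
  rw [MvPolynomial.coeff_zero_C, MvPolynomial.C_eq_algebraMap, AlgHom.commutes] at h
  exact h

theorem reg_zero : Reg (0 : Mer n) 0 := by simpa using reg_algebraMap (n := n) 0

theorem reg_one : Reg (1 : Mer n) 1 := by simpa using reg_algebraMap (n := n) 1

theorem Reg.prod {ι : Type*} (s : Finset ι) {r : ι → Mer n} {c : ι → ℂ}
    (h : ∀ i ∈ s, Reg (r i) (c i)) : Reg (∏ i ∈ s, r i) (∏ i ∈ s, c i) := by
  classical
  induction s using Finset.induction_on with
  | empty => simpa using reg_one
  | insert i s hi ih =>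
    rw [Finset.prod_insert hi, Finset.prod_insert hi]
    exact (h i (Finset.mem_insert_self _ _)).mul (ih fun j hj => h j (Finset.mem_insert_of_mem hj))

theorem ev_ne_zero {d : MvPolynomial (Sig n) ℂ} (hd : d.coeff 0 = 1) : ev n d ≠ 0 := by
  intro h
  have h1 := germ_ev d
  rw [h] at h1
  have := (h1.unique germ_zero).self_of_nhds
  simp only [Pi.zero_apply] at this
  rw [← MvPolynomial.constantCoeff_eq] at hd
  rw [MvPolynomial.eval_zero, hd] at this
  exact one_ne_zero this

/-- The denominator has value $1$ at the origin, so the fraction is analytic there; in particular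
the value $c$ depends only on $r$. -/
theorem Reg.germ {r : Mer n} {c : ℂ} (h : Reg r c) : ∃ f, Germ r f ∧ f 0 = c := by
  obtain ⟨P, d, hP, hd, h⟩ := h
  have hd' : MvPolynomial.eval 0 d = 1 := by
    rw [MvPolynomial.eval_zero, MvPolynomial.constantCoeff_eq, hd]
  have h1 := (germ_ev P).mul ((germ_ev d).inv (by rw [hd']; exact one_ne_zero))
  rw [← h, mul_comm (ev n d), mul_inv_cancel_right₀ (ev_ne_zero hd)] at h1
  refine ⟨_, h1, ?_⟩
  simp only [Pi.mul_apply, Pi.inv_apply]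
  rw [hd', inv_one, mul_one, MvPolynomial.eval_zero, MvPolynomial.constantCoeff_eq, hP]

theorem Reg.unique {r : Mer n} {c d : ℂ} (h1 : Reg r c) (h2 : Reg r d) : c = d := by
  obtain ⟨f, hf, rfl⟩ := h1.germ
  obtain ⟨g, hg, rfl⟩ := h2.germ
  exact (hf.unique hg).self_of_nhds

/-! ### Vector-valued germs and normally convergent expansions. -/

/-- `f` is regular at the origin, with value `c`. -/
def RegV (f : H0K n) (c : Equiv.Perm (Fin (n + 2)) → ℂ) : Prop := ∀ w, Reg (f w) (c w)

/-- `f` is analytic near the origin in the simple root variables, with value `c` there. -/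
def GermV (f : H0K n) (c : Equiv.Perm (Fin (n + 2)) → ℂ) : Prop :=
  ∀ w, ∃ g, Germ (f w) g ∧ g 0 = c w

/-- The multi-indices in `Q_+ × Q_+` as exponents of monomials in the simple root variables. -/
def idx (n : ℕ) : QIdx n ≃ (Sig n →₀ ℕ) :=
  (Equiv.sumArrowEquivProdArrow _ _ _).symm.trans Finsupp.equivFunOnFinite.symm

theorem mon_idx (ab : QIdx n) (p : Torus n × Torus n) : mon (idx n ab) (XY p) = monomial ab p := by
  rw [mon, Fintype.prod_sum_type, ← Finset.prod_mul_distrib]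
  rfl

theorem mem_region_iff {ε : ℝ} (hε : 0 < ε) (p : Torus n × Torus n) :
    p ∈ region n ε ↔ ‖XY p‖ < ε := by
  rw [pi_norm_lt_iff hε]
  constructor
  · rintro h (i | i)
    · exact (h i).1
    · exact (h i).2
  · exact fun h i => ⟨h (.inl i), h (.inr i)⟩

/-- Normal convergence at the single point with all root variables equal to $\varepsilon/2$ already
bounds $|K_a|(\varepsilon/2)^{|a|}$, which makes the series analytic at the origin. -/
theorem GermV.of_hasExpansion {Ψ : H0K n} (h : HasExpansion Ψ) :
    GermV Ψ (Pi.single Fin.revPerm 1) := by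
  obtain ⟨ε, hε, K, hK, hA, h0⟩ := h
  intro w
  obtain ⟨p, hp⟩ : ∃ p : Torus n × Torus n, XY p = fun _ => ((ε / 2 : ℝ) : ℂ) :=
    exists_XY_eq fun s => by exact_mod_cast (half_pos hε).ne'
  have hp' : p ∈ region n ε := by
    rw [mem_region_iff hε, hp]
    refine (pi_norm_const_le _).trans_lt ?_
    rw [Complex.norm_real, Real.norm_of_nonneg (half_pos hε).le]
    exact half_lt_self hε
  obtain ⟨M, hM, hb⟩ := hK {p} (Set.singleton_subset_iff.2 hp') isCompact_singleton w
  have hM0 : ∀ ab, 0 ≤ M ab := fun ab => (norm_nonneg _).trans (hb ab p rfl)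
  have hbound : ∀ a, ‖K ((idx n).symm a) w‖ * (ε / 2) ^ a.degree ≤ ∑' ab, M ab := by
    intro a
    have h1 := hb ((idx n).symm a) p rfl
    rw [← mon_idx, Equiv.apply_symm_apply, norm_mul, hp, mon, norm_prod] at h1
    simp only [norm_pow, Complex.norm_real, Real.norm_of_nonneg (half_pos hε).le] at h1
    rw [Finset.prod_pow_eq_pow_sum, ← Finsupp.degree_eq_sum] at h1
    exact h1.trans (hM.le_tsum _ fun ab _ => hM0 ab)
  refine ⟨ser fun a => K ((idx n).symm a) w, ⟨?_, ?_⟩, ?_⟩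
  · exact analyticOnNhd_ser (half_pos hε) hbound 0 (by simpa using half_pos hε)
  · obtain ⟨a, b, hb, he, hab⟩ := hA w
    refine ⟨a, b, hb, he, ε, hε, fun p hp => ?_⟩
    rw [← hab p ((mem_region_iff hε p).2 hp), ser, ← (idx n).tsum_eq]
    simp only [Equiv.symm_apply_apply, mon_idx]
  · rw [ser_zero, show (idx n).symm 0 = 0 from rfl, h0]

/-- Each of the finitely many components has its own radius of convergence, and the smallest one
serves for all. On a compact set the root variables stay in a strictly smaller polydisc, which gives
the summable majorant. -/
theorem GermV.hasExpansion {Ψ : H0K n} (h : GermV Ψ (Pi.single Fin.revPerm 1)) :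
    HasExpansion Ψ := by
  have h' : ∀ w, ∃ ε > 0, ∃ K : (Sig n →₀ ℕ) → ℂ, ∃ M : ℝ,
      (∀ a, ‖K a‖ * ε ^ a.degree ≤ M) ∧ AgreesOn (Ψ w) (fun p => ser K (XY p)) (region n ε) ∧
      K 0 = (Pi.single Fin.revPerm 1 : Equiv.Perm (Fin (n + 2)) → ℂ) w := by
    intro w
    obtain ⟨f, ⟨hf, a, b, hb, he, ε, hε, hab⟩, hf0⟩ := h w
    obtain ⟨K, R, M, hR, hK, hKs⟩ := exists_ser_of_analyticAt hf
    have hm : 0 < min ε R := lt_min hε hR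
    refine ⟨min ε R, hm, K, M, fun a => ?_, ⟨a, b, hb, he, fun p hp => ?_⟩, ?_⟩
    · exact (mul_le_mul_of_nonneg_left (pow_le_pow_left₀ hm.le (min_le_right _ _) _)
        (norm_nonneg _)).trans (hK a)
    · rw [mem_region_iff hm] at hp
      rw [← hab p (hp.trans_le (min_le_left _ _)), hKs _ (hp.trans_le (min_le_right _ _))]
    · rw [← hf0, hKs 0 (by simpa using hR), ser_zero]
  choose ε hε K M hK hA h0 using h'
  obtain ⟨w₀, hw₀⟩ := Finite.exists_min ε
  refine ⟨ε w₀, hε w₀, fun ab w => K w (idx n ab), fun C hC hCc w => ?_, fun w => ?_, ?_⟩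
  · have hmax : ∃ r, 0 ≤ r ∧ r < ε w₀ ∧ ∀ p ∈ C, ‖XY p‖ ≤ r := by
      rcases C.eq_empty_or_nonempty with rfl | hne
      · exact ⟨0, le_rfl, hε w₀, by simp⟩
      · obtain ⟨p, hp, hmax⟩ := hCc.exists_isMaxOn hne (continuous_XY n).norm.continuousOn
        exact ⟨‖XY p‖, norm_nonneg _, (mem_region_iff (hε w₀) p).1 (hC hp), fun p' hp' => hmax hp'⟩
    obtain ⟨r, hr0, hr, hr'⟩ := hmax
    refine ⟨fun ab => ‖K w (idx n ab)‖ * r ^ (idx n ab).degree, ?_, fun ab p hp => ?_⟩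
    · have hs := summable_norm_ser (hε w) (hK w) hr0 (hr.trans_le (hw₀ w))
      exact hs.comp_injective (idx n).injective
    · rw [norm_mul, ← mon_idx]
      exact mul_le_mul_of_nonneg_left
        (norm_mon_le fun s => (norm_le_pi_norm _ s).trans (hr' p hp)) (norm_nonneg _)
  · obtain ⟨a, b, hb, he, hab⟩ := hA w
    refine ⟨a, b, hb, he, fun p hp => ?_⟩
    rw [← hab p ((mem_region_iff (hε w) p).2
      (((mem_region_iff (hε w₀) p).1 hp).trans_le (hw₀ w)))]
    have e : ser (K w) (XY p) = ∑' ab, K w (idx n ab) * monomial ab p := by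
      simp only [← mon_idx]
      exact ((idx n).tsum_eq fun a => K w a * mon a (XY p)).symm
    exact congrArg (· * b.1 p) e.symm
  · funext w
    have e : idx n 0 = 0 := by
      ext s
      rcases s with s | s <;> rfl
    rw [← h0 w, ← e]

/-! ### Semilinear operators with a limit at the origin. -/

/-- `T` is a semilinear operator which maps functions that are regular at the origin to functions
that are regular at the origin; the values at the origin transform by `A`. -/
structure IsRegOp (q : Set.Ioo (0 : ℝ) 1) (T : H0K n ≃ₗ[ℂ] H0K n) (e : Sig n → ℕ)
    (A : Module.End ℂ (Equiv.Perm (Fin (n + 2)) → ℂ)) : Prop where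
  semilinear : ∃ φ : Bihol n, Scales q φ e ∧ ∀ (c : Mer n) (f : H0K n), T (c • f) = act n φ c • T f
  reg : ∀ f c, RegV f c → RegV (T f) (A c)

theorem IsRegOp.one (q : Set.Ioo (0 : ℝ) 1) : IsRegOp (n := n) q 1 0 1 where
  semilinear := ⟨1, fun p s => by
    change XY p s = _
    simp, fun c f => by
    rw [map_one]
    rfl⟩
  reg _ _ h := h

theorem IsRegOp.mul {q : Set.Ioo (0 : ℝ) 1} {T T' : H0K n ≃ₗ[ℂ] H0K n} {e e' : Sig n → ℕ}
    {A A' : Module.End ℂ (Equiv.Perm (Fin (n + 2)) → ℂ)} (h : IsRegOp q T e A)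
    (h' : IsRegOp q T' e' A') : IsRegOp q (T * T') (e + e') (A * A') where
  semilinear := by
    obtain ⟨φ, hφ, hT⟩ := h.semilinear
    obtain ⟨ψ, hψ, hT'⟩ := h'.semilinear
    refine ⟨φ * ψ, fun p s => ?_, fun c f => ?_⟩
    · change XY (ψ.1.symm (φ.1.symm p)) s = _
      rw [hψ, hφ, Pi.add_apply, pow_add]
      ring
    · rw [LinearEquiv.mul_apply, hT', hT, map_mul]
      rfl
  reg f c hf := h.reg _ _ (h'.reg _ _ hf)

theorem RegV.const (c : Equiv.Perm (Fin (n + 2)) → ℂ) :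
    RegV (fun w => algebraMap ℂ (Mer n) (c w)) c := fun w => reg_algebraMap (c w)

/-- Applying the operators in both orders to constant vectors and comparing values at the origin
shows that the limits inherit commutativity, so it need not be computed in the Hecke algebra. -/
theorem IsRegOp.commute {q : Set.Ioo (0 : ℝ) 1} {T T' : H0K n ≃ₗ[ℂ] H0K n} {e e' : Sig n → ℕ}
    {A A' : Module.End ℂ (Equiv.Perm (Fin (n + 2)) → ℂ)} (h : IsRegOp q T e A)
    (h' : IsRegOp q T' e' A') (hc : Commute T T') : Commute A A' := by
  refine LinearMap.ext fun c => funext fun w => ?_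
  have h1 := (h.mul h').reg _ _ (RegV.const c) w
  have h2 := (h'.mul h).reg _ _ (RegV.const c) w
  rw [hc.eq] at h1
  exact h1.unique h2

theorem smul_single_sum (f : H0K n) : f = ∑ w, f w • (Pi.single w 1 : H0K n) := pi_eq_sum_univ' f

/-- A semilinear operator is a matrix composed with a substitution, so $T\Psi=\Psi$ becomes a
$q$-difference system. -/
theorem IsRegOp.apply_eq {T : H0K n ≃ₗ[ℂ] H0K n} {φ : Bihol n}
    (hT : ∀ (c : Mer n) (f : H0K n), T (c • f) = act n φ c • T f) (f : H0K n)
    (v : Equiv.Perm (Fin (n + 2))) :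
    T f v = ∑ w, T (Pi.single w 1) v * act n φ (f w) := by
  conv_lhs => rw [smul_single_sum f, map_sum, Finset.sum_apply]
  refine Finset.sum_congr rfl fun w _ => ?_
  rw [hT, Pi.smul_apply, smul_eq_mul, mul_comm]

theorem regV_single (w : Equiv.Perm (Fin (n + 2))) :
    RegV (Pi.single w 1 : H0K n) (Pi.single w 1) := by
  intro v
  by_cases h : v = w
  · subst h
    simpa using reg_one
  · simpa [h] using reg_zero

/-- The definition of `IsRegOp` tests only rational functions. The matrix entries of $T$ are regular
and the rescaling fixes the origin, so the conclusion extends to analytic germs. -/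
theorem IsRegOp.germV {q : Set.Ioo (0 : ℝ) 1} {T : H0K n ≃ₗ[ℂ] H0K n} {e : Sig n → ℕ}
    {A : Module.End ℂ (Equiv.Perm (Fin (n + 2)) → ℂ)} (h : IsRegOp q T e A) {f : H0K n}
    {c : Equiv.Perm (Fin (n + 2)) → ℂ} (hf : GermV f c) : GermV (T f) (A c) := by
  obtain ⟨φ, hφ, hT⟩ := h.semilinear
  choose g hg hg0 using hf
  intro v
  choose m hm hm0 using fun w => (h.reg _ _ (regV_single w) v).germ
  refine ⟨∑ w, m w * (g w ∘ scale q e), ?_, ?_⟩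
  · rw [IsRegOp.apply_eq hT]
    exact Germ.sum _ fun w _ => (hm w).mul ((hg w).act hφ)
  · rw [Finset.sum_apply]
    simp only [Pi.mul_apply, Function.comp_apply, scale_zero, hg0, hm0]
    conv_rhs => rw [pi_eq_sum_univ' c, map_sum, Finset.sum_apply]
    refine Finset.sum_congr rfl fun w _ => ?_
    rw [map_smul, Pi.smul_apply, smul_eq_mul, mul_comm]

theorem GermV.sub {f g : H0K n} {c d : Equiv.Perm (Fin (n + 2)) → ℂ} (hf : GermV f c)
    (hg : GermV g d) : GermV (f - g) (c - d) := by
  intro w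
  obtain ⟨F, hF, h1⟩ := hf w
  obtain ⟨G, hG, h2⟩ := hg w
  refine ⟨F + (fun x => MvPolynomial.eval x (-1)) * G, ?_, ?_⟩
  · have := hF.add ((germ_ev (-1)).mul hG)
    rw [map_neg, map_one, neg_one_mul, ← sub_eq_add_neg] at this
    exact this
  · simp [h1, h2, sub_eq_add_neg]

theorem scale_one (q : Set.Ioo (0 : ℝ) 1) : scale (n := n) q 1 = fun x => (qC q : ℂ) • x := by
  funext x s
  simp [scale]

/-- Uniqueness of the solution of `T Ψ = Ψ` with given value at the origin. -/
theorem IsRegOp.eq_zero {q : Set.Ioo (0 : ℝ) 1} {T : H0K n ≃ₗ[ℂ] H0K n}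
    {A : Module.End ℂ (Equiv.Perm (Fin (n + 2)) → ℂ)} (h : IsRegOp q T 1 A) (hA : A * A = A)
    {Ψ : H0K n} (hT : T Ψ = Ψ) (h0 : GermV Ψ 0) : Ψ = 0 := by
  obtain ⟨φ, hφ, hTφ⟩ := h.semilinear
  choose g hg hg0 using h0
  choose m hm hm0 using fun v w => (h.reg _ _ (regV_single w) v).germ
  have heq : ∀ v, g v =ᶠ[nhds 0] ∑ w, m v w * (g w ∘ scale q 1) := by
    intro v
    refine (hg v).unique ?_
    have := Germ.sum Finset.univ fun w _ => (hm v w).mul ((hg w).act hφ)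
    rw [← IsRegOp.apply_eq hTφ, hT] at this
    exact this
  have key := eventually_eq_zero_of_qDifference (J := Equiv.Perm (Fin (n + 2)))
    (norm_qC_lt_one q) (M := fun x => Matrix.of fun v w => m v w x) (f := fun x v => g v x)
    (continuousAt_pi.2 fun v => continuousAt_pi.2 fun w => (hm v w).1.continuousAt) ?_
    (differentiableAt_pi.2 fun v => (hg v).1.differentiableAt) (funext fun v => hg0 v) ?_
  · funext v
    exact (hg v).eq_zero (key.mono fun x hx => congrFun hx v)
  · have e : (Matrix.of fun v w => m v w 0) = LinearMap.toMatrix' A := by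
      ext v w
      rw [LinearMap.toMatrix'_apply, Matrix.of_apply, hm0]
    rw [e, ← LinearMap.toMatrix'_mul, hA]
  · filter_upwards [Filter.eventually_all.2 heq] with x hx
    funext v
    rw [hx v, Finset.sum_apply]
    refine Finset.sum_congr rfl fun w _ => ?_
    rw [scale_one]
    rfl

theorem actHol_pullH {q : Set.Ioo (0 : ℝ) 1} {φ : Bihol n} (hφ : Scales q φ 1)
    {F : (Sig n → ℂ) → ℂ} (hF : AnalyticOnNhd ℂ F Set.univ) :
    ∀ p, (actHol n φ (pullH F hF)).1 p = F ((qC q : ℂ) • XY p) := by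
  intro p
  change F (XY (φ.1.symm p)) = _
  rw [hφ.XY_eq, scale_one]

/-- Existence of a solution of `T Ψ = Ψ` with given value at the origin. -/
theorem IsRegOp.exists_solution {q : Set.Ioo (0 : ℝ) 1} {T : H0K n ≃ₗ[ℂ] H0K n}
    {A : Module.End ℂ (Equiv.Perm (Fin (n + 2)) → ℂ)} (h : IsRegOp q T 1 A) (hA : A * A = A)
    {c : Equiv.Perm (Fin (n + 2)) → ℂ} (hc : A c = c) : ∃ Ψ : H0K n, T Ψ = Ψ ∧ GermV Ψ c := by
  classical
  obtain ⟨φ, hφ, hTφ⟩ := h.semilinear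
  choose P' d' hP' hd' hr using fun v w => h.reg _ _ (regV_single w) v
  -- A common denominator of all matrix entries. As $d(0)=1$, the polynomial matrix $P=dM$ has the
  -- same value $A$ at the origin as $M$.
  obtain ⟨d, hd⟩ : ∃ d : MvPolynomial (Sig n) ℂ,
      d = ∏ i : Equiv.Perm (Fin (n + 2)) × Equiv.Perm (Fin (n + 2)), d' i.1 i.2 := ⟨_, rfl⟩
  have hcoef : ∀ s : Finset (Equiv.Perm (Fin (n + 2)) × Equiv.Perm (Fin (n + 2))),
      (∏ i ∈ s, d' i.1 i.2).coeff 0 = 1 := by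
    intro s
    rw [← MvPolynomial.constantCoeff_eq, map_prod]
    exact Finset.prod_eq_one fun i _ => by rw [MvPolynomial.constantCoeff_eq, hd']
  obtain ⟨P, hPd⟩ : ∃ P : Matrix (Equiv.Perm (Fin (n + 2))) (Equiv.Perm (Fin (n + 2)))
      (MvPolynomial (Sig n) ℂ), ∀ v w, P v w = P' v w * ∏ i ∈ Finset.univ.erase (v, w), d' i.1 i.2 :=
    ⟨fun v w => P' v w * ∏ i ∈ Finset.univ.erase (v, w), d' i.1 i.2, fun _ _ => rfl⟩
  have hd0 : d.coeff 0 = 1 := by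
    rw [hd]
    exact hcoef _
  have hP : ∀ v w, ev n d * T (Pi.single w 1) v = ev n (P v w) := by
    intro v w
    rw [hd, hPd, ← Finset.mul_prod_erase _ _ (Finset.mem_univ (v, w)), map_mul, map_mul, ← hr]
    ring
  have hP0 : P.map (MvPolynomial.coeff 0) = LinearMap.toMatrix' A := by
    ext v w
    rw [LinearMap.toMatrix'_apply, Matrix.map_apply]
    rw [hPd, coeff_zero_mul, hcoef, mul_one, hP']
  have hq0 : (qC q : ℂ) ≠ 0 := (qC q).ne_zero
  obtain ⟨F, hF, hF0, hFeq⟩ := exists_entire_solution hq0 (norm_qC_lt_one q) P c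
    (by rw [hP0, ← LinearMap.toMatrix'_mul, hA])
    (by rw [hP0, ← Matrix.toLin'_apply, Matrix.toLin'_toMatrix', hc])
  have hD0 : (Matrix.of fun _ _ : Unit => d).map (MvPolynomial.coeff 0) = 1 := by
    ext i j
    simp only [Matrix.map_apply, Matrix.of_apply, Matrix.one_apply, if_true]
    exact hd0
  -- The scalar equation $S(x)=d(x)S(qx)$, $S(0)=1$, absorbs the denominator: if $F(x)=P(x)F(qx)$,
  -- then $F/S$ solves the system with matrix $P/d$. Both $F$ and $S$ are entire, so the quotient is
  -- meromorphic on all of $T\times T$.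
  obtain ⟨S, hS, hS0, hSeq⟩ := exists_entire_solution hq0 (norm_qC_lt_one q)
    (Matrix.of fun _ _ : Unit => d) (fun _ => 1) (by rw [hD0, one_mul])
    (by rw [hD0, Matrix.one_mulVec])
  have gS := germ_algebraMap (n := n) (hS ())
  have hSne : algebraMap (Hol n) (Mer n) (pullH (S ()) (hS ())) ≠ 0 := by
    intro h0
    rw [h0] at gS
    have := (gS.unique germ_zero).self_of_nhds
    rw [hS0] at this
    exact one_ne_zero this
  have hSne' : act n φ (algebraMap (Hol n) (Mer n) (pullH (S ()) (hS ()))) ≠ 0 := by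
    rwa [Ne, EmbeddingLike.map_eq_zero_iff]
  refine ⟨fun w => algebraMap (Hol n) (Mer n) (pullH (F w) (hF w)) *
    (algebraMap (Hol n) (Mer n) (pullH (S ()) (hS ())))⁻¹, ?_, fun w => ?_⟩
  · funext v
    rw [IsRegOp.apply_eq hTφ]
    have eS : algebraMap (Hol n) (Mer n) (pullH (S ()) (hS ())) =
        ev n d * act n φ (algebraMap (Hol n) (Mer n) (pullH (S ()) (hS ()))) := by
      rw [act_algebraMap, ev_eq, ← map_mul]
      congr 1
      refine Subtype.ext (funext fun p => ?_)
      change S () (XY p) = (evH n d).1 p * (actHol n φ (pullH (S ()) (hS ()))).1 p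
      rw [actHol_pullH hφ, evH_apply, hSeq]
      simp
    have eF : algebraMap (Hol n) (Mer n) (pullH (F v) (hF v)) =
        ∑ w, ev n (P v w) * act n φ (algebraMap (Hol n) (Mer n) (pullH (F w) (hF w))) := by
      simp only [act_algebraMap, ev_eq, ← map_mul, ← map_sum]
      congr 1
      refine Subtype.ext (funext fun p => ?_)
      have e1 : (∑ w, evH n (P v w) * actHol n φ (pullH (F w) (hF w)) : Hol n).1 p =
          ∑ w, (evH n (P v w)).1 p * (actHol n φ (pullH (F w) (hF w))).1 p := by
        rw [AddSubmonoidClass.coe_finsetSum, Finset.sum_apply]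
        rfl
      rw [e1]
      simp only [actHol_pullH hφ, evH_apply]
      exact hFeq v (XY p)
    have hd1 := ev_ne_zero (n := n) hd0
    conv_rhs => rw [eF, eS, Finset.sum_mul]
    refine Finset.sum_congr rfl fun w _ => ?_
    rw [map_mul, map_inv₀, ← hP]
    field_simp
  · exact ⟨_, (germ_algebraMap (hF w)).mul (gS.inv (by rw [hS0]; exact one_ne_zero)), by
      simp [hF0, hS0]⟩

/-! ### Regularity of coordinate ratios, and its behaviour under substitutions and under $\iota$. -/

theorem ev_X_inl (b : Fin (n + 1)) :
    ev n (MvPolynomial.X (.inl b)) = xM b.succ / xM b.castSucc := by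
  rw [eq_div_iff (xM_ne_zero _), ev_eq, xM, xM, ← map_mul]
  congr 1
  refine Subtype.ext (funext fun p => ?_)
  change (evH n (MvPolynomial.X (.inl b))).1 p * (p.1 b.castSucc : ℂ) = (p.1 b.succ : ℂ)
  rw [evH_apply, MvPolynomial.eval_X]
  exact div_mul_cancel₀ _ (Units.ne_zero _)

theorem ev_X_inr (b : Fin (n + 1)) :
    ev n (MvPolynomial.X (.inr b)) = yM b.castSucc / yM b.succ := by
  rw [eq_div_iff (yM_ne_zero _), ev_eq, yM, yM, ← map_mul]
  congr 1
  refine Subtype.ext (funext fun p => ?_)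
  change (evH n (MvPolynomial.X (.inr b))).1 p * (p.2 b.succ : ℂ) = (p.2 b.castSucc : ℂ)
  rw [evH_apply, MvPolynomial.eval_X]
  exact div_mul_cancel₀ _ (Units.ne_zero _)

theorem reg_X (s : Sig n) : Reg (ev n (MvPolynomial.X s)) 0 := by
  simpa using reg_ev (n := n) (MvPolynomial.X s)

/-- The ratio is the product of the simple root variables between $a$ and $b$; the empty product
accounts for the value $1$. In the second torus (`reg_yM_div`) the ratio is inverted, as the
asymptotic region requires. -/
theorem reg_xM_div {a b : Fin (n + 2)} (h : a ≤ b) :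
    Reg (xM b / xM a : Mer n) (if a = b then 1 else 0) := by
  induction b using Fin.induction with
  | zero =>
    obtain rfl : a = 0 := Fin.le_zero_iff.1 h
    simpa [xM_ne_zero] using reg_one
  | succ c ih =>
    rcases h.eq_or_lt with rfl | h
    · simpa [xM_ne_zero] using reg_one
    · have h1 := (ih (Fin.le_castSucc_iff.2 h)).mul (reg_X (.inl c))
      rw [ev_X_inl, mul_zero, mul_comm, div_mul_div_cancel₀ (xM_ne_zero _)] at h1
      rwa [if_neg h.ne]

theorem reg_yM_div {a b : Fin (n + 2)} (h : a ≤ b) :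
    Reg (yM a / yM b : Mer n) (if a = b then 1 else 0) := by
  induction b using Fin.induction with
  | zero =>
    obtain rfl : a = 0 := Fin.le_zero_iff.1 h
    simpa [yM_ne_zero] using reg_one
  | succ c ih =>
    rcases h.eq_or_lt with rfl | h
    · simpa [yM_ne_zero] using reg_one
    · have h1 := (ih (Fin.le_castSucc_iff.2 h)).mul (reg_X (.inr c))
      rw [ev_X_inr, mul_zero, div_mul_div_cancel₀ (yM_ne_zero _)] at h1
      rwa [if_neg h.ne]

theorem Reg.neg {r : Mer n} {c : ℂ} (h : Reg r c) : Reg (-r) (-c) := by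
  have := (reg_algebraMap (n := n) (-1)).mul h
  simpa using this

theorem Reg.sub {r s : Mer n} {c d : ℂ} (h1 : Reg r c) (h2 : Reg s d) : Reg (r - s) (c - d) := by
  rw [sub_eq_add_neg, sub_eq_add_neg]
  exact h1.add h2.neg

theorem Reg.inv {r : Mer n} {c : ℂ} (h : Reg r c) (hc : c ≠ 0) : Reg r⁻¹ c⁻¹ := by
  have hr : r ≠ 0 := by
    rintro rfl
    exact hc (h.unique reg_zero)
  obtain ⟨P, D, hP, hD, h⟩ := h
  refine ⟨MvPolynomial.C c⁻¹ * D, MvPolynomial.C c⁻¹ * P, ?_, ?_, ?_⟩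
  · rw [MvPolynomial.coeff_C_mul, hD, mul_one]
  · rw [MvPolynomial.coeff_C_mul, hP, inv_mul_cancel₀ hc]
  · rw [map_mul, map_mul, ← h]
    field_simp

theorem Reg.div {r s : Mer n} {c d : ℂ} (h1 : Reg r c) (h2 : Reg s d) (hd : d ≠ 0) :
    Reg (r / s) (c / d) := by
  rw [div_eq_mul_inv, div_eq_mul_inv]
  exact h1.mul (h2.inv hd)

theorem scales_of_act {q : Set.Ioo (0 : ℝ) 1} {φ : Bihol n} {e : Sig n → ℕ}
    (h : ∀ s, act n φ (ev n (MvPolynomial.X s)) =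
      algebraMap ℂ (Mer n) ((qC q : ℂ) ^ e s) * ev n (MvPolynomial.X s)) : Scales q φ e := by
  intro p s
  have h1 := h s
  rw [ev_eq, act_algebraMap, IsScalarTower.algebraMap_apply ℂ (Hol n) (Mer n), ← map_mul,
    (algebraMap_Hol_injective n).eq_iff] at h1
  have h2 := congrFun (congrArg Subtype.val h1) p
  change (evH n _).1 (φ.1.symm p) = (qC q : ℂ) ^ e s * (evH n _).1 p at h2
  rwa [evH_apply, evH_apply, MvPolynomial.eval_X, MvPolynomial.eval_X] at h2

/-- The operation on meromorphic functions induced by substitutions of polynomials without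
constant terms for the simple root variables preserves regularity. -/
theorem Reg.map {r : Mer n} {c : ℂ} (h : Reg r c) (φ : Bihol n)
    (g : Sig n → MvPolynomial (Sig n) ℂ) (hg : ∀ s, (g s).coeff 0 = 0)
    (hφ : ∀ s, act n φ (ev n (MvPolynomial.X s)) = ev n (g s)) : Reg (act n φ r) c := by
  have key : ∀ P, act n φ (ev n P) = ev n (MvPolynomial.aeval g P) := by
    intro P
    have : (act n φ : Mer n →ₐ[ℂ] Mer n).comp (ev n) = (ev n).comp (MvPolynomial.aeval g) := by
      refine MvPolynomial.algHom_ext fun s => ?_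
      rw [AlgHom.comp_apply, AlgHom.comp_apply, MvPolynomial.aeval_X]
      exact hφ s
    exact DFunLike.congr_fun this P
  have key0 : ∀ P : MvPolynomial (Sig n) ℂ, (MvPolynomial.aeval g P).coeff 0 = P.coeff 0 := by
    intro P
    simp only [← MvPolynomial.constantCoeff_eq]
    have : (MvPolynomial.constantCoeff : MvPolynomial (Sig n) ℂ →+* ℂ).comp
        (MvPolynomial.aeval g : MvPolynomial (Sig n) ℂ →ₐ[ℂ] _).toRingHom =
        MvPolynomial.constantCoeff := by
      refine MvPolynomial.ringHom_ext (fun a => ?_) fun s => ?_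
      · simp
      · simpa [MvPolynomial.constantCoeff_eq] using hg s
    exact DFunLike.congr_fun this P
  obtain ⟨P, D, hP, hD, h⟩ := h
  refine ⟨MvPolynomial.aeval g P, MvPolynomial.aeval g D, ?_, ?_, ?_⟩
  · rw [key0, hP]
  · rw [key0, hD]
  · rw [← key, ← key, ← h, map_mul]

theorem Reg.act {r : Mer n} {c : ℂ} (h : Reg r c) {q : Set.Ioo (0 : ℝ) 1} {φ : Bihol n}
    {e : Sig n → ℕ} (hφ : ∀ s, BqKZ.act n φ (ev n (MvPolynomial.X s)) =
      algebraMap ℂ (Mer n) ((qC q : ℂ) ^ e s) * ev n (MvPolynomial.X s)) :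
    Reg (BqKZ.act n φ r) c :=
  h.map φ (fun s => MvPolynomial.C ((qC q : ℂ) ^ e s) * MvPolynomial.X s)
    (fun s => by rw [MvPolynomial.coeff_C_mul]; simp) fun s => by
      rw [hφ, map_mul, MvPolynomial.C_eq_algebraMap, AlgHom.commutes]

/-- Evaluating $t_{i+1}/t_i$ at $(\gamma^{-1},t^{-1})$ gives $\gamma_i/\gamma_{i+1}$. So $\iota$
exchanges the two sets of root variables and fixes the asymptotic origin. -/
theorem act_iota_ev_X (s : Sig n) :
    act n iotaB (ev n (MvPolynomial.X s)) = ev n (MvPolynomial.X s.swap) := by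
  rcases s with b | b
  · rw [Sum.swap_inl, ev_X_inl, ev_X_inr, map_div₀, act_iota_xM, act_iota_xM, inv_div_inv]
  · rw [Sum.swap_inr, ev_X_inl, ev_X_inr, map_div₀, act_iota_yM, act_iota_yM, inv_div_inv]

theorem Reg.act_iota {r : Mer n} {c : ℂ} (h : Reg r c) : Reg (BqKZ.act n iotaB r) c :=
  h.map iotaB (fun s => MvPolynomial.X s.swap) (fun s => by simp) act_iota_ev_X

theorem XY_iota (p : Torus n × Torus n) (s : Sig n) :
    XY ((iotaB (n := n)).1.symm p) s = XY p s.swap := by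
  rcases s with b | b
  · change (((p.2 b.succ)⁻¹ : ℂˣ) : ℂ) / ((p.2 b.castSucc)⁻¹ : ℂˣ) = _
    simp only [Units.val_inv_eq_inv_val, inv_div_inv]
    rfl
  · change (((p.1 b.castSucc)⁻¹ : ℂˣ) : ℂ) / ((p.1 b.succ)⁻¹ : ℂˣ) = _
    simp only [Units.val_inv_eq_inv_val, inv_div_inv]
    rfl

theorem Germ.act_iota {ψ : Mer n} {f : (Sig n → ℂ) → ℂ} (h1 : Germ ψ f) :
    Germ (BqKZ.act n iotaB ψ) fun x => f (x ∘ Sum.swap) := by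
  obtain ⟨hf, a, b, hb, rfl, ε, hε, h⟩ := h1
  have e1 : ∀ p : Torus n × Torus n, XY ((iotaB (n := n)).1.symm p) = XY p ∘ Sum.swap := fun p =>
    funext fun s => XY_iota p s
  refine ⟨?_, actHol n iotaB a, actHol n iotaB b, ?_, ?_, ε, hε, fun p hp => ?_⟩
  · refine AnalyticAt.comp (f := fun x : Sig n → ℂ => x ∘ Sum.swap) hf ?_
    exact analyticAt_pi_iff.2 fun s =>
      (ContinuousLinearMap.proj (R := ℂ) (φ := fun _ => ℂ) s.swap).analyticAt _
  · rwa [Ne, EmbeddingLike.map_eq_zero_iff]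
  · rw [map_div₀, act_algebraMap, act_algebraMap]
  · have := h ((iotaB (n := n)).1.symm p) (by
      rw [e1, pi_norm_lt_iff hε]
      exact fun s => (norm_le_pi_norm (XY p) _).trans_lt hp)
    rw [e1] at this
    exact this

/-! ### Explicit form of $\tau(\omega_l,e)$. -/

/-- The coefficient `(1 - z / a) / (k - k⁻¹ z / a)`. -/
def cZ (k : ℂˣ) (a z : Mer n) : Mer n :=
  (1 - z / a) / (algebraMap ℂ (Mer n) k - algebraMap ℂ (Mer n) (k : ℂ)⁻¹ * (z / a))

/-- Here $z/a=q^{-1}x_a/x_b$ is the inverse of $r=q\,x_b/x_a$, which vanishes at the origin.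
Multiplying numerator and denominator by $r$ gives $-(1-r)/(kr-k^{-1})$, with value $k$. -/
theorem reg_cZ (q : Set.Ioo (0 : ℝ) 1) (k : ℂˣ) {a b : Fin (n + 2)} (h : a < b) :
    Reg (cZ k (xM b) (algebraMap ℂ (Mer n) (qC q : ℂ)⁻¹ * xM a)) k := by
  have h1 := (reg_algebraMap (n := n) (qC q : ℂ)).mul (reg_xM_div h.le)
  rw [if_neg h.ne, mul_zero] at h1
  have h2 := (reg_one.sub h1).div
    (((reg_algebraMap (n := n) (k : ℂ)).mul h1).sub (reg_algebraMap (k : ℂ)⁻¹)) (by simp)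
  have h3 := h2.neg
  have hk : -((1 - 0) / ((k : ℂ) * 0 - (k : ℂ)⁻¹)) = k := by simp
  rw [hk] at h3
  convert h3 using 1
  have hx := xM_ne_zero (n := n) a
  have hy := xM_ne_zero (n := n) b
  have hq : algebraMap ℂ (Mer n) (qC q : ℂ) ≠ 0 := by simp
  rw [cZ, ← neg_div, map_inv₀]
  generalize algebraMap ℂ (Mer n) (qC q : ℂ) = Q at *
  have e : Q⁻¹ * xM a / xM b = (Q * (xM b / xM a))⁻¹ := by field_simp
  have hr : Q * (xM b / xM a) ≠ 0 := by
    exact mul_ne_zero hq (div_ne_zero hy hx)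
  rw [e]
  generalize Q * (xM b / xM a) = r at *
  rw [← mul_div_mul_left (1 - r⁻¹) _ hr]
  congr 1
  · field_simp
    ring
  · field_simp

/-- The index `n - l`, counted from the right. -/
def idxR (n l : ℕ) : Fin (n + 1) := ⟨n - l, by omega⟩

theorem tauL_sW (q : Set.Ioo (0 : ℝ) 1) (k : ℂˣ) {l : ℕ} (hl : l ≤ n) :
    tauL n q k (sW (n + 1 - l)) = tauS k (idxR n l) := by
  have e : Fin.ofNat (n + 2) (n + 1 - l) = (idxR n l).succ := by
    ext
    simp only [Fin.val_ofNat, idxR, Fin.val_succ]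
    rw [Nat.mod_eq_of_lt (by omega)]
    omega
  rw [sW, e, tauL, PresentedGroup.toGroup.of, tauGen_succ]

/-- The product of the factors `1 + c (T_i - k)` for `i = N - 1, …, N - l`. -/
def opV (k : ℂˣ) (z : Mer n) : ℕ → Module.End (Mer n) (H0K n)
  | 0 => 1
  | l + 1 => opV k z l * (1 + cZ k (xM (idxR n l).succ) z • heckeA k (idxR n l))

/-- The cycle `s_{N-1} ⋯ s_{N-l}`. -/
def cyc (n : ℕ) : ℕ → Equiv.Perm (Fin (n + 2))
  | 0 => 1
  | l + 1 => cyc n l * si (idxR n l)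

theorem val_cyc {l : ℕ} (hl : l ≤ n + 1) (j : Fin (n + 2)) : (cyc n l j).val =
    if j.val + l < n + 1 then j.val else if j.val + l = n + 1 then n + 1 else j.val - 1 := by
  induction l generalizing j with
  | zero =>
    have := j.isLt
    simp only [cyc, Equiv.Perm.one_apply]
    split_ifs <;> omega
  | succ l ih =>
    have := j.isLt
    have e : (si (idxR n l) j).val =
        if j.val = n - l then n - l + 1 else if j.val = n - l + 1 then n - l else j.val := by
      rw [si, Equiv.swap_apply_def]
      simp only [Fin.ext_iff, idxR, Fin.val_castSucc, Fin.val_succ]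
      split_ifs <;> rfl
    rw [cyc, Equiv.Perm.mul_apply, ih (by omega), e]
    split_ifs <;> omega

/-- The cycle `s_1 ⋯ s_{N-1-l}` of the first `N - l` indices. -/
def rotL (n l : ℕ) : Equiv.Perm (Fin (n + 2)) := rot n * cyc n l

theorem val_rot (j : Fin (n + 2)) : (rot n j).val = if j.val = n + 1 then 0 else j.val + 1 := by
  have := j.isLt
  induction j using Fin.lastCases with
  | last => simp [rot_last]
  | cast j =>
    rw [rot_castSucc, if_neg (by simpa using j.isLt.ne)]
    rfl

theorem val_rotL {l : ℕ} (hl : l ≤ n + 1) (j : Fin (n + 2)) : (rotL n l j).val =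
    if j.val + l < n + 1 then j.val + 1 else if j.val + l = n + 1 then 0 else j.val := by
  have := j.isLt
  rw [rotL, Equiv.Perm.mul_apply, val_rot, val_cyc hl]
  split_ifs <;> omega

theorem rotL_apply_of_lt {l : ℕ} (hl : l ≤ n + 1) {j : Fin (n + 2)} (h : n + 1 < j.val + l) :
    rotL n l j = j := by
  ext
  rw [val_rotL hl, if_neg (by omega), if_neg (by omega)]

theorem rotL_pow_apply_of_lt {l : ℕ} (hl : l ≤ n + 1) {j : Fin (n + 2)} (h : n + 1 < j.val + l)
    (m : ℕ) : (rotL n l ^ m) j = j := by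
  induction m with
  | zero => rfl
  | succ m ih => rw [pow_succ, Equiv.Perm.mul_apply, rotL_apply_of_lt hl h, ih]

theorem val_rotL_pow_apply {l : ℕ} (hl : l ≤ n + 1) {j : Fin (n + 2)} (h : j.val + l ≤ n + 1)
    (m : ℕ) : ((rotL n l ^ m) j).val = (j.val + m) % (n + 2 - l) := by
  induction m with
  | zero => rw [add_zero, Nat.mod_eq_of_lt (by omega)]; rfl
  | succ m ih =>
    have hlt : (j.val + m) % (n + 2 - l) < n + 2 - l := Nat.mod_lt _ (by omega)
    rw [pow_succ', Equiv.Perm.mul_apply, val_rotL hl, ih, ← add_assoc, Nat.add_mod _ 1]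
    rcases (show (j.val + m) % (n + 2 - l) + 1 < n + 2 - l ∨
      (j.val + m) % (n + 2 - l) + 1 = n + 2 - l by omega) with h1 | h1
    · rw [if_pos (by omega), Nat.mod_eq_of_lt (a := 1) (by omega), Nat.mod_eq_of_lt h1]
    · rw [if_neg (by omega), if_pos (by omega), ← Nat.add_mod, ← Nat.mod_add_mod, h1,
        Nat.mod_self]

theorem rotL_pow {l : ℕ} (hl : l ≤ n + 1) : rotL n l ^ (n + 2 - l) = 1 := by
  ext j
  rcases Nat.lt_or_ge (n + 1) (j.val + l) with h | h
  · rw [rotL_pow_apply_of_lt hl h]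
    rfl
  · rw [val_rotL_pow_apply hl h, Nat.add_mod_right, Nat.mod_eq_of_lt (by omega)]
    rfl

/-- The point `q⁻¹ x_j`. -/
def zM (q : Set.Ioo (0 : ℝ) 1) (j : ℕ) : Mer n :=
  algebraMap ℂ (Mer n) (qC q : ℂ)⁻¹ * xM (Fin.ofNat (n + 2) j)

/-- The action of the finite part of `g_l` on the coefficients. -/
def bB (q : Set.Ioo (0 : ℝ) 1) (l : ℕ) : Bihol n := piB q * permB (cyc n l)

theorem act_bB_yM (q : Set.Ioo (0 : ℝ) 1) (l : ℕ) (j : Fin (n + 2)) :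
    act n (bB q l) (yM j) = yM j := by
  rw [bB, map_mul, AlgEquiv.mul_apply, act_perm_yM, act_pi_yM]

theorem act_bB_pow_yM (q : Set.Ioo (0 : ℝ) 1) (l m : ℕ) (j : Fin (n + 2)) :
    act n (bB q l ^ m) (yM j) = yM j := by
  induction m with
  | zero => rw [pow_zero, map_one]; rfl
  | succ m ih => rw [pow_succ, map_mul, AlgEquiv.mul_apply, act_bB_yM, ih]

theorem act_bB_xM (q : Set.Ioo (0 : ℝ) 1) {l : ℕ} (hl : l ≤ n + 1) (j : Fin (n + 2)) :
    act n (bB q l) (xM j) = algebraMap ℂ (Mer n) (if j.val + l = n + 1 then (qC q : ℂ)⁻¹ else 1) *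
      xM (rotL n l j) := by
  have e : cyc n l j = Fin.last (n + 1) ↔ j.val + l = n + 1 := by
    have := j.isLt
    rw [Fin.ext_iff, val_cyc hl, Fin.val_last]
    split_ifs <;> omega
  rw [bB, map_mul, AlgEquiv.mul_apply, act_perm_xM, act_pi_xM, if_congr e rfl rfl]
  rfl

theorem act_bB_xM_of_lt (q : Set.Ioo (0 : ℝ) 1) {l : ℕ} (hl : l ≤ n + 1) {j : Fin (n + 2)}
    (h : n + 1 < j.val + l) : act n (bB q l) (xM j) = xM j := by
  rw [act_bB_xM q hl, rotL_apply_of_lt hl h, if_neg (by omega), map_one, one_mul]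

theorem act_bB_pow_xM_of_lt (q : Set.Ioo (0 : ℝ) 1) {l : ℕ} (hl : l ≤ n + 1) {j : Fin (n + 2)}
    (h : n + 1 < j.val + l) (m : ℕ) : act n (bB q l ^ m) (xM j) = xM j := by
  induction m with
  | zero => rw [pow_zero, map_one]; rfl
  | succ m ih => rw [pow_succ, map_mul, AlgEquiv.mul_apply, act_bB_xM_of_lt q hl h, ih]

theorem act_bB_pow_xM_zero (q : Set.Ioo (0 : ℝ) 1) {l : ℕ} (hl : l ≤ n + 1) {m : ℕ} {j : ℕ}
    (hm : j + m + l ≤ n + 1) :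
    act n (bB q l ^ m) (xM (Fin.ofNat (n + 2) j)) = xM (Fin.ofNat (n + 2) (j + m)) := by
  induction m with
  | zero => rw [pow_zero, map_one]; rfl
  | succ m ih =>
    have hv : (Fin.ofNat (n + 2) (j + m)).val = j + m := Nat.mod_eq_of_lt (by omega)
    rw [pow_succ', map_mul, AlgEquiv.mul_apply, ih (by omega), act_bB_xM q hl, hv,
      if_neg (by omega), map_one, one_mul]
    congr 1
    ext
    rw [val_rotL hl, hv, if_pos (by omega)]
    exact (Nat.mod_eq_of_lt (by omega)).symm

/-- The rescaling of the coordinates by `ω_l`. -/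
theorem act_bB_pow_xM (q : Set.Ioo (0 : ℝ) 1) {l : ℕ} (hl : l ≤ n + 1) (j : Fin (n + 2)) :
    act n (bB q l ^ (n + 2 - l)) (xM j) =
      algebraMap ℂ (Mer n) (if j.val + l ≤ n + 1 then (qC q : ℂ)⁻¹ else 1) * xM j := by
  rcases Nat.lt_or_ge (n + 1) (j.val + l) with h | h
  · rw [act_bB_pow_xM_of_lt q hl h, if_neg (by omega), map_one, one_mul]
  · have hj : Fin.ofNat (n + 2) j.val = j := ofNat_val_eq j
    have e : n + 2 - l = (j.val + 1) + (n + 1 - l - j.val) := by omega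
    have h1 := act_bB_pow_xM_zero q hl (j := j.val) (m := n + 1 - l - j.val) (by omega)
    rw [hj] at h1
    have h2 : (Fin.ofNat (n + 2) (j.val + (n + 1 - l - j.val))).val = n + 1 - l := by
      rw [Fin.val_ofNat, Nat.mod_eq_of_lt (by omega)]
      omega
    have h3 : rotL n l (Fin.ofNat (n + 2) (j.val + (n + 1 - l - j.val))) = Fin.ofNat (n + 2) 0 := by
      ext
      rw [val_rotL hl, h2, if_neg (by omega), if_pos (by omega)]
      rfl
    have h4 := act_bB_pow_xM_zero q hl (j := 0) (m := j.val) (by omega)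
    rw [zero_add, hj] at h4
    rw [if_pos h, e, pow_add, pow_succ, map_mul, map_mul, AlgEquiv.mul_apply, AlgEquiv.mul_apply,
      h1, act_bB_xM q hl, h2, if_pos (by omega), h3, map_mul, AlgEquiv.commutes, h4]

theorem coefAct_etaPi {φ : Bihol n} (h : ∀ j, act n φ (yM j) = yM j) (f : H0K n) :
    coefAct φ (etaPi f) = etaPi (coefAct φ f) := by
  funext w
  simp only [etaPi_apply, coefAct_apply, map_mul, h]

theorem coefAct_opV {φ : Bihol n} (k : ℂˣ) (z : Mer n) (l : ℕ)
    (h : ∀ m < l, act n φ (xM (idxR n m).succ) = xM (idxR n m).succ) (f : H0K n) :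
    coefAct φ (opV k z l f) = opV k (act n φ z) l (coefAct φ f) := by
  induction l generalizing f with
  | zero => rfl
  | succ l ih =>
    have hc : act n φ (cZ k (xM (idxR n l).succ) z) = cZ k (xM (idxR n l).succ) (act n φ z) := by
      simp only [cZ, map_div₀, map_sub, map_mul, map_one, AlgEquiv.commutes, h l l.lt_succ_self]
    rw [opV, Module.End.mul_apply, ih fun m hm => h m (hm.trans l.lt_succ_self), coefAct_one_add,
      hc]
    rfl

/-- By induction on $l$: before the next reflection acts, the substitution $b_l$ has turned its two
coordinates into $x_{N-l}$ and $q^{-1}x_1$. All factors therefore share the argument $q^{-1}x_1$. -/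
theorem tauL_gW (q : Set.Ioo (0 : ℝ) 1) (k : ℂˣ) {l : ℕ} (hl : l ≤ n + 1) (f : H0K n) :
    tauL n q k (gW l) f = etaPi (opV k (zM q 0) l (coefAct (bB q l) f)) := by
  induction l generalizing f with
  | zero =>
    have h : tauL n q k piW = tauPi q := by
      rw [piW, tauL, PresentedGroup.toGroup.of, tauGen_pi]
    have h' : (gW 0 : W n) = piW := mul_one _
    rw [h', h, tauPi_apply]
    rfl
  | succ l ih =>
    have hv : (idxR n l).val = n - l := rfl
    have hx1 : act n (bB q l) (xM (idxR n l).succ) = zM q 0 := by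
      rw [act_bB_xM q (by omega), if_pos (by rw [Fin.val_succ, hv]; omega), zM]
      congr 2
      ext
      rw [val_rotL (by omega), Fin.val_succ, hv, if_neg (by omega), if_pos (by omega)]
      rfl
    have hx2 : act n (bB q l) (xM (idxR n l).castSucc) = xM (idxR n l).succ := by
      rw [act_bB_xM q (by omega), if_neg (by rw [Fin.val_castSucc, hv]; omega), map_one, one_mul]
      congr 2
      ext
      rw [val_rotL (by omega), Fin.val_succ, Fin.val_castSucc, hv, if_pos (by omega)]
    have hc : act n (bB q l) (cM k (idxR n l).castSucc (idxR n l).succ) =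
        cZ k (xM (idxR n l).succ) (zM q 0) := by
      simp only [cM, cZ, map_div₀, map_sub, map_mul, map_one, AlgEquiv.commutes, hx1, hx2]
    have hb : (bB q l * permB (si (idxR n l)) : Bihol n) = bB q (l + 1) := by
      rw [bB, mul_assoc, ← permB_mul]
      rfl
    rw [gW_succ, map_mul, LinearEquiv.mul_apply, ih (by omega), tauL_sW q k (by omega),
      tauS_apply, tauSFun_eq, coefAct_one_add, hc, coefAct_coefAct, hb]
    rfl

/-- The composition of the operators `η(π) V_l(z_j)` for `j = 0, …, m - 1`. -/
def opL (q : Set.Ioo (0 : ℝ) 1) (k : ℂˣ) (l : ℕ) : ℕ → H0K n → H0K n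
  | 0 => id
  | m + 1 => fun f => opL q k l m (etaPi (opV k (zM q m) l f))

/-- Collecting the substitutions on the right moves $b_l^m$ past $V_l$. It fixes $\gamma$ and the
last $l$ coordinates $x_i$, and only carries $q^{-1}x_1$ to $q^{-1}x_{m+1}$. -/
theorem tauL_gW_pow (q : Set.Ioo (0 : ℝ) 1) (k : ℂˣ) {l m : ℕ} (hl : l ≤ n + 1)
    (hm : m + l ≤ n + 2) (f : H0K n) :
    tauL n q k (gW l ^ m) f = opL q k l m (coefAct (bB q l ^ m) f) := by
  induction m generalizing f with
  | zero =>
    rw [pow_zero, pow_zero, map_one]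
    funext w
    change f w = act n 1 (f w)
    rw [map_one]
    rfl
  | succ m ih =>
    have hz : act n (bB q l ^ m) (zM q 0) = zM q m := by
      rw [zM, map_mul, AlgEquiv.commutes, act_bB_pow_xM_zero q hl (by omega), zero_add]
      rfl
    have hv : ∀ p < l, act n (bB q l ^ m) (xM (idxR n p).succ) = xM (idxR n p).succ := by
      intro p hp
      refine act_bB_pow_xM_of_lt q hl ?_ m
      change n + 1 < n - p + 1 + l
      omega
    rw [pow_succ, map_mul, LinearEquiv.mul_apply, ih (by omega), tauL_gW q k hl,
      coefAct_etaPi (act_bB_pow_yM q l m), coefAct_opV k _ l hv, hz, coefAct_coefAct, ← pow_succ]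
    rfl

/-! ### The limit of $\tau(\omega_l,e)$ at the origin, up to monomials in $\gamma$. -/

/-- The product `∏_{j < m} γ_{w⁻¹(j)}`. -/
def yP (m : ℕ) (w : Equiv.Perm (Fin (n + 2))) : Mer n :=
  ∏ j ∈ Finset.range m, yM (w⁻¹ (Fin.ofNat (n + 2) j))

theorem yP_ne_zero (m : ℕ) (w : Equiv.Perm (Fin (n + 2))) : yP m w ≠ 0 :=
  Finset.prod_ne_zero_iff.2 fun _ _ => yM_ne_zero _

theorem yP_succ (m : ℕ) (v : Equiv.Perm (Fin (n + 2))) :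
    yP (m + 1) v = yM (v⁻¹ 0) * yP m ((rot n)⁻¹ * v) := by
  rw [yP, Finset.prod_range_succ', mul_comm, yP]
  congr 1
  refine Finset.prod_congr rfl fun j _ => ?_
  rw [mul_inv_rev, inv_inv, Equiv.Perm.mul_apply, rot, finRotate_apply, ofNat_succ_eq]

/-- The reflection moves only positions from $a$ on, while the monomial involves positions below
$m$. Hence the factors of $V_l$, which act on the last $l+1$ positions, respect the normalisation in
`RegM`. -/
theorem yP_si {m : ℕ} {a : Fin (n + 1)} (h : m ≤ a) (w : Equiv.Perm (Fin (n + 2))) :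
    yP m (si a * w) = yP m w := by
  refine Finset.prod_congr rfl fun j hj => ?_
  have hj' := Finset.mem_range.1 hj
  have hv : (Fin.ofNat (n + 2) j).val = j := Nat.mod_eq_of_lt (by have := a.isLt; omega)
  rw [mul_inv_rev, Equiv.Perm.mul_apply, Equiv.swap_inv, Equiv.swap_apply_of_ne_of_ne]
  · rw [Ne, Fin.ext_iff, hv, Fin.val_castSucc]
    omega
  · rw [Ne, Fin.ext_iff, hv, Fin.val_succ]
    omega

/-- `f` is regular at the origin up to the factors `∏_{j < m} γ_{w⁻¹(j)}`. -/
def RegM (m : ℕ) (f : H0K n) (c : Equiv.Perm (Fin (n + 2)) → ℂ) : Prop :=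
  ∀ w, Reg (f w / yP m w) (c w)

/-- The operator `1 + k (T_i - k)` on the Hecke algebra. -/
def opA (k : ℂˣ) (a : Fin (n + 1)) : Module.End ℂ (Equiv.Perm (Fin (n + 2)) → ℂ) where
  toFun c w := k * c (si a * w) + (if w⁻¹ a.succ < w⁻¹ a.castSucc then 0 else 1 - (k : ℂ) ^ 2) * c w
  map_add' c d := funext fun w => by
    simp only [Pi.add_apply]
    ring
  map_smul' r c := funext fun w => by
    simp only [Pi.smul_apply, smul_eq_mul, RingHom.id_apply]
    ring

theorem opA_apply (k : ℂˣ) (a : Fin (n + 1)) (c : Equiv.Perm (Fin (n + 2)) → ℂ)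
    (w : Equiv.Perm (Fin (n + 2))) : opA k a c w =
      k * c (si a * w) + (if w⁻¹ a.succ < w⁻¹ a.castSucc then 0 else 1 - (k : ℂ) ^ 2) * c w := rfl

/-- With $r$ replaced by its value $k$ the operator becomes $1+k(T_a-k)$, which equals $kT_a^{-1}$
by the quadratic relation. -/
theorem RegM.opA {m : ℕ} {f : H0K n} {c : Equiv.Perm (Fin (n + 2)) → ℂ} (h : RegM m f c)
    (k : ℂˣ) {a : Fin (n + 1)} (hm : m ≤ a) {r : Mer n} (hr : Reg r k) :
    RegM m ((1 + r • heckeA k a : Module.End (Mer n) (H0K n)) f) (opA k a c) := by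
  intro w
  have h1 := h (si a * w)
  rw [yP_si hm] at h1
  have hk := k.ne_zero
  have e : (1 + r • heckeA k a : Module.End (Mer n) (H0K n)) f w / yP m w = f w / yP m w +
      r * (f (si a * w) / yP m w + (algebraMap ℂ (Mer n)
        (if w⁻¹ a.succ < w⁻¹ a.castSucc then -(k : ℂ)⁻¹ else -(k : ℂ))) * (f w / yP m w)) := by
    rw [LinearMap.add_apply, LinearMap.smul_apply, Module.End.one_apply, Pi.add_apply,
      Pi.smul_apply, smul_eq_mul, heckeA_apply, apply_ite (algebraMap ℂ (Mer n))]
    ring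
  rw [e]
  convert (h w).add (hr.mul (h1.add ((reg_algebraMap _).mul (h w)))) using 1
  rw [opA_apply]
  split_ifs
  · field_simp
    ring
  · ring

/-- The limit of the operators `V_l(z)` at the origin. -/
def valV (k : ℂˣ) : ℕ → Module.End ℂ (Equiv.Perm (Fin (n + 2)) → ℂ)
  | 0 => 1
  | l + 1 => valV k l * opA k (idxR n l)

/-- The bound on $m$ keeps the reflections away from the monomial. The bound on $j$ places $x_j$
before the coordinates it is compared with, so that `reg_cZ` gives the limit $k$ for every
coefficient. -/
theorem RegM.opV {m : ℕ} {f : H0K n} {c : Equiv.Perm (Fin (n + 2)) → ℂ} (h : RegM m f c)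
    (q : Set.Ioo (0 : ℝ) 1) (k : ℂˣ) {j l : ℕ} (hm : m + l ≤ n + 1) (hj : j + l ≤ n + 1) :
    RegM m (BqKZ.opV k (zM q j) l f) (valV k l c) := by
  induction l generalizing f c with
  | zero => exact h
  | succ l ih =>
    have hv : (idxR n l).val = n - l := rfl
    refine ih (h.opA k (by omega) (reg_cZ q k ?_)) (by omega) (by omega)
    rw [Fin.lt_def, Fin.val_succ, hv, Fin.val_ofNat, Nat.mod_eq_of_lt (by omega)]
    omega

/-- The left multiplication by `σ`. -/
def valP : Module.End ℂ (Equiv.Perm (Fin (n + 2)) → ℂ) where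
  toFun c v := c ((rot n)⁻¹ * v)
  map_add' _ _ := rfl
  map_smul' _ _ := rfl

theorem RegM.etaPi {m : ℕ} {f : H0K n} {c : Equiv.Perm (Fin (n + 2)) → ℂ} (h : RegM m f c) :
    RegM (m + 1) (etaPi f) (valP c) := by
  intro v
  rw [etaPi_apply, yP_succ, mul_div_mul_left _ _ (yM_ne_zero _)]
  exact h _

/-- The limit at the origin of the `m`-th power of `τ(g_l)`. -/
def valQ (k : ℂˣ) (l m : ℕ) : Module.End ℂ (Equiv.Perm (Fin (n + 2)) → ℂ) :=
  (valP * valV k l) ^ m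

theorem valQ_succ (k : ℂˣ) (l m : ℕ) :
    (valQ k l (m + 1) : Module.End ℂ (Equiv.Perm (Fin (n + 2)) → ℂ)) =
      valQ k l m * (valP * valV k l) := pow_succ _ _

theorem valQ_succ' (k : ℂˣ) (l m : ℕ) :
    (valQ k l (m + 1) : Module.End ℂ (Equiv.Perm (Fin (n + 2)) → ℂ)) =
      valP * valV k l * valQ k l m := pow_succ' _ _

theorem RegM.opL {p : ℕ} {f : H0K n} {c : Equiv.Perm (Fin (n + 2)) → ℂ} (h : RegM p f c)
    (q : Set.Ioo (0 : ℝ) 1) (k : ℂˣ) {m l : ℕ} (hm : p + m + l ≤ n + 2) :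
    RegM (p + m) (BqKZ.opL q k l m f) (valQ k l m c) := by
  induction m generalizing p f c with
  | zero => exact h
  | succ m ih =>
    have := ih ((h.opV q k (j := m) (l := l) (by omega) (by omega)).etaPi) (by omega)
    rw [valQ_succ, show p + (m + 1) = p + 1 + m by omega]
    exact this

theorem regM_zero {f : H0K n} {c : Equiv.Perm (Fin (n + 2)) → ℂ} (h : RegV f c) : RegM 0 f c := by
  intro w
  rw [yP, Finset.range_zero, Finset.prod_empty, div_one]
  exact h w

/-- The exponents of the rescaling of the simple root variables by `ω_l`. -/
def expL (n l : ℕ) : Sig n → ℕ := Sum.elim (fun b => if b.val + l = n + 1 then 1 else 0) fun _ => 0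

theorem act_bB_pow_ev_X (q : Set.Ioo (0 : ℝ) 1) {l : ℕ} (hl : l ≤ n + 1) (s : Sig n) :
    act n (bB q l ^ (n + 2 - l)) (ev n (MvPolynomial.X s)) =
      algebraMap ℂ (Mer n) ((qC q : ℂ) ^ expL n l s) * ev n (MvPolynomial.X s) := by
  rcases s with b | b
  · rw [ev_X_inl, map_div₀, act_bB_pow_xM q hl, act_bB_pow_xM q hl, Fin.val_succ, Fin.val_castSucc,
      expL, Sum.elim_inl]
    have hq : algebraMap ℂ (Mer n) (qC q : ℂ) ≠ 0 := by simp
    have := xM_ne_zero (n := n) b.castSucc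
    rcases lt_trichotomy (b.val + l) (n + 1) with h | h | h
    · rw [if_pos (by omega), if_pos (by omega), if_neg (by omega), pow_zero, map_one, map_inv₀]
      field_simp
    · rw [if_neg (by omega), if_pos (by omega), if_pos (by omega), pow_one, map_one, map_inv₀]
      field_simp
    · rw [if_neg (by omega), if_neg (by omega), if_neg (by omega), pow_zero, map_one]
      field_simp
  · rw [ev_X_inr, map_div₀, act_bB_pow_yM, act_bB_pow_yM]
    simp [expL]

theorem regM_tauL_omW (q : Set.Ioo (0 : ℝ) 1) (k : ℂˣ) {l : ℕ} (hl : l ≤ n + 1) {f : H0K n}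
    {c : Equiv.Perm (Fin (n + 2)) → ℂ} (h : RegV f c) :
    RegM (n + 2 - l) (tauL n q k (omW l) f) (valQ k l (n + 2 - l) c) := by
  rw [omW, tauL_gW_pow q k hl (by omega)]
  have h1 : RegV (coefAct (bB q l ^ (n + 2 - l)) f) c := fun w =>
    (h w).act (act_bB_pow_ev_X q hl)
  have := (regM_zero h1).opL q k (m := n + 2 - l) (l := l) (by omega)
  rwa [zero_add] at this

/-- The hypothesis says that $s_a$ shortens $w$, in which case $T_a^{-1}T_w=T_{s_aw}$. -/
theorem opA_single (k : ℂˣ) {a : Fin (n + 1)} {w : Equiv.Perm (Fin (n + 2))}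
    (h : w⁻¹ a.succ < w⁻¹ a.castSucc) :
    opA k a (Pi.single w 1) = (k : ℂ) • Pi.single (si a * w) 1 := by
  funext v
  rw [opA_apply, Pi.smul_apply, smul_eq_mul]
  have e : si a * v = w ↔ v = si a * w := by
    constructor
    · rintro rfl
      rw [← mul_assoc, Equiv.swap_mul_self, one_mul]
    · rintro rfl
      rw [← mul_assoc, Equiv.swap_mul_self, one_mul]
  have h2 : (if v⁻¹ a.succ < v⁻¹ a.castSucc then 0 else 1 - (k : ℂ) ^ 2) *
      (Pi.single w 1 : Equiv.Perm (Fin (n + 2)) → ℂ) v = 0 := by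
    by_cases hv : v = w
    · rw [hv, if_pos h, zero_mul]
    · rw [Pi.single_eq_of_ne hv, mul_zero]
  rw [h2, add_zero]
  simp only [Pi.single_apply, e]

/-- The hypothesis says that $w^{-1}$ is larger at position $N-l$ than at every later position. As
this entry is moved to the end, each of the $l$ reflections shortens the permutation, so
`opA_single` applies every time. -/
theorem valV_single (k : ℂˣ) {l : ℕ} (hl : l ≤ n + 1) {w : Equiv.Perm (Fin (n + 2))}
    (h : ∀ b c : Fin (n + 2), c.val + l = n + 1 → n + 1 < b.val + l → w⁻¹ b < w⁻¹ c) :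
    valV k l (Pi.single w 1) = (k : ℂ) ^ l • Pi.single (cyc n l * w) 1 := by
  induction l generalizing w with
  | zero =>
    rw [pow_zero, one_smul]
    rfl
  | succ l ih =>
    have hv : (idxR n l).val = n - l := rfl
    have h1 := h (idxR n l).succ (idxR n l).castSucc (by rw [Fin.val_castSucc]; omega)
      (by rw [Fin.val_succ]; omega)
    rw [valV, Module.End.mul_apply, opA_single k h1, map_smul, ih (by omega), smul_smul, pow_succ',
      cyc, mul_assoc]
    intro b c hc hb
    have hc' : c = (idxR n l).succ := by
      ext
      rw [Fin.val_succ]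
      omega
    rw [mul_inv_rev, Equiv.swap_inv, Equiv.Perm.mul_apply, Equiv.Perm.mul_apply, hc',
      Equiv.swap_apply_right, Equiv.swap_apply_of_ne_of_ne]
    · exact h _ _ (by rw [Fin.val_castSucc]; omega) (by omega)
    · rw [Ne, Fin.ext_iff, Fin.val_castSucc]
      omega
    · rw [Ne, Fin.ext_iff, Fin.val_succ]
      omega

theorem valP_single (w : Equiv.Perm (Fin (n + 2))) :
    valP (Pi.single w 1) = Pi.single (rot n * w) 1 := by
  funext v
  change (Pi.single w 1 : Equiv.Perm (Fin (n + 2)) → ℂ) ((rot n)⁻¹ * v) = _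
  simp only [Pi.single_apply, inv_mul_eq_iff_eq_mul]

/-- For $w_0$ the values of $w^{-1}$ at the last $l$ positions lie below all values at the first
$N-l$. The cycle `rotL` permutes only the first $N-l$ positions, so this persists and `valV_single`
applies at every step. -/
theorem valQ_single (k : ℂˣ) {l : ℕ} (hl : l ≤ n + 1) (m : ℕ) :
    valQ k l m (Pi.single Fin.revPerm 1 : Equiv.Perm (Fin (n + 2)) → ℂ) =
      (k : ℂ) ^ (l * m) • Pi.single (rotL n l ^ m * Fin.revPerm) 1 := by
  induction m with
  | zero => rw [mul_zero, pow_zero, one_smul, pow_zero, one_mul]; rfl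
  | succ m ih =>
    rw [valQ_succ', Module.End.mul_apply, ih, map_smul, Module.End.mul_apply, valV_single k hl,
      map_smul, valP_single, smul_smul, ← pow_add, ← mul_assoc, pow_succ', ← mul_assoc, rotL,
      mul_add_one, mul_assoc]
    intro b c hc hb
    have hb' : (rotL n l ^ m)⁻¹ b = b := by
      rw [Equiv.Perm.inv_eq_iff_eq, rotL_pow_apply_of_lt hl hb]
    have hc' : ((rotL n l ^ m)⁻¹ c).val + l ≤ n + 1 := by
      by_contra! h
      have h1 : c = (rotL n l ^ m)⁻¹ c :=
        ((rotL n l ^ m).apply_symm_apply c).symm.trans (rotL_pow_apply_of_lt hl h m)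
      rw [← h1] at h
      omega
    rw [mul_inv_rev, Equiv.Perm.mul_apply, Equiv.Perm.mul_apply, hb']
    change Fin.rev _ < Fin.rev _
    rw [Fin.rev_lt_rev, Fin.lt_def]
    omega

theorem valQ_single_self (k : ℂˣ) {l : ℕ} (hl : l ≤ n + 1) :
    valQ k l (n + 2 - l) (Pi.single Fin.revPerm 1 : Equiv.Perm (Fin (n + 2)) → ℂ) =
      (k : ℂ) ^ (l * (n + 2 - l)) • Pi.single Fin.revPerm 1 := by
  rw [valQ_single k hl, rotL_pow hl, one_mul]

/-! ### Dominance of the monomial at $w_0$. -/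

/-- The quotient of `∏_{j < m} γ_{w⁻¹(j)}` by the dominant monomial is regular. -/
theorem reg_yP_div (w : Equiv.Perm (Fin (n + 2))) {l : ℕ} (hl : l ≤ n + 1) :
    Reg (yP (n + 2 - l) w / yP (n + 2 - l) Fin.revPerm : Mer n)
      (if ∀ j : Fin (n + 2), j.val + l ≤ n + 1 → l ≤ (w⁻¹ j).val then 1 else 0) := by
  classical
  have himg : ∀ v : Equiv.Perm (Fin (n + 2)), (yP (n + 2 - l) v : Mer n) =
      ∏ b ∈ (Finset.univ.filter fun j : Fin (n + 2) => j.val + l ≤ n + 1).image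
        (fun j => v⁻¹ j), yM b := by
    intro v
    rw [Finset.prod_image fun a _ b _ h => v⁻¹.injective h, yP]
    refine Finset.prod_bij' (fun j _ => Fin.ofNat (n + 2) j) (fun j _ => j.val) ?_ ?_ ?_ ?_ ?_
    · intro j hj
      have := Finset.mem_range.1 hj
      rw [Finset.mem_filter, Fin.val_ofNat, Nat.mod_eq_of_lt (by omega)]
      exact ⟨Finset.mem_univ _, by omega⟩
    · intro j hj
      have := (Finset.mem_filter.1 hj).2
      rw [Finset.mem_range]
      omega
    · intro j hj
      have := Finset.mem_range.1 hj
      exact Nat.mod_eq_of_lt (by omega)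
    · intro j _
      exact ofNat_val_eq j
    · intro j _
      rfl
  have hcard : ∀ v : Equiv.Perm (Fin (n + 2)),
      ((Finset.univ.filter fun j : Fin (n + 2) => j.val + l ≤ n + 1).image fun j => v⁻¹ j).card =
        (Finset.univ.filter fun j : Fin (n + 2) => j.val + l ≤ n + 1).card := fun v =>
    Finset.card_image_of_injective _ v⁻¹.injective
  have hmem : ∀ b : Fin (n + 2), b ∈ ((Finset.univ.filter fun j : Fin (n + 2) =>
      j.val + l ≤ n + 1).image fun j => (Fin.revPerm : Equiv.Perm (Fin (n + 2)))⁻¹ j) ↔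
      l ≤ b.val := by
    intro b
    rw [Finset.mem_image]
    constructor
    · rintro ⟨j, hj, rfl⟩
      have := (Finset.mem_filter.1 hj).2
      change l ≤ (Fin.rev j).val
      rw [Fin.val_rev]
      omega
    · intro h
      refine ⟨b.rev, Finset.mem_filter.2 ⟨Finset.mem_univ _, ?_⟩, Fin.rev_rev b⟩
      rw [Fin.val_rev]
      omega
  rw [himg, himg]
  have hc2 := (hcard w).trans (hcard Fin.revPerm).symm
  have hcond : (∀ j : Fin (n + 2), j.val + l ≤ n + 1 → l ≤ (w⁻¹ j).val) ↔
      ((Finset.univ.filter fun j : Fin (n + 2) => j.val + l ≤ n + 1).image fun j => w⁻¹ j) ⊆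
      ((Finset.univ.filter fun j : Fin (n + 2) => j.val + l ≤ n + 1).image
        fun j => (Fin.revPerm : Equiv.Perm (Fin (n + 2)))⁻¹ j) := by
    rw [Finset.image_subset_iff]
    simp only [hmem, Finset.mem_filter, Finset.mem_univ, true_and]
  rw [if_congr hcond rfl rfl]
  generalize ((Finset.univ.filter fun j : Fin (n + 2) => j.val + l ≤ n + 1).image
        fun j => (Fin.revPerm : Equiv.Perm (Fin (n + 2)))⁻¹ j) = L at *
  generalize ((Finset.univ.filter fun j : Fin (n + 2) => j.val + l ≤ n + 1).image
        fun j => w⁻¹ j) = S at *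
  have hne : ∀ s : Finset (Fin (n + 2)), (∏ b ∈ s, yM b : Mer n) ≠ 0 := fun s =>
    Finset.prod_ne_zero_iff.2 fun b _ => yM_ne_zero b
  split_ifs with hSL
  · rw [Finset.eq_of_subset_of_card_le hSL hc2.ge, div_self (hne L)]
    exact reg_one
  · have hc3 := Finset.card_sdiff_comm hc2
    -- Any bijection will do: it pairs an index below $l$ with one that is at least $l$, and each
    -- such ratio $\gamma_b/\gamma_{e(b)}$ vanishes at the origin.
    let e := Finset.equivOfCardEq hc3
    have e1 : (∏ b ∈ S, yM b) / ∏ b ∈ L, yM b =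
        (∏ b : ↥(S \ L), yM (b : Fin (n + 2)) / yM (e b : Fin (n + 2)) : Mer n) := by
      rw [Finset.prod_div_distrib, e.prod_comp fun b : ↥(L \ S) => (yM (b : Fin (n + 2)) : Mer n),
        Finset.prod_coe_sort (S \ L) fun b => (yM b : Mer n),
        Finset.prod_coe_sort (L \ S) fun b => (yM b : Mer n),
        ← Finset.prod_inter_mul_prod_sdiff S L, ← Finset.prod_inter_mul_prod_sdiff L S,
        Finset.inter_comm L S, mul_div_mul_left _ _ (hne _)]
    rw [e1]
    have h0 : ∀ b ∈ (Finset.univ : Finset ↥(S \ L)),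
        Reg (yM (b : Fin (n + 2)) / yM (e b : Fin (n + 2)) : Mer n) 0 := by
      intro b _
      have h1 := (Finset.mem_sdiff.1 b.2).2
      have h2 := (Finset.mem_sdiff.1 (e b).2).1
      rw [hmem] at h1 h2
      have hlt : (b : Fin (n + 2)) < (e b : Fin (n + 2)) := by
        rw [Fin.lt_def]
        omega
      have := reg_yM_div (n := n) hlt.le
      rwa [if_neg hlt.ne] at this
    have := Reg.prod _ h0
    have hnonempty : (Finset.univ : Finset ↥(S \ L)).Nonempty := by
      obtain ⟨b, hb, hb'⟩ := Finset.not_subset.1 hSL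
      exact ⟨⟨b, Finset.mem_sdiff.2 ⟨hb, hb'⟩⟩, Finset.mem_univ _⟩
    rwa [Finset.prod_const, zero_pow (Finset.card_ne_zero.2 hnonempty)] at this

/-! ### Theta functions and the transformation behaviour of $W_\kappa$. -/

theorem multipliable_one_sub (q : Set.Ioo (0 : ℝ) 1) (z : ℂ) :
    Multipliable fun m : ℕ => 1 - (qC q : ℂ) ^ m * z := by
  have h : Summable fun m : ℕ => ‖-((qC q : ℂ) ^ m * z)‖ := by
    simp only [norm_neg, norm_mul, norm_pow]
    exact (summable_geometric_of_lt_one (norm_nonneg _) (norm_qC_lt_one q)).mul_right _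
  simpa only [sub_eq_add_neg] using multipliable_one_add_of_summable h

/-- With the two products separated, their indices can be shifted in opposite directions. -/
theorem theta_eq (q : Set.Ioo (0 : ℝ) 1) (z : ℂ) : theta q z =
    (∏' m : ℕ, (1 - (qC q : ℂ) ^ m * z)) * ∏' m : ℕ, (1 - (qC q : ℂ) ^ m * ((qC q : ℂ) / z)) := by
  rw [← (multipliable_one_sub q z).tprod_mul (multipliable_one_sub q _), theta]
  refine tprod_congr fun m => ?_
  rw [pow_succ, mul_div_assoc]

theorem tprod_one_sub_shift (q : Set.Ioo (0 : ℝ) 1) (z : ℂ) :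
    ∏' m : ℕ, (1 - (qC q : ℂ) ^ m * z) =
      (1 - z) * ∏' m : ℕ, (1 - (qC q : ℂ) ^ m * ((qC q : ℂ) * z)) := by
  have h : (fun m : ℕ => 1 - (qC q : ℂ) ^ (m + 1) * z) =
      fun m : ℕ => 1 - (qC q : ℂ) ^ m * ((qC q : ℂ) * z) := by
    funext m
    rw [pow_succ, mul_assoc]
  have hm := multipliable_one_sub q ((qC q : ℂ) * z)
  rw [← h] at hm ⊢
  rw [tprod_eq_zero_mul' (f := fun m : ℕ => 1 - (qC q : ℂ) ^ m * z) hm, pow_zero, one_mul]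

/-- The functional equation of the theta function. -/
theorem theta_shift (q : Set.Ioo (0 : ℝ) 1) {z : ℂ} (hz : z ≠ 0) :
    theta q ((qC q : ℂ)⁻¹ * z) = -((qC q : ℂ)⁻¹ * z) * theta q z := by
  have hq := (qC q).ne_zero
  have h1 := tprod_one_sub_shift q ((qC q : ℂ)⁻¹ * z)
  have h2 := tprod_one_sub_shift q ((qC q : ℂ) / z)
  rw [mul_inv_cancel_left₀ hq] at h1
  have e : (qC q : ℂ) / ((qC q : ℂ)⁻¹ * z) = (qC q : ℂ) * ((qC q : ℂ) / z) := by field_simp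
  rw [theta_eq, theta_eq, e, h1, h2]
  have e2 : 1 - (qC q : ℂ)⁻¹ * z = -((qC q : ℂ)⁻¹ * z) * (1 - (qC q : ℂ) / z) := by
    field_simp
    ring
  rw [e2]
  ring

/-- At $-1$ all factors are real and at least $1$, so the partial products cannot tend to $0$. This
point is used to see that no theta factor of $W_\kappa$ vanishes identically. -/
theorem theta_neg_one_ne_zero (q : Set.Ioo (0 : ℝ) 1) : theta q (-1) ≠ 0 := by
  have hq0 : (0 : ℝ) ≤ (q : ℝ) := q.2.1.le
  have key : ∀ r : ℝ, 0 ≤ r → ∏' m : ℕ, (1 - (qC q : ℂ) ^ m * (-(r : ℂ))) ≠ 0 := by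
    intro r hr h0
    have h := (multipliable_one_sub q (-(r : ℂ))).hasProd
    rw [h0] at h
    have h1 := (h.tendsto_prod_nat).norm
    rw [norm_zero] at h1
    have h2 := ge_of_tendsto' h1 (b := 1) fun N => ?_
    · exact absurd h2 (by norm_num)
    · rw [norm_prod]
      refine Finset.prod_induction _ (fun x => 1 ≤ x) (fun _ _ => one_le_mul_of_one_le_of_one_le)
        le_rfl fun m _ => ?_
      have e : (1 - (qC q : ℂ) ^ m * (-(r : ℂ))) = ((1 + (q : ℝ) ^ m * r : ℝ) : ℂ) := by
        simp [qC]
      rw [e, Complex.norm_real]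
      refine le_trans ?_ (le_abs_self _)
      have := mul_nonneg (pow_nonneg hq0 m) hr
      linarith
  rw [theta_eq]
  refine mul_ne_zero (by simpa using key 1 zero_le_one) ?_
  have e : (qC q : ℂ) / -1 = -((q : ℝ) : ℂ) := by simp [qC, div_neg]
  rw [e]
  exact key _ hq0

theorem thetaHol_ne_zero (q : Set.Ioo (0 : ℝ) 1) {u : Torus n × Torus n → ℂˣ}
    (hu : IsHol n fun p => (u p : ℂ)) {p : Torus n × Torus n} (hp : u p = -1) :
    algebraMap (Hol n) (Mer n) (thetaHol q u hu) ≠ 0 := by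
  refine algebraMap_ne_zero fun h => theta_neg_one_ne_zero q ?_
  have := congrFun (congrArg Subtype.val h) p
  change theta q (u p) = 0 at this
  rwa [hp] at this

theorem act_thetaHol_congr (q : Set.Ioo (0 : ℝ) 1) (φ : Bihol n) {u v : Torus n × Torus n → ℂˣ}
    (hu : IsHol n fun p => (u p : ℂ)) (hv : IsHol n fun p => (v p : ℂ))
    (h : ∀ p, u (φ.1.symm p) = v p) :
    act n φ (algebraMap (Hol n) (Mer n) (thetaHol q u hu)) =
      algebraMap (Hol n) (Mer n) (thetaHol q v hv) := by
  rw [act_algebraMap]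
  congr 1
  refine Subtype.ext (funext fun p => ?_)
  change theta q (u (φ.1.symm p)) = theta q (v p)
  rw [h]

theorem act_thetaHol_shift (q : Set.Ioo (0 : ℝ) 1) (φ : Bihol n) {u : Torus n × Torus n → ℂˣ}
    (hu : IsHol n fun p => (u p : ℂ)) (h : ∀ p, u (φ.1.symm p) = (qC q)⁻¹ * u p) :
    act n φ (algebraMap (Hol n) (Mer n) (thetaHol q u hu)) =
      algebraMap ℂ (Mer n) (-(qC q : ℂ)⁻¹) * algebraMap (Hol n) (Mer n) ⟨_, hu⟩ *
        algebraMap (Hol n) (Mer n) (thetaHol q u hu) := by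
  rw [act_algebraMap, IsScalarTower.algebraMap_apply ℂ (Hol n) (Mer n), ← map_mul, ← map_mul]
  congr 1
  refine Subtype.ext (funext fun p => ?_)
  change theta q (u (φ.1.symm p)) = -(qC q : ℂ)⁻¹ * (u p : ℂ) * theta q (u p)
  rw [h, Units.val_mul, Units.val_inv_eq_inv_val, theta_shift q (u p).ne_zero]
  simp only [neg_mul]

/-- The factors of the function `W_κ`. -/
def wF (q : Set.Ioo (0 : ℝ) 1) (k κ : ℂˣ) (i : Fin (n + 2)) : Mer n :=
  algebraMap (Hol n) (Mer n) (thetaHol q _ (isHol_mul_fst_mul_inv_snd κ i i.rev)) /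
    (algebraMap (Hol n) (Mer n) (thetaHol q _ (isHol_mul_fst (κ * k ^ delta i) i)) *
      algebraMap (Hol n) (Mer n) (thetaHol q _ (isHol_mul_inv_snd (κ * k ^ (-delta i)) i.rev)))

theorem Wk_eq (q : Set.Ioo (0 : ℝ) 1) (k κ : ℂˣ) : Wk n q k κ = ∏ i, wF q k κ i := rfl

theorem wF_ne_zero (q : Set.Ioo (0 : ℝ) 1) (k κ : ℂˣ) (i : Fin (n + 2)) : wF q k κ i ≠ 0 := by
  refine div_ne_zero ?_ (mul_ne_zero ?_ ?_)
  · exact thetaHol_ne_zero q _ (p := (fun _ => -κ⁻¹, 1)) (by simp)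
  · exact thetaHol_ne_zero q _ (p := (fun _ => -(κ * k ^ delta i)⁻¹, 1)) (by simp)
  · exact thetaHol_ne_zero q _ (p := (1, fun _ => -(κ * k ^ (-delta i)))) (by
      simp only [inv_neg, mul_neg, mul_inv_cancel])

theorem Wk_ne_zero (q : Set.Ioo (0 : ℝ) 1) (k κ : ℂˣ) : Wk n q k κ ≠ 0 := by
  rw [Wk_eq]
  exact Finset.prod_ne_zero_iff.2 fun i _ => wF_ne_zero q k κ i

theorem delta_rev (i : Fin (n + 2)) : delta i.rev = -delta i := by
  have := i.isLt
  rw [delta, delta, Fin.val_rev]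
  omega

/-- The inversion exchanges the two theta functions in the denominator, and the symmetry
$\delta_{N-i+1}=-\delta_i$ matches their parameters with those of the reversed index. -/
theorem act_iota_wF (q : Set.Ioo (0 : ℝ) 1) (k κ : ℂˣ) (i : Fin (n + 2)) :
    act n iotaB (wF q k κ i) = wF q k κ i.rev := by
  rw [wF, wF, map_div₀, map_mul, mul_comm (algebraMap _ _ (thetaHol q _
    (isHol_mul_fst (κ * k ^ delta i.rev) i.rev)))]
  congr 1
  · refine act_thetaHol_congr q _ _ _ fun p => ?_
    change κ * (p.2 i)⁻¹ * ((p.1 i.rev)⁻¹)⁻¹ = κ * p.1 i.rev * (p.2 i.rev.rev)⁻¹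
    rw [Fin.rev_rev, inv_inv, mul_right_comm]
  congr 1
  · refine act_thetaHol_congr q _ _ _ fun p => ?_
    change κ * k ^ delta i * (p.2 i)⁻¹ = κ * k ^ (-delta i.rev) * (p.2 i.rev.rev)⁻¹
    rw [Fin.rev_rev, delta_rev, neg_neg]
  · refine act_thetaHol_congr q _ _ _ fun p => ?_
    change κ * k ^ (-delta i) * ((p.1 i.rev)⁻¹)⁻¹ = κ * k ^ delta i.rev * p.1 i.rev
    rw [delta_rev, inv_inv]

theorem act_iota_Wk (q : Set.Ioo (0 : ℝ) 1) (k κ : ℂˣ) :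
    act n iotaB (Wk n q k κ) = Wk n q k κ := by
  rw [Wk_eq, map_prod]
  simp only [act_iota_wF]
  exact Equiv.prod_comp Fin.revPerm (wF q k κ)

theorem symm_fst_eq {φ : Bihol n} {c : ℂˣ} {j : Fin (n + 2)}
    (h : act n φ (xM j) = algebraMap ℂ (Mer n) c * xM j) (p : Torus n × Torus n) :
    (φ.1.symm p).1 j = c * p.1 j := by
  rw [xM, act_algebraMap, IsScalarTower.algebraMap_apply ℂ (Hol n) (Mer n), ← map_mul,
    (algebraMap_Hol_injective n).eq_iff] at h
  exact Units.ext (congrFun (congrArg Subtype.val h) p)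

theorem symm_snd_eq {φ : Bihol n} {j : Fin (n + 2)} (h : act n φ (yM j) = yM j)
    (p : Torus n × Torus n) : (φ.1.symm p).2 j = p.2 j := by
  rw [yM, act_algebraMap, (algebraMap_Hol_injective n).eq_iff] at h
  exact Units.ext (congrFun (congrArg Subtype.val h) p)

theorem act_wF_of_fixed {q : Set.Ioo (0 : ℝ) 1} (k κ : ℂˣ) {φ : Bihol n} {i : Fin (n + 2)}
    (hx : act n φ (xM i) = xM i) (hy : act n φ (yM i.rev) = yM i.rev) :
    act n φ (wF q k κ i) = wF q k κ i := by
  have h1 := symm_fst_eq (c := 1) (φ := φ) (j := i) (by simpa using hx)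
  have h2 := symm_snd_eq hy
  rw [wF, map_div₀, map_mul]
  congr 1
  · exact act_thetaHol_congr q _ _ _ fun p => by rw [h1, h2, one_mul]
  congr 1
  · exact act_thetaHol_congr q _ _ _ fun p => by rw [h1, one_mul]
  · exact act_thetaHol_congr q _ _ _ fun p => by rw [h2]

/-- Two theta functions depend on $t_i$, and each acquires $-q^{-1}$ times its argument. In the
quotient $\kappa$ and $t_i$ cancel, leaving $k^{-\delta_i}\gamma_{N-i+1}^{-1}$. -/
theorem act_wF_of_shift {q : Set.Ioo (0 : ℝ) 1} (k κ : ℂˣ) {φ : Bihol n} {i : Fin (n + 2)}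
    (hx : act n φ (xM i) = algebraMap ℂ (Mer n) (qC q : ℂ)⁻¹ * xM i)
    (hy : act n φ (yM i.rev) = yM i.rev) :
    act n φ (wF q k κ i) =
      algebraMap ℂ (Mer n) ((k ^ (-delta i) : ℂˣ) : ℂ) * (yM i.rev)⁻¹ * wF q k κ i := by
  have h1 := symm_fst_eq (c := (qC q)⁻¹) (φ := φ) (j := i) (by simpa using hx)
  have h2 := symm_snd_eq hy
  have e1 := act_thetaHol_shift q φ (isHol_mul_fst_mul_inv_snd κ i i.rev) fun p => by
    rw [h1, h2]
    simp only [mul_left_comm, mul_assoc]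
  have e2 := act_thetaHol_shift q φ (isHol_mul_fst (κ * k ^ delta i) i) fun p => by
    rw [h1]
    exact mul_left_comm _ _ _
  have e3 := act_thetaHol_congr q φ (isHol_mul_inv_snd (κ * k ^ (-delta i)) i.rev)
    (isHol_mul_inv_snd (κ * k ^ (-delta i)) i.rev) fun p => by rw [h2]
  have hu : algebraMap (Hol n) (Mer n) ⟨_, isHol_mul_fst_mul_inv_snd κ i i.rev⟩ * yM i.rev =
      algebraMap (Hol n) (Mer n) ⟨_, isHol_mul_fst (κ * k ^ delta i) i⟩ *
        algebraMap ℂ (Mer n) ((k ^ (-delta i) : ℂˣ) : ℂ) := by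
    rw [yM, IsScalarTower.algebraMap_apply ℂ (Hol n) (Mer n), ← map_mul, ← map_mul]
    congr 1
    refine Subtype.ext (funext fun p => ?_)
    change ((κ * p.1 i * (p.2 i.rev)⁻¹ : ℂˣ) : ℂ) * (p.2 i.rev : ℂ) =
      ((κ * k ^ delta i * p.1 i : ℂˣ) : ℂ) * ((k ^ (-delta i) : ℂˣ) : ℂ)
    rw [← Units.val_mul, ← Units.val_mul, inv_mul_cancel_right, zpow_neg]
    congr 1
    rw [mul_right_comm, mul_inv_cancel_right]
  have hne : algebraMap (Hol n) (Mer n) ⟨_, isHol_mul_fst (κ * k ^ delta i) i⟩ ≠ 0 := by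
    refine algebraMap_ne_zero fun h => ?_
    have h1 : ((κ * k ^ delta i * 1 : ℂˣ) : ℂ) = 0 := congrFun (congrArg Subtype.val h) 1
    exact Units.ne_zero _ h1
  have hq : algebraMap ℂ (Mer n) (-(qC q : ℂ)⁻¹) ≠ 0 := by simp
  have hk : algebraMap ℂ (Mer n) ((k ^ (-delta i) : ℂˣ) : ℂ) ≠ 0 := by
    rw [Ne, map_eq_zero_iff _ (algebraMap ℂ (Mer n)).injective]
    exact Units.ne_zero _
  have hyne := yM_ne_zero (n := n) i.rev
  rw [← eq_div_iff hyne] at hu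
  rw [wF, map_div₀, map_mul, e1, e2, e3, hu]
  generalize algebraMap ℂ (Mer n) (-(qC q : ℂ)⁻¹) = Q at *
  generalize algebraMap ℂ (Mer n) ((k ^ (-delta i) : ℂˣ) : ℂ) = K at *
  generalize algebraMap (Hol n) (Mer n) ⟨_, isHol_mul_fst (κ * k ^ delta i) i⟩ = U at *
  rw [show Q * (U * K / yM i.rev) = Q * U * (K * (yM i.rev)⁻¹) by ring, mul_assoc (Q * U),
    mul_assoc (Q * U), mul_div_mul_left _ _ (mul_ne_zero hq hne), mul_div_assoc]

/-- This is the sum $\delta_1+\dots+\delta_m=m(N-m)$. -/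
theorem prod_zpow_delta (k : ℂˣ) {m : ℕ} (hm : m ≤ n + 2) :
    ∏ j ∈ Finset.range m, k ^ (-delta (Fin.ofNat (n + 2) j)) =
      k ^ (-(m * (n + 2 - m) : ℤ)) := by
  induction m with
  | zero => simp
  | succ m ih =>
    rw [Finset.prod_range_succ, ih (by omega), ← zpow_add, delta, Fin.val_ofNat,
      Nat.mod_eq_of_lt (by omega)]
    congr 1
    push_cast
    ring

/-- Multiplying the factors over $i\le N-l$ gives the inverse of the eigenvalue $k^{l(N-l)}$ in
`valQ_single_self` times the monomial at $w_0$. This is the reason for the choice of $\delta$ and of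
the reversed indices in $W_\kappa$. -/
theorem act_bB_pow_Wk (q : Set.Ioo (0 : ℝ) 1) (k κ : ℂˣ) {l : ℕ} (hl : l ≤ n + 1) :
    act n (bB q l ^ (n + 2 - l)) (Wk n q k κ) =
      algebraMap ℂ (Mer n) (((k : ℂ) ^ (l * (n + 2 - l)))⁻¹) *
        (yP (n + 2 - l) Fin.revPerm)⁻¹ * Wk n q k κ := by
  obtain ⟨g, hg⟩ : ∃ g : ℕ → Mer n, ∀ j, g j =
      algebraMap ℂ (Mer n) ((k ^ (-delta (Fin.ofNat (n + 2) j)) : ℂˣ) : ℂ) *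
        (yM (Fin.ofNat (n + 2) j).rev)⁻¹ := ⟨_, fun _ => rfl⟩
  have h1 : ∀ i : Fin (n + 2), act n (bB q l ^ (n + 2 - l)) (wF q k κ i) =
      (if i.val + l ≤ n + 1 then g i.val else 1) * wF q k κ i := by
    intro i
    split_ifs with h
    · rw [hg, ofNat_val_eq]
      refine act_wF_of_shift k κ ?_ (act_bB_pow_yM q l _ _)
      rw [act_bB_pow_xM q hl, if_pos h]
    · rw [one_mul]
      exact act_wF_of_fixed k κ (act_bB_pow_xM_of_lt q hl (by omega) _) (act_bB_pow_yM q l _ _)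
  rw [Wk_eq, map_prod, Finset.prod_congr rfl fun i _ => h1 i, Finset.prod_mul_distrib]
  congr 1
  rw [Fin.prod_univ_eq_prod_range (fun j => if j + l ≤ n + 1 then g j else 1) (n + 2),
    ← Finset.prod_subset (Finset.range_mono (show n + 2 - l ≤ n + 2 by omega)) fun j _ hj => by
      rw [Finset.mem_range] at hj
      rw [if_neg (by omega)]]
  have h2 : ∀ j ∈ Finset.range (n + 2 - l), (if j + l ≤ n + 1 then g j else 1) =
      algebraMap ℂ (Mer n) ((k ^ (-delta (Fin.ofNat (n + 2) j)) : ℂˣ) : ℂ) *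
        (yM (Fin.ofNat (n + 2) j).rev)⁻¹ := by
    intro j hj
    rw [Finset.mem_range] at hj
    rw [if_pos (by omega), hg]
  rw [Finset.prod_congr rfl h2, Finset.prod_mul_distrib,
    Finset.prod_inv_distrib, ← map_prod, ← Units.coe_prod, prod_zpow_delta k (by omega)]
  congr 2
  rw [zpow_neg, Units.val_inv_eq_inv_val, Units.val_zpow_eq_zpow_val, ← zpow_natCast]
  congr 2
  have : ((n + 2 - l : ℕ) : ℤ) = n + 2 - l := by omega
  push_cast [this]
  ring

theorem opL_smul (q : Set.Ioo (0 : ℝ) 1) (k : ℂˣ) (l m : ℕ) (c : Mer n) (f : H0K n) :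
    opL q k l m (c • f) = c • opL q k l m f := by
  induction m generalizing f with
  | zero => rfl
  | succ m ih =>
    change opL q k l m (etaPi (opV k (zM q m) l (c • f))) = _
    rw [map_smul, map_smul, ih]
    rfl

theorem tauL_omW_smul (q : Set.Ioo (0 : ℝ) 1) (k : ℂˣ) {l : ℕ} (hl : l ≤ n + 1) (c : Mer n)
    (f : H0K n) : tauL n q k (omW l) (c • f) =
      act n (bB q l ^ (n + 2 - l)) c • tauL n q k (omW l) f := by
  rw [omW, tauL_gW_pow q k hl (by omega), tauL_gW_pow q k hl (by omega), coefAct_smul, opL_smul]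

/-! ### The gauged action and its limit at the origin. -/

/-- The multiplication by `W_κ`. -/
def mulW (n : ℕ) (q : Set.Ioo (0 : ℝ) 1) (k κ : ℂˣ) : H0K n ≃ₗ[ℂ] H0K n :=
  (LinearEquiv.smulOfNeZero (Mer n) (H0K n) (Wk n q k κ) (Wk_ne_zero q k κ)).restrictScalars ℂ

theorem mulW_apply (q : Set.Ioo (0 : ℝ) 1) (k κ : ℂˣ) (f : H0K n) :
    mulW n q k κ f = Wk n q k κ • f := rfl

theorem mulW_inv_apply (q : Set.Ioo (0 : ℝ) 1) (k κ : ℂˣ) (f : H0K n) :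
    (mulW n q k κ)⁻¹ f = (Wk n q k κ)⁻¹ • f := by
  change (mulW n q k κ).symm f = _
  rw [LinearEquiv.symm_apply_eq, mulW_apply, smul_inv_smul₀ (Wk_ne_zero q k κ)]

/-- The action of `W` on `H_0^𝕂` by gauged operators. -/
def gau (n : ℕ) (q : Set.Ioo (0 : ℝ) 1) (k κ : ℂˣ) : W n →* (H0K n ≃ₗ[ℂ] H0K n) :=
  (MulAut.conj (mulW n q k κ)⁻¹).toMonoidHom.comp (tauL n q k)

theorem gau_apply (q : Set.Ioo (0 : ℝ) 1) (k κ : ℂˣ) (w : W n) (f : H0K n) :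
    gau n q k κ w f = (Wk n q k κ)⁻¹ • tauL n q k w (Wk n q k κ • f) := by
  have h : gau n q k κ w = (mulW n q k κ)⁻¹ * tauL n q k w * mulW n q k κ := by
    change MulAut.conj (mulW n q k κ)⁻¹ (tauL n q k w) = _
    rw [MulAut.conj_apply, inv_inv]
  rw [h, LinearEquiv.mul_apply, LinearEquiv.mul_apply, mulW_inv_apply, mulW_apply]

/-- The condition on `w` for `∏_{j ≤ N - l} γ_{w⁻¹(j)}` to be the dominant monomial. -/
def Dom (l : ℕ) (w : Equiv.Perm (Fin (n + 2))) : Prop :=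
  ∀ j : Fin (n + 2), j.val + l ≤ n + 1 → l ≤ (w⁻¹ j).val

instance (l : ℕ) (w : Equiv.Perm (Fin (n + 2))) : Decidable (Dom l w) := by
  unfold Dom
  infer_instance

/-- The limit at the origin of the gauged operator of `ω_l`. -/
def valG (k : ℂˣ) (l : ℕ) : Module.End ℂ (Equiv.Perm (Fin (n + 2)) → ℂ) where
  toFun c w := ((k : ℂ) ^ (l * (n + 2 - l)))⁻¹ * (if Dom l w then 1 else 0) *
    valQ k l (n + 2 - l) c w
  map_add' c d := funext fun w => by
    simp only [map_add, Pi.add_apply, mul_add]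
  map_smul' r c := funext fun w => by
    simp only [map_smul, Pi.smul_apply, smul_eq_mul, RingHom.id_apply]
    ring

theorem valG_apply (k : ℂˣ) (l : ℕ) (c : Equiv.Perm (Fin (n + 2)) → ℂ)
    (w : Equiv.Perm (Fin (n + 2))) : valG k l c w =
      ((k : ℂ) ^ (l * (n + 2 - l)))⁻¹ * (if Dom l w then 1 else 0) *
        valQ k l (n + 2 - l) c w := rfl

theorem isRegOp_gau (q : Set.Ioo (0 : ℝ) 1) (k κ : ℂˣ) {l : ℕ} (hl : l ≤ n + 1) :
    IsRegOp q (gau n q k κ (omW l)) (expL n l) (valG k l) where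
  semilinear := by
    refine ⟨bB q l ^ (n + 2 - l), scales_of_act (act_bB_pow_ev_X q hl), fun c f => ?_⟩
    rw [gau_apply, gau_apply, smul_comm (Wk n q k κ) c f, tauL_omW_smul q k hl,
      smul_comm (Wk n q k κ)⁻¹]
  reg f c h := by
    intro w
    have hW := Wk_ne_zero (n := n) q k κ
    -- Inserting the monomial at $w$ separates the gauge constant, the monomial quotient of
    -- `reg_yP_div` and the normalised operator of `regM_tauL_omW`, each of which has a limit.
    have e : gau n q k κ (omW l) f w = algebraMap ℂ (Mer n) (((k : ℂ) ^ (l * (n + 2 - l)))⁻¹) *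
        (yP (n + 2 - l) w / yP (n + 2 - l) Fin.revPerm) *
        (tauL n q k (omW l) f w / yP (n + 2 - l) w) := by
      rw [gau_apply, tauL_omW_smul q k hl, act_bB_pow_Wk q k κ hl, Pi.smul_apply, Pi.smul_apply,
        smul_eq_mul, smul_eq_mul]
      have h1 := yP_ne_zero (n := n) (n + 2 - l) w
      have h2 := yP_ne_zero (n := n) (n + 2 - l) Fin.revPerm
      generalize algebraMap ℂ (Mer n) (((k : ℂ) ^ (l * (n + 2 - l)))⁻¹) = K
      field_simp
    rw [e, valG_apply]
    exact ((reg_algebraMap _).mul (reg_yP_div w hl)).mul (regM_tauL_omW q k hl h w)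

theorem dom_revPerm (l : ℕ) : Dom l (Fin.revPerm : Equiv.Perm (Fin (n + 2))) := by
  intro j hj
  change l ≤ (Fin.rev j).val
  rw [Fin.val_rev]
  omega

theorem valG_single (k : ℂˣ) {l : ℕ} (hl : l ≤ n + 1) :
    valG k l (Pi.single Fin.revPerm 1 : Equiv.Perm (Fin (n + 2)) → ℂ) =
      Pi.single Fin.revPerm 1 := by
  funext w
  rw [valG_apply, valQ_single_self k hl, Pi.smul_apply, smul_eq_mul]
  by_cases hw : w = Fin.revPerm
  · subst hw
    rw [if_pos (dom_revPerm l), mul_one, inv_mul_cancel_left₀ (pow_ne_zero _ k.ne_zero)]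
  · rw [Pi.single_eq_of_ne hw, mul_zero, mul_zero]

/-- The conditions for all $l$ say that $u=w_0w^{-1}$ satisfies $u(j)\le j$ for every $j$, which
forces $u=1$. -/
theorem eq_revPerm_of_dom {w : Equiv.Perm (Fin (n + 2))} (h : ∀ l ≤ n + 1, Dom l w) :
    w = Fin.revPerm := by
  obtain ⟨u, hu⟩ : ∃ u : Equiv.Perm (Fin (n + 2)), u = Fin.revPerm * w⁻¹ := ⟨_, rfl⟩
  have h1 : ∀ j, u j ≤ j := by
    intro j
    have := j.isLt
    have h2 := h (n + 1 - j) (by omega) j (by omega)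
    rw [hu]
    change (Fin.rev (w⁻¹ j)) ≤ j
    rw [Fin.le_def, Fin.val_rev]
    omega
  have h2 : ∀ (m : ℕ) (j : Fin (n + 2)), j.val = m → u j = j := by
    intro m
    induction m using Nat.strong_induction_on with
    | _ m ih =>
      intro j hj
      by_contra hne
      have hlt := lt_of_le_of_ne (h1 j) hne
      have := ih (u j).val (by rw [← hj]; exact hlt) _ rfl
      exact hne (u.injective this)
  have h3 : u = 1 := Equiv.ext fun j => h2 _ j rfl
  rw [hu] at h3
  exact (mul_inv_eq_one.1 h3).symm

/-! ### Duality: conjugation of the gauged action by $\tau(\iota)$. -/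

theorem tauIota_smul (c : Mer n) (f : H0K n) : tauIota (c • f) = act n iotaB c • tauIota f := by
  rw [tauIota_apply, coefAct_smul, map_smul, tauIota_apply]

/-- The linear extension of the inversion of permutations. -/
def valJ : Module.End ℂ (Equiv.Perm (Fin (n + 2)) → ℂ) where
  toFun c w := c w⁻¹
  map_add' _ _ := rfl
  map_smul' _ _ := rfl

theorem valJ_single : valJ (Pi.single Fin.revPerm 1 : Equiv.Perm (Fin (n + 2)) → ℂ) =
    Pi.single Fin.revPerm 1 := by
  funext w
  change (Pi.single Fin.revPerm 1 : Equiv.Perm (Fin (n + 2)) → ℂ) w⁻¹ = _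
  have h : (Fin.revPerm : Equiv.Perm (Fin (n + 2)))⁻¹ = Fin.revPerm := rfl
  simp only [Pi.single_apply, inv_eq_iff_eq_inv, h]

theorem RegV.tauIota {f : H0K n} {c : Equiv.Perm (Fin (n + 2)) → ℂ} (h : RegV f c) :
    RegV (tauIota f) (valJ c) := fun w => (h w⁻¹).act_iota

theorem GermV.tauIota {f : H0K n} {c : Equiv.Perm (Fin (n + 2)) → ℂ} (h : GermV f c) :
    GermV (tauIota f) (valJ c) := by
  intro w
  obtain ⟨g, hg, hg0⟩ := h w⁻¹
  exact ⟨_, hg.act_iota, hg0⟩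

/-- Since $\iota$ fixes the asymptotic origin, conjugation preserves regularity. It exchanges the
rescalings of the $x_i$ and $y_i$ and conjugates the limit by $T_w\mapsto T_{w^{-1}}$. -/
theorem IsRegOp.dual {q : Set.Ioo (0 : ℝ) 1} {T : H0K n ≃ₗ[ℂ] H0K n} {e : Sig n → ℕ}
    {A : Module.End ℂ (Equiv.Perm (Fin (n + 2)) → ℂ)} (h : IsRegOp q T e A) :
    IsRegOp q (MulAut.conj BqKZ.tauIota T) (fun s => e s.swap) (valJ * A * valJ) where
  semilinear := by
    obtain ⟨φ, hφ, hT⟩ := h.semilinear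
    refine ⟨iotaB * φ * iotaB, fun p s => ?_, fun c f => ?_⟩
    · change XY ((iotaB (n := n)).1.symm (φ.1.symm ((iotaB (n := n)).1.symm p))) s = _
      rw [XY_iota, hφ, XY_iota, Sum.swap_swap]
    · rw [conj_tauIota_apply, conj_tauIota_apply, tauIota_smul, hT, tauIota_smul, map_mul, map_mul]
      rfl
  reg f c hf := by
    rw [conj_tauIota_apply]
    exact (h.reg _ _ hf.tauIota).tauIota

/-- The dual action of `W` on `H_0^𝕂` by gauged operators. -/
def gauR (n : ℕ) (q : Set.Ioo (0 : ℝ) 1) (k κ : ℂˣ) : W n →* (H0K n ≃ₗ[ℂ] H0K n) :=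
  (MulAut.conj (tauIota (n := n))).toMonoidHom.comp (gau n q k κ)

theorem gauR_apply (q : Set.Ioo (0 : ℝ) 1) (k κ : ℂˣ) (w : W n) (f : H0K n) :
    gauR n q k κ w f = tauIota (gau n q k κ w (tauIota f)) := conj_tauIota_apply _ f

/-- Gauging and conjugation by $\tau(\iota)$ commute because $W_\kappa$ is $\iota$-invariant. -/
theorem gauR_eq (q : Set.Ioo (0 : ℝ) 1) (k κ : ℂˣ) (w : W n) :
    gauR n q k κ w = MulAut.conj (mulW n q k κ)⁻¹ (tauR n q k w) := by
  refine LinearEquiv.ext fun f => ?_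
  rw [gauR_apply, gau_apply, tauIota_smul, map_inv₀, act_iota_Wk, MulAut.conj_apply, inv_inv,
    LinearEquiv.mul_apply, LinearEquiv.mul_apply, mulW_inv_apply, mulW_apply]
  congr 1
  change _ = MulAut.conj tauIota (tauL n q k w) _
  rw [conj_tauIota_apply, tauIota_smul, act_iota_Wk]

theorem gau_commute_gauR (q : Set.Ioo (0 : ℝ) 1) (k κ : ℂˣ) (v w : W n) :
    Commute (gau n q k κ v) (gauR n q k κ w) := by
  rw [gauR_eq]
  exact (tauL_commute_tauR q k v w).map (MulAut.conj (mulW n q k κ)⁻¹)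

theorem tau_translWW (q : Set.Ioo (0 : ℝ) 1) (k : ℂˣ) (l m : Fin (n + 2) → ℤ) :
    tau n q k (translWW l m) = tauL n q k (transl l) * tauR n q k (transl m) := by
  rw [tau, translWW, SemidirectProduct.lift_inl]
  rfl

theorem gauged_eq (q : Set.Ioo (0 : ℝ) 1) (k κ : ℂˣ) (l m : Fin (n + 2) → ℤ) (Ψ : H0K n) :
    (Wk n q k κ)⁻¹ • tau n q k (translWW l m) (Wk n q k κ • Ψ) =
      gau n q k κ (transl l) (gauR n q k κ (transl m) Ψ) := by
  rw [tau_translWW, gau_apply, gauR_eq, MulAut.conj_apply, inv_inv, LinearEquiv.mul_apply,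
    LinearEquiv.mul_apply, LinearEquiv.mul_apply, mulW_inv_apply, mulW_apply,
    smul_inv_smul₀ (Wk_ne_zero q k κ)]

/-! ### Reduction to the $\omega_l$ and construction of the master operator. -/

theorem mem_comap_stabilizer {G : Type*} [Group G] (ρ : G →* (H0K n ≃ₗ[ℂ] H0K n)) (Ψ : H0K n)
    (w : G) : w ∈ (MulAction.stabilizer (H0K n ≃ₗ[ℂ] H0K n) Ψ).comap ρ ↔ ρ w Ψ = Ψ := Iff.rfl

/-- The elements that fix $\Psi$ form a subgroup, so the generators $\epsilon_j$ may be replaced by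
the $\omega_l$, whose limits at the origin are known. -/
theorem isGaugedSolution_iff (q : Set.Ioo (0 : ℝ) 1) (k κ : ℂˣ) (Ψ : H0K n) :
    IsGaugedSolution n q k κ Ψ ↔ ∀ l ≤ n + 1, gau n q k κ (omW l) Ψ = Ψ ∧
      gauR n q k κ (omW l) Ψ = Ψ := by
  constructor
  · intro h l hl
    constructor
    · rw [← mem_comap_stabilizer]
      refine omW_mem_of_eps_mem _ (fun j => ?_) l hl
      have := h (Pi.single j 1) 0
      rw [gauged_eq, transl_zero, map_one, transl_single] at this
      exact this
    · rw [← mem_comap_stabilizer]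
      refine omW_mem_of_eps_mem _ (fun j => ?_) l hl
      have := h 0 (Pi.single j 1)
      rw [gauged_eq, transl_zero, map_one, transl_single] at this
      exact this
  · intro h l m
    have h1 := transl_mem ((MulAction.stabilizer (H0K n ≃ₗ[ℂ] H0K n) Ψ).comap (gau n q k κ))
      (eps_mem_of_omW_mem _ fun l hl => (h l hl).1) l
    have h2 := transl_mem ((MulAction.stabilizer (H0K n ≃ₗ[ℂ] H0K n) Ψ).comap (gauR n q k κ))
      (eps_mem_of_omW_mem _ fun l hl => (h l hl).2) m
    rw [mem_comap_stabilizer] at h1 h2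
    rw [gauged_eq, h2, h1]

/-- Here $x=\omega_0\cdots\omega_{m-1}$; membership in every subgroup containing the $\omega_l$
records all that is needed about $x$. The last clause confines the image of the limit to the $T_w$
satisfying the dominance condition of every factor. -/
theorem exists_prod_omW (q : Set.Ioo (0 : ℝ) 1) (k κ : ℂˣ) {m : ℕ} (hm : m ≤ n + 2) :
    ∃ (x : W n) (A : Module.End ℂ (Equiv.Perm (Fin (n + 2)) → ℂ)),
      IsRegOp q (gau n q k κ x) (∑ l ∈ Finset.range m, expL n l) A ∧
      (∀ S : Subgroup (W n), (∀ l ≤ n + 1, omW l ∈ S) → x ∈ S) ∧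
      A (Pi.single Fin.revPerm 1) = Pi.single Fin.revPerm 1 ∧
      ∀ c w, A c w ≠ 0 → ∀ l < m, Dom l w := by
  induction m with
  | zero =>
    refine ⟨1, 1, ?_, fun S _ => S.one_mem, rfl, fun _ _ _ l hl => absurd hl (by omega)⟩
    rw [map_one]
    exact IsRegOp.one q
  | succ m ih =>
    obtain ⟨x, A, h1, h2, h3, h4⟩ := ih (by omega)
    have hG := isRegOp_gau (n := n) q k κ (l := m) (by omega)
    have hcomm : Commute x (omW m) := by
      have := h2 (Subgroup.centralizer {omW m}) fun l hl => by
        rw [Subgroup.mem_centralizer_singleton_iff]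
        exact omW_comm hl (by omega)
      rwa [Subgroup.mem_centralizer_singleton_iff] at this
    -- Commutativity lets the new factor act last, so the image of the product also satisfies its
    -- dominance condition; the earlier conditions hold because $A$ is also a left factor.
    have hA : Commute A (valG k m) := h1.commute hG (hcomm.map _)
    refine ⟨x * omW m, A * valG k m, ?_, fun S hS => S.mul_mem (h2 S hS) (hS m (by omega)), ?_,
      fun c w hc l hl => ?_⟩
    · rw [map_mul, Finset.sum_range_succ]
      exact h1.mul hG
    · rw [Module.End.mul_apply, valG_single k (by omega), h3]
    · rcases Nat.lt_succ_iff_lt_or_eq.1 hl with hl | rfl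
      · exact h4 _ _ hc l hl
      · rw [hA.eq, Module.End.mul_apply, valG_apply] at hc
        by_contra hd
        rw [if_neg hd, mul_zero, zero_mul] at hc
        exact hc rfl

/-- Each $x_i$ is rescaled by exactly one $\omega_l$, and each $y_i$ by exactly one dual operator.
-/
theorem sum_expL_add (n : ℕ) : ((∑ l ∈ Finset.range (n + 2), expL n l) + fun s : Sig n =>
    (∑ l ∈ Finset.range (n + 2), expL n l) s.swap) = 1 := by
  have h1 : ∀ b : Fin (n + 1), (∑ l ∈ Finset.range (n + 2), expL n l) (.inl b) = 1 := by
    intro b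
    have := b.isLt
    rw [Finset.sum_apply, Finset.sum_eq_single (n + 1 - b.val)]
    · exact if_pos (by omega)
    · intro l _ hl
      exact if_neg (by omega)
    · intro h
      exact absurd (Finset.mem_range.2 (by omega)) h
  have h2 : ∀ b : Fin (n + 1), (∑ l ∈ Finset.range (n + 2), expL n l) (.inr b) = 0 := by
    intro b
    rw [Finset.sum_apply]
    exact Finset.sum_eq_zero fun l _ => rfl
  funext s
  rcases s with b | b
  · rw [Pi.add_apply, Sum.swap_inl, h1, h2]
    rfl
  · rw [Pi.add_apply, Sum.swap_inr, h1, h2]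
    rfl

/-- A product of gauged operators which rescales all the simple root variables by `q`. -/
theorem exists_master (q : Set.Ioo (0 : ℝ) 1) (k κ : ℂˣ) :
    ∃ (x : W n) (A : Module.End ℂ (Equiv.Perm (Fin (n + 2)) → ℂ)),
      IsRegOp q (gau n q k κ x * gauR n q k κ x) 1 A ∧
      (∀ S : Subgroup (W n), (∀ l ≤ n + 1, omW l ∈ S) → x ∈ S) ∧
      A (Pi.single Fin.revPerm 1) = Pi.single Fin.revPerm 1 ∧ A * A = A := by
  obtain ⟨x, A, h1, h2, h3, h4⟩ := exists_prod_omW (n := n) q k κ le_rfl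
  have hr := h1.mul h1.dual
  rw [sum_expL_add] at hr
  obtain ⟨B, hB⟩ : ∃ B : Module.End ℂ (Equiv.Perm (Fin (n + 2)) → ℂ), B = valJ * A * valJ :=
    ⟨_, rfl⟩
  rw [← hB] at hr
  have hBfix : B (Pi.single Fin.revPerm 1) = Pi.single Fin.revPerm 1 := by
    simp only [hB, Module.End.mul_apply, valJ_single, h3]
  -- All dominance conditions hold on the image of $A$, so this image is the line of $T_{w_0}$. Both
  -- $A$ and its dual $B$ fix $T_{w_0}$, which makes $AB$ idempotent.
  have hA : ∀ c, A c = A c Fin.revPerm • (Pi.single Fin.revPerm 1 : _ → ℂ) := by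
    intro c
    funext w
    rw [Pi.smul_apply, smul_eq_mul]
    by_cases hw : w = Fin.revPerm
    · rw [hw, Pi.single_eq_same, mul_one]
    · rw [Pi.single_eq_of_ne hw, mul_zero]
      by_contra hc
      exact hw (eq_revPerm_of_dom fun l hl => h4 c w hc l (by omega))
  refine ⟨x, A * B, hr, h2, ?_, LinearMap.ext fun c => ?_⟩
  · rw [Module.End.mul_apply, hBfix, h3]
  · simp only [Module.End.mul_apply]
    rw [hA (B c), map_smul, map_smul, hBfix, h3]

/-! ### Existence, uniqueness and self-duality. -/

theorem omW_commute_of_mem {x : W n}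
    (hx : ∀ S : Subgroup (W n), (∀ l ≤ n + 1, omW l ∈ S) → x ∈ S) {l : ℕ} (hl : l ≤ n + 1) :
    Commute x (omW l) := by
  have := hx (Subgroup.centralizer {omW l}) fun l' hl' => by
    rw [Subgroup.mem_centralizer_singleton_iff]
    exact omW_comm hl' hl
  rwa [Subgroup.mem_centralizer_singleton_iff] at this

/-- By commutativity $T'\Psi-\Psi$ is again fixed by $T$, and its value at the origin is $A'c-c=0$;
uniqueness for $T$ makes it vanish. -/
theorem IsRegOp.apply_eq_self {q : Set.Ioo (0 : ℝ) 1} {T T' : H0K n ≃ₗ[ℂ] H0K n} {e : Sig n → ℕ}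
    {A A' : Module.End ℂ (Equiv.Perm (Fin (n + 2)) → ℂ)} (h : IsRegOp q T 1 A) (hA : A * A = A)
    (h' : IsRegOp q T' e A') (hc : Commute T T') {Ψ : H0K n}
    {c : Equiv.Perm (Fin (n + 2)) → ℂ} (hΨ : T Ψ = Ψ) (hc' : GermV Ψ c) (hA' : A' c = c) :
    T' Ψ = Ψ := by
  rw [← sub_eq_zero]
  refine h.eq_zero hA ?_ ?_
  · rw [map_sub, ← LinearEquiv.mul_apply, hc.eq, LinearEquiv.mul_apply, hΨ]
  · have := (h'.germV hc').sub hc'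
    rwa [hA', sub_self] at this

/-- Only the master equation is solved. Every other equation of the holonomic system follows from
`IsRegOp.apply_eq_self`, as all limits fix $T_{w_0}$. -/
theorem exists_isAsymptoticallyFree (q : Set.Ioo (0 : ℝ) 1) (k κ : ℂˣ) :
    ∃ Ψ : H0K n, IsAsymptoticallyFree n q k κ Ψ := by
  obtain ⟨x, A, h1, h2, h3, h4⟩ := exists_master (n := n) q k κ
  obtain ⟨Ψ, hΨ, hg⟩ := h1.exists_solution h4 h3
  refine ⟨Ψ, (isGaugedSolution_iff q k κ Ψ).2 fun l hl => ?_, hg.hasExpansion⟩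
  have hx := omW_commute_of_mem h2 hl
  have hG := isRegOp_gau (n := n) q k κ hl
  constructor
  · exact h1.apply_eq_self h4 hG ((hx.map _).mul_left (gau_commute_gauR q k κ _ _).symm) hΨ hg
      (valG_single k hl)
  · refine h1.apply_eq_self h4 hG.dual ((gau_commute_gauR q k κ _ _).mul_left
      (hx.map (gauR n q k κ))) hΨ hg ?_
    simp only [Module.End.mul_apply, valJ_single, valG_single k hl]

/-- Any solution is fixed by the master operator, and the difference of two has value $0$ at the
origin. -/
theorem IsAsymptoticallyFree.unique {q : Set.Ioo (0 : ℝ) 1} {k κ : ℂˣ} {Ψ Ψ' : H0K n}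
    (h : IsAsymptoticallyFree n q k κ Ψ) (h' : IsAsymptoticallyFree n q k κ Ψ') : Ψ = Ψ' := by
  obtain ⟨x, A, h1, h2, -, h4⟩ := exists_master (n := n) q k κ
  have key : ∀ Ψ : H0K n, IsAsymptoticallyFree n q k κ Ψ →
      (gau n q k κ x * gauR n q k κ x) Ψ = Ψ := by
    intro Ψ hΨ
    have hs := (isGaugedSolution_iff q k κ Ψ).1 hΨ.1
    have e1 := h2 ((MulAction.stabilizer (H0K n ≃ₗ[ℂ] H0K n) Ψ).comap (gau n q k κ))
      fun l hl => (hs l hl).1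
    have e2 := h2 ((MulAction.stabilizer (H0K n ≃ₗ[ℂ] H0K n) Ψ).comap (gauR n q k κ))
      fun l hl => (hs l hl).2
    rw [mem_comap_stabilizer] at e1 e2
    rw [LinearEquiv.mul_apply, e2, e1]
  rw [← sub_eq_zero]
  refine h1.eq_zero h4 ?_ ?_
  · rw [map_sub, key Ψ h, key Ψ' h']
  · have := (GermV.of_hasExpansion h.2).sub (GermV.of_hasExpansion h'.2)
    rwa [sub_self] at this

/-- The involution $\tau(\iota)$ swaps the equations for $\lambda$ and $\mu$, preserves the form of
the expansion, and fixes $T_{w_0}$ because $w_0$ is an involution. With uniqueness and the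
invariance of $W_\kappa$ this gives self-duality. -/
theorem IsAsymptoticallyFree.tauIota {q : Set.Ioo (0 : ℝ) 1} {k κ : ℂˣ} {Ψ : H0K n}
    (h : IsAsymptoticallyFree n q k κ Ψ) : IsAsymptoticallyFree n q k κ (BqKZ.tauIota Ψ) := by
  have hs := (isGaugedSolution_iff q k κ Ψ).1 h.1
  refine ⟨(isGaugedSolution_iff q k κ _).2 fun l hl => ⟨?_, ?_⟩, GermV.hasExpansion ?_⟩
  · have := congrArg BqKZ.tauIota (hs l hl).2
    rwa [gauR_apply, tauIota_tauIota] at this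
  · rw [gauR_apply, tauIota_tauIota, (hs l hl).1]
  · have := (GermV.of_hasExpansion h.2).tauIota
    rwa [valJ_single] at this

theorem isAsymptoticallyFree_Psi (q : Set.Ioo (0 : ℝ) 1) (k κ : ℂˣ) :
    IsAsymptoticallyFree n q k κ (Psi n q k κ) :=
  Classical.epsilon_spec (exists_isAsymptoticallyFree q k κ)

theorem tauIota_Phi (q : Set.Ioo (0 : ℝ) 1) (k κ : ℂˣ) :
    tauIota (Phi n q k κ) = Phi n q k κ := by
  have h := isAsymptoticallyFree_Psi (n := n) q k κ
  rw [Phi, tauIota_smul, act_iota_Wk, h.tauIota.unique h]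

end

end BqKZ

theorem mainTheorem3 (n : ℕ) (q : Set.Ioo (0 : ℝ) 1) (k κ : ℂˣ) :
    (∃! Ψ : BqKZ.H0K n, BqKZ.IsAsymptoticallyFree n q k κ Ψ) ∧
    BqKZ.IsAsymptoticallyFree n q k κ (BqKZ.Psi n q k κ) ∧
    BqKZ.tau n q k (BqKZ.iota n) (BqKZ.Phi n q k κ) = BqKZ.Phi n q k κ ∧
    BqKZ.Phi n q k κ = BqKZ.Ciota (BqKZ.coefAct BqKZ.iotaB (BqKZ.Phi n q k κ)) := by
  have h := BqKZ.isAsymptoticallyFree_Psi (n := n) q k κ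
  refine ⟨⟨_, h, fun Ψ hΨ => hΨ.unique h⟩, h, ?_, (BqKZ.tauIota_Phi q k κ).symm⟩
  rw [BqKZ.tau_iota, BqKZ.tauIota_Phi]
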